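/- Let $(M,g)$ be a connected smooth Riemannian manifold (Hausdorff, second countable, without boundary, not necessarily complete) and let $\gamma:\mathbb{R}\to M$ be a geodesic parameterized with arc length. Let $\mathrm{Isom}(M,g)$ be the full isometry group with the compact-open topology, and put $$G_\gamma(s)=\{a\in \mathrm{Isom}(M,g)\;:\; a(\gamma(t))=\gamma(t+s)\ \ \forall t\in\mathbb{R}\},\qquad G_\gamma=\bigcup_{s\in\mathbb{R}}G_\gamma(s),$$ a subgroup of $\mathrm{Isom}(M,g)$. Then $G_\gamma$, with its natural topology, is a (finite-dimensional, Hausdorff, second countable) Lie group. Precisely: 1. If $\gamma$ is periodic, then $G_\gamma$ is a compact, closed subgroup of $\mathrm{Isom}(M,g)$, and it is a Lie group in the topology induced from $\mathrm{Isom}(M,g)$. 2. If $\gamma$ is not periodic (in particular, if $\gamma$ is injective), then every $a\in G_\gamma$ lies in $G_\gamma(s)$ for a unique $s=:\eta(a)$. Let $\Pi_s:T_{\gamma(0)}M\to T_{\gamma(s)}M$ be the Levi-Civita parallel transport along $\gamma$, and put $\varphi(a)=\Pi_{\eta(a)}^{-1}\circ (da)_{\gamma(0)}$. Then $\varphi(a)$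 is an orthogonal transformation of $T_{\gamma(0)}M$ that fixes $\gamma'(0)$, and $a\mapsto(\eta(a),\varphi(a))$ is an injective group homomorphism of $G_\gamma$ into $\mathbb{R}\times O(T_{\gamma(0)}M)$ with closed image. With the topology induced by this map, $G_\gamma$ is a Lie group, and the inclusion $G_\gamma\to\mathrm{Isom}(M,g)$ is continuous. -/

import Mathlib

open scoped Manifold ContDiff Topology
open Bundle

namespace RiemGeod

noncomputable section

variable {n : ℕ} {M : Type*} [TopologicalSpace M] [ChartedSpace (EuclideanSpace ℝ (Fin n)) M]
  [IsManifold (𝓡 n) ∞ M]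

/-- A smooth Riemannian metric on the smooth `n`-manifold `M`. -/
abbrev Metric (n : ℕ) (M : Type*) [TopologicalSpace M]
    [ChartedSpace (EuclideanSpace ℝ (Fin n)) M] [IsManifold (𝓡 n) ∞ M] :=
  ContMDiffRiemannianMetric (𝓡 n) ∞ (EuclideanSpace ℝ (Fin n))
    (fun x : M => TangentSpace (𝓡 n) x)

/-! ### Isometries -/

/-- `f` is a smooth map that preserves the metric tensor. -/
def PreservesMetric (g : Metric n M) (f : M → M) : Prop :=
  ContMDiff (𝓡 n) (𝓡 n) ∞ f ∧
    ∀ (x : M) (v w : TangentSpace (𝓡 n) x),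
      g.inner (f x) (mfderiv (𝓡 n) (𝓡 n) f x v) (mfderiv (𝓡 n) (𝓡 n) f x w) = g.inner x v w

theorem PreservesMetric.comp {g : Metric n M} {f h : M → M}
    (hf : PreservesMetric g f) (hh : PreservesMetric g h) : PreservesMetric g (f ∘ h) := by
  refine ⟨hf.1.comp hh.1, fun x v w => ?_⟩
  rw [mfderiv_comp x (hf.1.mdifferentiable (by simp) _) (hh.1.mdifferentiable (by simp) _)]
  exact (hf.2 (h x) _ _).trans (hh.2 x v w)

theorem PreservesMetric.id (g : Metric n M) : PreservesMetric g (fun x : M => x) := by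
  refine ⟨contMDiff_id, fun x v w => ?_⟩
  change g.inner x (mfderiv (𝓡 n) (𝓡 n) (_root_.id : M → M) x v)
    (mfderiv (𝓡 n) (𝓡 n) (_root_.id : M → M) x w) = _
  rw [mfderiv_id]
  rfl

/-- The full isometry group `Isom(M, g)`: the diffeomorphisms of `M` that preserve `g`, with
composition as multiplication. -/
def Isom (g : Metric n M) : Subgroup (M ≃ₜ M) where
  carrier := {f | PreservesMetric g f ∧ PreservesMetric g f.symm}
  mul_mem' := fun ha hb => ⟨ha.1.comp hb.1, hb.2.comp ha.2⟩
  one_mem' := ⟨PreservesMetric.id g, PreservesMetric.id g⟩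
  inv_mem' := fun ha => ⟨ha.2, ha.1⟩

/-- The compact-open topology on `Isom(M, g)`. -/
instance (g : Metric n M) : TopologicalSpace (Isom g) :=
  TopologicalSpace.induced (fun a => (⟨a.1, a.1.continuous⟩ : C(M, M))) inferInstance

/-! ### The Levi-Civita connection along curves, geodesics, parallel transport -/

/-- The metric in the chart at `x`: at the point `y` of the chart's target, the value
`g_y(v, w)` on the vectors with coordinates `v`, `w`. -/
def chartMetric (g : Metric n M) (x : M) (y v w : EuclideanSpace ℝ (Fin n)) : ℝ :=
  g.inner ((extChartAt (𝓡 n) x).symm y)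
    (mfderiv (𝓡 n) (𝓡 n) (extChartAt (𝓡 n) x).symm y v)
    (mfderiv (𝓡 n) (𝓡 n) (extChartAt (𝓡 n) x).symm y w)

/-- The derivative at `y` in the direction `u` of the function `z ↦ g_z(v, w)` in the chart
at `x`. -/
def dChartMetric (g : Metric n M) (x : M) (y u v w : EuclideanSpace ℝ (Fin n)) : ℝ :=
  fderiv ℝ (fun z => chartMetric g x z v w) y u

/-- The Christoffel symbols of the first kind of `g` in the chart at `x`, as a trilinear form:
`Γ_y(u, v; w) = (∂_u g(v, w) + ∂_v g(u, w) - ∂_w g(u, v)) / 2`. -/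
def christoffel (g : Metric n M) (x : M) (y u v w : EuclideanSpace ℝ (Fin n)) : ℝ :=
  (dChartMetric g x y u v w + dChartMetric g x y v u w - dChartMetric g x y w u v) / 2

/-- The velocity `γ'(t)` of a curve. -/
def velocity (n : ℕ) {M : Type*} [TopologicalSpace M]
    [ChartedSpace (EuclideanSpace ℝ (Fin n)) M] (γ : ℝ → M) (t : ℝ) :
    TangentSpace (𝓡 n) (γ t) :=
  mfderiv 𝓘(ℝ, ℝ) (𝓡 n) γ t (1 : ℝ)

/-- The coordinates, in the chart at `x`, of the vector `V t` tangent to `M` at `γ t`. -/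
def chartCoord (γ : ℝ → M) (V : (t : ℝ) → TangentSpace (𝓡 n) (γ t)) (x : M) (t : ℝ) :
    EuclideanSpace ℝ (Fin n) :=
  mfderiv (𝓡 n) (𝓡 n) (extChartAt (𝓡 n) x) (γ t) (V t)

/-- The vector field `V` along `γ` is parallel for the Levi-Civita connection of `g`. In each
chart, with `u` and `v` the coordinates of `γ'` and `V`, this is the equation
`g(v', w) + Γ(u, v; w) = 0` for every `w`, that is `v'^k + Γ^k_{ij} u^i v^j = 0`. -/
def IsParallel (g : Metric n M) (γ : ℝ → M) (V : (t : ℝ) → TangentSpace (𝓡 n) (γ t)) : Prop :=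
  ∀ (x : M) (t : ℝ), γ t ∈ (extChartAt (𝓡 n) x).source →
    ∃ v' : EuclideanSpace ℝ (Fin n), HasDerivAt (chartCoord γ V x) v' t ∧
      ∀ w : EuclideanSpace ℝ (Fin n),
        chartMetric g x (extChartAt (𝓡 n) x (γ t)) v' w +
          christoffel g x (extChartAt (𝓡 n) x (γ t))
            (chartCoord γ (velocity n γ) x t) (chartCoord γ V x t) w = 0

/-- `γ : ℝ → M` is a geodesic of `(M, g)` parameterized with arc length: it is smooth, its
velocity is parallel along it, and has length one. -/
structure IsUnitSpeedGeodesic (g : Metric n M) (γ : ℝ → M) : Prop where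
  smooth : ContMDiff 𝓘(ℝ, ℝ) (𝓡 n) ∞ γ
  parallel : IsParallel g γ (velocity n γ)
  unit : ∀ t, g.inner (γ t) (velocity n γ t) (velocity n γ t) = 1

/-- `L` is the parallel transport along `γ` from `M_{γ(s)}` to `M_{γ(t)}`. -/
def IsParallelTransport (g : Metric n M) (γ : ℝ → M) (s t : ℝ)
    (L : TangentSpace (𝓡 n) (γ s) →L[ℝ] TangentSpace (𝓡 n) (γ t)) : Prop :=
  ∀ v, ∃ V : (r : ℝ) → TangentSpace (𝓡 n) (γ r), IsParallel g γ V ∧ V s = v ∧ V t = L v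

open Classical in
/-- The parallel transport along `γ` from `M_{γ(s)}` to `M_{γ(t)}`; for a smooth curve
there is exactly one `L` as in `IsParallelTransport`. -/
def parallelTransport (g : Metric n M) (γ : ℝ → M) (s t : ℝ) :
    TangentSpace (𝓡 n) (γ s) →L[ℝ] TangentSpace (𝓡 n) (γ t) :=
  if h : ∃ L, IsParallelTransport g γ s t L then h.choose else 0

/-! ### The group `G_γ` -/

/-- `G_γ`: the group of all isometries `a` such that, for some `s`,
`a(γ(t)) = γ(t + s)` for all `t`. -/
def G (g : Metric n M) (γ : ℝ → M) : Subgroup (Isom g) where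
  carrier := {a | ∃ s : ℝ, ∀ t : ℝ, a.1 (γ t) = γ (t + s)}
  mul_mem' := by
    rintro a b ⟨s, hs⟩ ⟨s', hs'⟩
    refine ⟨s' + s, fun t => ?_⟩
    change a.1 (b.1 (γ t)) = _
    rw [hs', hs, add_assoc]
  one_mem' := ⟨0, fun t => by rw [add_zero]; rfl⟩
  inv_mem' := by
    rintro a ⟨s, hs⟩
    refine ⟨-s, fun t => ?_⟩
    change a.1.symm (γ t) = _
    rw [Homeomorph.symm_apply_eq, hs, neg_add_cancel_right]

/-- `γ` is periodic. -/
def IsPeriodic (γ : ℝ → M) : Prop := ∃ p : ℝ, 0 < p ∧ Function.Periodic γ p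

/-- The translation `η(a)`: a number `s` with `a(γ(t)) = γ(t + s)` for all `t`. It is unique
when `γ` is not periodic. -/
def shift {g : Metric n M} {γ : ℝ → M} (a : G g γ) : ℝ := a.2.choose

theorem shift_spec {g : Metric n M} {γ : ℝ → M} (a : G g γ) (t : ℝ) :
    a.1.1 (γ t) = γ (t + shift a) := a.2.choose_spec t

/-- The identity `M_x = M_y` for equal points `x = y`. -/
def tangentCast {x y : M} (h : x = y) : TangentSpace (𝓡 n) x →L[ℝ] TangentSpace (𝓡 n) y :=
  h ▸ ContinuousLinearMap.id ℝ (TangentSpace (𝓡 n) x)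

/-- The differential of `a ∈ G_γ` at `γ(0)`, as a map from `M_{γ(0)}` to `M_{γ(s)}`,
`s = η(a)`. -/
def differential {g : Metric n M} {γ : ℝ → M} (a : G g γ) :
    TangentSpace (𝓡 n) (γ 0) →L[ℝ] TangentSpace (𝓡 n) (γ (shift a)) :=
  (tangentCast (by rw [shift_spec, zero_add])).comp
    (mfderiv (𝓡 n) (𝓡 n) (a.1.1 : M → M) (γ 0))

/-- `φ(a) = Π_s⁻¹ ∘ (T a)_{γ(0)}`, an endomorphism of `M_{γ(0)}`, where `s = η(a)` and `Π_s⁻¹` is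
the parallel transport along `γ` from `M_{γ(s)}` back to `M_{γ(0)}`. -/
def rotation {g : Metric n M} {γ : ℝ → M} (a : G g γ) :
    TangentSpace (𝓡 n) (γ 0) →L[ℝ] TangentSpace (𝓡 n) (γ 0) :=
  (parallelTransport g γ (shift a) 0).comp (differential a)

/-- The map `a ↦ (η(a), φ(a))`. -/
def development (g : Metric n M) (γ : ℝ → M) (a : G g γ) :
    ℝ × (TangentSpace (𝓡 n) (γ 0) →L[ℝ] TangentSpace (𝓡 n) (γ 0)) :=
  (shift a, rotation a)

/-- The natural topology on `G_γ` for a non-periodic `γ`: the one induced by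
`a ↦ (η(a), φ(a))`. -/
abbrev naturalTopology (g : Metric n M) (γ : ℝ → M) : TopologicalSpace (G g γ) :=
  TopologicalSpace.induced (development g γ) inferInstance

/-- The group `G` with the given topology is a (finite-dimensional, real, smooth, Hausdorff and
second countable) Lie group: it carries a smooth atlas, compatible with that topology, for which
the group operations are smooth. -/
def IsLieGroup (G : Type*) [Group G] [TopologicalSpace G] : Prop :=
  T2Space G ∧ SecondCountableTopology G ∧
    ∃ (k : ℕ) (_ : ChartedSpace (EuclideanSpace ℝ (Fin k)) G), LieGroup (𝓡 k) ∞ G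

end

end RiemGeod

/-! An isometry is governed by its 1-jet at one point. In charts, differentiating $f^*h' = h$ and
using the symmetry of $D^2f$ expresses $D^2f$ through $f$, $Df$ and the Christoffel symbols
(`fderiv_fderiv_of_isometry`), so the 1-jet solves a total differential equation $DJ = \Psi(w,J)$
with $\Psi$ smooth. By Grönwall, convergence of 1-jets at one point of a chart ball spreads
uniformly over the ball, and the limit is smooth (`jet_convergence`). Since metric-preserving maps
are uniformly Lipschitz in charts, an open-closed argument on the connected $M$ makes convergence of
differentials at one point global, with a metric-preserving limit (`exists_limit`). If the inverses
converge too, the limit is an isometry. Completeness of $M$ plays no role.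

Now consider pairs $(s,a)$ with $a(\gamma(t))=\gamma(t+s)$. As $a$ commutes with parallel transport
along $\gamma$, the pair $(s, \Pi_s^{-1}\circ da)$ is multiplicative in $(s,a)$, and it recovers
$da$ at $\gamma(0)$. Hence $(s,a)\mapsto(e^s,\Pi_s^{-1}da)$ is an injective homomorphism into the
units of the algebra $\mathbb{R}\times\mathrm{End}$. Its image is closed: if $s$ and the orthogonal
parts converge, the limit of the orthogonal parts is again orthogonal, so the differentials and
those of the inverses converge, and `exists_limit` supplies the limit isometry.

Closed groups of units are Lie groups by von Neumann's argument (`eventually_log_mem_lieAlg`), and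
so are their quotients by discrete normal subgroups (`exists_lieGroup_of_quotient`). The group
$G_\gamma$ is the quotient of the image by the pairs $(s,1)$, i.e. by the $s$ with
$\gamma(t+s)=\gamma(t)$ for all $t$. Without periods the quotient map is a homeomorphism for the
natural topology. With a period $p$ the number $s$ can be kept in $[0,p]$, and orthogonal maps are
bounded. This gives compactness of $G_\gamma$ and openness of the quotient map onto the compact-open
topology, while unit speed makes the periods discrete. -/

namespace RiemGeod

/-! ### Riemannian metrics in coordinates and the Christoffel symbols -/

section Coordinates

set_option maxSynthPendingDepth 3

variable {E : Type*} [NormedAddCommGroup E] [NormedSpace ℝ E]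

/-- A smooth Riemannian metric on an open subset `U` of a vector space. -/
structure IsCoordMetric (U : Set E) (h : E → E →L[ℝ] E →L[ℝ] ℝ) : Prop where
  isOpen : IsOpen U
  smooth : ContDiffOn ℝ ∞ h U
  symm : ∀ y ∈ U, ∀ v w, h y v w = h y w v
  pos : ∀ y ∈ U, ∀ v, v ≠ 0 → 0 < h y v v

/-- The Christoffel symbols of the first kind of `h`, as a continuous trilinear form. -/
noncomputable def christoffelForm (h : E → E →L[ℝ] E →L[ℝ] ℝ) (y : E) :
    E →L[ℝ] E →L[ℝ] E →L[ℝ] ℝ :=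
  (2⁻¹ : ℝ) • (fderiv ℝ h y + (fderiv ℝ h y).flip -
    (ContinuousLinearMap.flipₗᵢ ℝ E E ℝ).toContinuousLinearEquiv.toContinuousLinearMap.comp
      (fderiv ℝ h y).flip)

theorem christoffelForm_apply (h : E → E →L[ℝ] E →L[ℝ] ℝ) (y u v w : E) :
    christoffelForm h y u v w =
      (fderiv ℝ h y u v w + fderiv ℝ h y v u w - fderiv ℝ h y w u v) / 2 := by
  simp [christoffelForm]
  ring

/-- The Christoffel symbols of the second kind of `h`, as a continuous bilinear map. -/
noncomputable def christoffelMap (h : E → E →L[ℝ] E →L[ℝ] ℝ) (y : E) : E →L[ℝ] E →L[ℝ] E :=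
  (ContinuousLinearMap.compL ℝ E (E →L[ℝ] ℝ) E (h y).inverse).comp (christoffelForm h y)

theorem christoffelMap_apply (h : E → E →L[ℝ] E →L[ℝ] ℝ) (y u v : E) :
    christoffelMap h y u v = (h y).inverse (christoffelForm h y u v) := rfl

namespace IsCoordMetric

variable {U U' : Set E} {h h' : E → E →L[ℝ] E →L[ℝ] ℝ}

theorem eq_zero_of_forall (hh : IsCoordMetric U h) {y : E} (hy : y ∈ U) {v : E}
    (hv : ∀ w, h y v w = 0) : v = 0 := by
  by_contra hne
  exact (hh.pos y hy v hne).ne' (hv v)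

theorem contDiffOn_fderiv (hh : IsCoordMetric U h) : ContDiffOn ℝ ∞ (fderiv ℝ h) U :=
  hh.smooth.fderiv_of_isOpen hh.isOpen (by simp)

theorem hasFDerivAt (hh : IsCoordMetric U h) {y : E} (hy : y ∈ U) :
    HasFDerivAt h (fderiv ℝ h y) y :=
  ((hh.smooth.contDiffAt (hh.isOpen.mem_nhds hy)).differentiableAt (by simp)).hasFDerivAt

set_option synthInstance.maxHeartbeats 100000 in
theorem contDiffOn_christoffelForm (hh : IsCoordMetric U h) :
    ContDiffOn ℝ ∞ (christoffelForm h) U := by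
  have h1 := hh.contDiffOn_fderiv
  have h2 : ContDiffOn ℝ ∞ (fun y => (fderiv ℝ h y).flip) U :=
    (ContinuousLinearMap.flipₗᵢ ℝ E E (E →L[ℝ] ℝ)).toContinuousLinearEquiv.contDiff.comp_contDiffOn h1
  exact ((h1.add h2).sub (contDiffOn_const.clm_comp h2)).const_smul _

variable [FiniteDimensional ℝ E]

/-- Positivity makes `h y` injective into a dual of the same dimension. Hence `(h y).inverse` in
`christoffelMap` is a true inverse on `U` and not the default value zero. -/
theorem exists_equiv (hh : IsCoordMetric U h) {y : E} (hy : y ∈ U) :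
    ∃ e : E ≃L[ℝ] (E →L[ℝ] ℝ), (e : E →L[ℝ] (E →L[ℝ] ℝ)) = h y := by
  have hinj : Function.Injective (h y : E →ₗ[ℝ] (E →L[ℝ] ℝ)) := by
    rw [← LinearMap.ker_eq_bot, LinearMap.ker_eq_bot']
    intro v hv
    refine hh.eq_zero_of_forall hy fun w => ?_
    have : h y v = 0 := hv
    rw [this]; rfl
  have hfr : Module.finrank ℝ E = Module.finrank ℝ (E →L[ℝ] ℝ) := by
    rw [← (LinearMap.toContinuousLinearMap (𝕜 := ℝ) (E := E) (F' := ℝ)).finrank_eq]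
    exact (Subspace.dual_finrank_eq (K := ℝ) (V := E)).symm
  refine ⟨(LinearEquiv.ofInjectiveOfFinrankEq (h y : E →ₗ[ℝ] (E →L[ℝ] ℝ)) hinj hfr).toContinuousLinearEquiv, ?_⟩
  ext v w
  rfl

theorem apply_christoffelMap (hh : IsCoordMetric U h) {y : E} (hy : y ∈ U) (u v : E) :
    h y (christoffelMap h y u v) = christoffelForm h y u v := by
  obtain ⟨e, he⟩ := hh.exists_equiv hy
  rw [christoffelMap_apply, ← he, ContinuousLinearMap.inverse_equiv]
  simp

theorem contDiffOn_christoffelMap (hh : IsCoordMetric U h) :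
    ContDiffOn ℝ ∞ (christoffelMap h) U := by
  refine ContDiffOn.clm_comp ?_ hh.contDiffOn_christoffelForm
  refine (ContinuousLinearMap.compL ℝ E (E →L[ℝ] ℝ) E).contDiff.comp_contDiffOn ?_
  intro y hy
  obtain ⟨e, he⟩ := hh.exists_equiv hy
  have := contDiffAt_map_inverse (n := ∞) e
  rw [he] at this
  exact this.comp_contDiffWithinAt y (hh.smooth y hy)

/-- This allows a vector identity at the image point to be tested only against vectors `fderiv ℝ f x
w`. -/
theorem surjective_of_isometry (hh : IsCoordMetric U h) {x y : E} (hx : x ∈ U) {L : E →L[ℝ] E}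
    (hL : ∀ v, h' y (L v) (L v) = h x v v) : Function.Surjective L := by
  have hinj : Function.Injective (L : E →ₗ[ℝ] E) := by
    rw [← LinearMap.ker_eq_bot, LinearMap.ker_eq_bot']
    intro v hv
    by_contra hne
    have h1 := hh.pos x hx v hne
    have : L v = 0 := hv
    rw [← hL, this] at h1
    simp at h1
  exact LinearMap.injective_iff_surjective.1 hinj

/-- The transformation law of the Christoffel symbols under a local isometry. -/
theorem fderiv_fderiv_of_isometry (hh : IsCoordMetric U h) (hh' : IsCoordMetric U' h')
    {f : E → E} {x : E} (hx : x ∈ U) (hfx : f x ∈ U') (hf : ContDiffAt ℝ 2 f x)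
    (hiso : ∀ᶠ z in 𝓝 x, ∀ v w, h' (f z) (fderiv ℝ f z v) (fderiv ℝ f z w) = h z v w) (u v : E) :
    fderiv ℝ (fderiv ℝ f) x u v = fderiv ℝ f x (christoffelMap h x u v) -
      christoffelMap h' (f x) (fderiv ℝ f x u) (fderiv ℝ f x v) := by
  have hf1 : HasFDerivAt f (fderiv ℝ f x) x := (hf.differentiableAt (by simp)).hasFDerivAt
  have hf2 : HasFDerivAt (fderiv ℝ f) (fderiv ℝ (fderiv ℝ f) x) x :=
    ((hf.fderiv_right (m := 1) (by norm_num)).differentiableAt (by simp)).hasFDerivAt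
  have hsymm : ∀ a b, fderiv ℝ (fderiv ℝ f) x a b = fderiv ℝ (fderiv ℝ f) x b a :=
    hf.isSymmSndFDerivAt (by simp)
  have hpt := hiso.self_of_nhds
  -- The isometry equation differentiated in the direction `a`.
  have key : ∀ a b c, fderiv ℝ h' (f x) (fderiv ℝ f x a) (fderiv ℝ f x b) (fderiv ℝ f x c) +
      h' (f x) (fderiv ℝ (fderiv ℝ f) x a b) (fderiv ℝ f x c) +
      h' (f x) (fderiv ℝ (fderiv ℝ f) x a c) (fderiv ℝ f x b) = fderiv ℝ h x a b c := by
    intro a b c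
    have e1 : HasFDerivAt (fun z => h z b c)
        (((fderiv ℝ h x).flip b).flip c) x := by
      have := ((hh.hasFDerivAt hx).clm_apply (hasFDerivAt_const b x)).clm_apply
        (hasFDerivAt_const c x)
      refine this.congr_fderiv ?_
      ext; simp
    have e2 := (((hh'.hasFDerivAt hfx).comp x hf1).clm_apply
      (hf2.clm_apply (hasFDerivAt_const b x))).clm_apply (hf2.clm_apply (hasFDerivAt_const c x))
    have e3 : HasFDerivAt (fun z => h z b c) _ x := e2.congr_of_eventuallyEq
      (hiso.mono fun z hz => (hz b c).symm)
    have := congrArg (fun L : E →L[ℝ] ℝ => L a) (e1.unique e3)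
    simp at this
    rw [this, hh'.symm _ hfx (fderiv ℝ (fderiv ℝ f) x a c)]
    ring
  -- Koszul's trick: in the sum of `key` at (u,v,w) and (v,u,w) minus the one at (w,u,v), symmetry
  -- of the second derivative cancels every second-order term except twice the wanted one.
  have hS : ∀ w, h' (f x) (fderiv ℝ (fderiv ℝ f) x u v) (fderiv ℝ f x w) =
      christoffelForm h x u v w -
        christoffelForm h' (f x) (fderiv ℝ f x u) (fderiv ℝ f x v) (fderiv ℝ f x w) := by
    intro w
    rw [christoffelForm_apply, christoffelForm_apply]
    have k1 := key u v w
    have k2 := key v u w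
    have k3 := key w u v
    rw [hsymm v u] at k2
    rw [hsymm w u, hsymm w v] at k3
    linarith
  rw [← sub_eq_zero]
  refine hh'.eq_zero_of_forall hfx fun w' => ?_
  obtain ⟨w, rfl⟩ := hh.surjective_of_isometry (h' := h') hx (fun v => hpt v v) w'
  rw [map_sub, map_sub, sub_apply, sub_apply, hS, hpt,
    hh.apply_christoffelMap hx, hh'.apply_christoffelMap hfx]
  ring

end IsCoordMetric

end Coordinates

/-! ### Convergence of 1-jets of local isometries -/

section JetConvergence

set_option maxSynthPendingDepth 3

open Metric Filter

/-- Grönwall's inequality along segments. -/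
theorem norm_le_exp_mul_of_norm_fderiv_le {E F : Type*} [NormedAddCommGroup E] [NormedSpace ℝ E]
    [NormedAddCommGroup F] [NormedSpace ℝ F] {δ : E → F} {δ' : E → E →L[ℝ] F} {s : Set E}
    (hs : Convex ℝ s) {K : ℝ} (hδ : ∀ w ∈ s, HasFDerivAt δ (δ' w) w)
    (hK : ∀ w ∈ s, ‖δ' w‖ ≤ K * ‖δ w‖) {z w : E} (hz : z ∈ s) (hw : w ∈ s) :
    ‖δ w‖ ≤ ‖δ z‖ * Real.exp (K * ‖w - z‖) := by
  have hmem : ∀ t ∈ Set.Icc (0 : ℝ) 1, z + t • (w - z) ∈ s := fun t ht =>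
    hs.add_smul_sub_mem hz hw ht
  have hd : ∀ t ∈ Set.Icc (0 : ℝ) 1, HasDerivAt (fun t : ℝ => δ (z + t • (w - z)))
      (δ' (z + t • (w - z)) (w - z)) t := by
    intro t ht
    have h1 : HasDerivAt (fun t : ℝ => z + t • (w - z)) (w - z) t := by
      simpa using ((hasDerivAt_id t).smul_const (w - z)).const_add z
    exact (hδ _ (hmem t ht)).comp_hasDerivAt t h1
  have := norm_le_gronwallBound_of_norm_deriv_right_le (δ := ‖δ z‖) (K := K * ‖w - z‖) (ε := 0)
    (f := fun t : ℝ => δ (z + t • (w - z))) (a := 0) (b := 1)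
    (fun t ht => (hd t ht).continuousAt.continuousWithinAt)
    (fun t ht => (hd t ⟨ht.1, ht.2.le⟩).hasDerivWithinAt) (by simp) (fun t ht => by
      have h2 := hK _ (hmem t ⟨ht.1, ht.2.le⟩)
      calc _ ≤ ‖δ' (z + t • (w - z))‖ * ‖w - z‖ := ContinuousLinearMap.le_opNorm _ _
        _ ≤ K * ‖δ (z + t • (w - z))‖ * ‖w - z‖ := by gcongr
        _ = _ := by ring) 1 ⟨zero_le_one, le_rfl⟩
  rw [gronwallBound_ε0] at this
  simpa using this

variable {E : Type*} [NormedAddCommGroup E] [NormedSpace ℝ E]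

/-- The total differential equation `DJ = jetField h h' (w, J)` satisfied by the `1`-jet
`J = (f, Df)` of a local isometry `f` from `h` to `h'`. -/
noncomputable def jetField (h h' : E → E →L[ℝ] E →L[ℝ] ℝ) (q : E × (E × (E →L[ℝ] E))) :
    E →L[ℝ] E × (E →L[ℝ] E) :=
  q.2.2.prod ((ContinuousLinearMap.compL ℝ E E E q.2.2).comp (christoffelMap h q.1) -
    ((ContinuousLinearMap.compL ℝ E E E).flip q.2.2).comp
      ((christoffelMap h' q.2.1).comp q.2.2))

variable {U U' : Set E} {h h' : E → E →L[ℝ] E →L[ℝ] ℝ} [FiniteDimensional ℝ E]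

theorem contDiffOn_jetField (hh : IsCoordMetric U h) (hh' : IsCoordMetric U' h') :
    ContDiffOn ℝ ∞ (jetField h h') (U ×ˢ (U' ×ˢ Set.univ)) := by
  have hP : ContDiff ℝ ∞ (fun q : E × (E × (E →L[ℝ] E)) => q.2.2) := contDiff_snd.snd
  have hC : ContDiffOn ℝ ∞ (fun q : E × (E × (E →L[ℝ] E)) => christoffelMap h q.1)
      (U ×ˢ (U' ×ˢ Set.univ)) :=
    hh.contDiffOn_christoffelMap.comp contDiff_fst.contDiffOn fun q hq => hq.1
  have hC' : ContDiffOn ℝ ∞ (fun q : E × (E × (E →L[ℝ] E)) => christoffelMap h' q.2.1)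
      (U ×ˢ (U' ×ˢ Set.univ)) :=
    hh'.contDiffOn_christoffelMap.comp contDiff_snd.fst.contDiffOn fun q hq => hq.2.1
  have h1 : ContDiffOn ℝ ∞ (fun q : E × (E × (E →L[ℝ] E)) =>
      (ContinuousLinearMap.compL ℝ E E E q.2.2).comp (christoffelMap h q.1))
      (U ×ˢ (U' ×ˢ Set.univ)) :=
    ((ContinuousLinearMap.compL ℝ E E E).contDiff.comp hP).contDiffOn.clm_comp hC
  have h2 : ContDiffOn ℝ ∞ (fun q : E × (E × (E →L[ℝ] E)) =>
      ((ContinuousLinearMap.compL ℝ E E E).flip q.2.2).comp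
      ((christoffelMap h' q.2.1).comp q.2.2)) (U ×ˢ (U' ×ˢ Set.univ)) :=
    ((ContinuousLinearMap.compL ℝ E E E).flip.contDiff.comp hP).contDiffOn.clm_comp
      (hC'.clm_comp hP.contDiffOn)
  exact (ContinuousLinearMap.prodₗᵢ ℝ (𝕜 := ℝ) : ((E →L[ℝ] E) × (E →L[ℝ] E →L[ℝ] E)) ≃ₗᵢ[ℝ]
    _).toContinuousLinearEquiv.contDiff.comp_contDiffOn (hP.contDiffOn.prodMk (h1.sub h2))

/-- The transformation law of the Christoffel symbols is a formula for second derivatives in terms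
of first ones, so it closes up into a first-order system for the 1-jet. -/
theorem hasFDerivAt_jet_of_isometry (hh : IsCoordMetric U h) (hh' : IsCoordMetric U' h')
    {f : E → E} {x : E} (hx : x ∈ U) (hfx : f x ∈ U') (hf : ContDiffAt ℝ 2 f x)
    (hiso : ∀ᶠ z in 𝓝 x, ∀ v w, h' (f z) (fderiv ℝ f z v) (fderiv ℝ f z w) = h z v w) :
    HasFDerivAt (fun z => (f z, fderiv ℝ f z)) (jetField h h' (x, (f x, fderiv ℝ f x))) x := by
  have hf1 : HasFDerivAt f (fderiv ℝ f x) x := (hf.differentiableAt (by simp)).hasFDerivAt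
  have hf2 : HasFDerivAt (fderiv ℝ f) (fderiv ℝ (fderiv ℝ f) x) x :=
    ((hf.fderiv_right (m := 1) (by norm_num)).differentiableAt (by simp)).hasFDerivAt
  refine (hf1.prodMk hf2).congr_fderiv ?_
  refine ContinuousLinearMap.ext fun u => Prod.ext rfl ?_
  refine ContinuousLinearMap.ext fun v => ?_
  exact hh.fderiv_fderiv_of_isometry hh' hx hfx hf hiso u v

/-- If the `1`-jets of a family of local isometries converge at one point of a ball, they converge
at all points of the ball, and the limit is smooth. -/
theorem jet_convergence (hh : IsCoordMetric U h) (hh' : IsCoordMetric U' h')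
    {ι : Type*} {l : Filter ι} [NeBot l] {f : ι → E → E} {x y : E} {r R C : ℝ}
    (hU : closedBall x r ⊆ U) (hU' : closedBall y R ⊆ U')
    (hf : ∀ᶠ i in l, ContDiffOn ℝ ∞ (f i) (ball x r) ∧ ∀ w ∈ ball x r,
      f i w ∈ closedBall y R ∧ ‖fderiv ℝ (f i) w‖ ≤ C ∧
      ∀ u v, h' (f i w) (fderiv ℝ (f i) w u) (fderiv ℝ (f i) w v) = h w u v)
    {z : E} (hz : z ∈ ball x r) {p : E} {L : E →L[ℝ] E}
    (hp : Tendsto (fun i => f i z) l (𝓝 p)) (hL : Tendsto (fun i => fderiv ℝ (f i) z) l (𝓝 L)) :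
    ∃ F : E → E, ContDiffOn ℝ ∞ F (ball x r) ∧ ∀ w ∈ ball x r, F w ∈ closedBall y R ∧
      Tendsto (fun i => f i w) l (𝓝 (F w)) ∧
      Tendsto (fun i => fderiv ℝ (f i) w) l (𝓝 (fderiv ℝ F w)) := by
  set J : ι → E → E × (E →L[ℝ] E) := fun i w => (f i w, fderiv ℝ (f i) w) with hJ
  have hΨ := contDiffOn_jetField hh hh'
  have hopen : IsOpen (U ×ˢ (U' ×ˢ (Set.univ : Set (E →L[ℝ] E)))) :=
    hh.isOpen.prod (hh'.isOpen.prod isOpen_univ)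
  -- A compact convex set that contains all the jets: compactness bounds the derivative of
  -- `jetField`, and convexity turns the bound into a Lipschitz constant.
  set T : Set (E × (E × (E →L[ℝ] E))) := closedBall x r ×ˢ (closedBall y R ×ˢ closedBall 0 C)
    with hT
  have hTU : T ⊆ U ×ˢ (U' ×ˢ Set.univ) :=
    Set.prod_mono hU (Set.prod_mono hU' (Set.subset_univ _))
  have hTc : IsCompact T :=
    (isCompact_closedBall x r).prod ((isCompact_closedBall y R).prod (isCompact_closedBall 0 C))
  have hTconv : Convex ℝ T :=
    (convex_closedBall x r).prod ((convex_closedBall y R).prod (convex_closedBall 0 C))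
  obtain ⟨k, hk⟩ : ∃ k : ℝ, ∀ q ∈ T, ‖fderiv ℝ (jetField h h') q‖ ≤ k := by
    have := hTc.exists_bound_of_continuousOn (f := fderiv ℝ (jetField h h'))
      ((hΨ.continuousOn_fderiv_of_isOpen hopen (by simp)).mono hTU)
    exact this
  have hlip : ∀ q ∈ T, ∀ q' ∈ T, ‖jetField h h' q - jetField h h' q'‖ ≤ k * ‖q - q'‖ := by
    intro q hq q' hq'
    refine hTconv.norm_image_sub_le_of_norm_fderiv_le (𝕜 := ℝ) (fun a ha => ?_) hk hq' hq
    exact (hΨ.contDiffAt (hopen.mem_nhds (hTU ha))).differentiableAt (by simp)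
  have hgood : ∀ᶠ i in l, ∀ w ∈ ball x r, (w, J i w) ∈ T ∧
      HasFDerivAt (J i) (jetField h h' (w, J i w)) w := by
    filter_upwards [hf] with i hi w hw
    obtain ⟨h1, h2, h3⟩ := hi.2 w hw
    refine ⟨⟨ball_subset_closedBall hw, h1, by simpa using h2⟩, ?_⟩
    have hn := isOpen_ball.mem_nhds hw
    refine hasFDerivAt_jet_of_isometry hh hh' (hU (ball_subset_closedBall hw)) (hU' h1)
      ((hi.1.contDiffAt hn).of_le (by norm_cast)) ?_
    filter_upwards [hn] with a ha using (hi.2 a ha).2.2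
  have hnorm : ∀ (w : E) (a b : E × (E →L[ℝ] E)), ‖(w, a) - (w, b)‖ = ‖a - b‖ := by
    intro w a b
    simp [Prod.norm_def]
  have hk0 : 0 ≤ k := by
    obtain ⟨i, hi⟩ := hgood.exists
    exact (norm_nonneg _).trans (hk _ (hi z hz).1)
  have hJz : Tendsto (fun i => J i z) l (𝓝 (p, L)) := hp.prodMk_nhds hL
  -- Grönwall for the difference of two solutions of the same equation; `2 * r` bounds the distance
  -- from `z` to `w`.
  have hdiff : ∀ᶠ m in l ×ˢ l, ∀ w ∈ ball x r,
      ‖J m.1 w - J m.2 w‖ ≤ ‖J m.1 z - J m.2 z‖ * Real.exp (k * (2 * r)) := by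
    filter_upwards [hgood.prod_mk hgood] with m hm w hw
    have := norm_le_exp_mul_of_norm_fderiv_le (convex_ball x r) (δ := fun w => J m.1 w - J m.2 w)
      (K := k) (fun a ha => (hm.1 a ha).2.sub (hm.2 a ha).2) (fun a ha => by
        rw [← hnorm a]; exact hlip _ (hm.1 a ha).1 _ (hm.2 a ha).1) hz hw
    refine this.trans ?_
    gcongr
    rw [mem_ball] at hz hw
    rw [← dist_eq_norm]
    linarith [dist_triangle_right w z x]
  have hcauchy : UniformCauchySeqOn J l (ball x r) := by
    intro u hu
    obtain ⟨ε, hε, hεu⟩ := Metric.mem_uniformity_dist.1 hu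
    have h0 : Tendsto (fun m : ι × ι => ‖J m.1 z - J m.2 z‖ * Real.exp (k * (2 * r)))
        (l ×ˢ l) (𝓝 0) := by
      have := (((hJz.comp tendsto_fst).sub (hJz.comp (tendsto_snd (f := l)))).norm).mul_const
        (Real.exp (k * (2 * r)))
      simpa only [sub_self, norm_zero, zero_mul, Function.comp_def] using this
    filter_upwards [hdiff, h0.eventually (gt_mem_nhds hε)] with m hm hmε w hw
    exact hεu (by rw [dist_eq_norm]; exact (hm w hw).trans_lt hmε)
  have hlim : ∀ w ∈ ball x r, ∃ q, Tendsto (fun i => J i w) l (𝓝 q) := fun w hw =>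
    cauchy_map_iff_exists_tendsto.1 (hcauchy.cauchy_map hw)
  choose! G hG using hlim
  have hunif : TendstoUniformlyOn J G l (ball x r) := hcauchy.tendstoUniformlyOn_of_tendsto hG
  have hGT : ∀ w ∈ ball x r, (w, G w) ∈ T := by
    intro w hw
    refine hTc.isClosed.mem_of_tendsto (tendsto_const_nhds.prodMk_nhds (hG w hw)) ?_
    exact hgood.mono fun i hi => (hi w hw).1
  have hunif' : TendstoUniformlyOn (fun i w => jetField h h' (w, J i w))
      (fun w => jetField h h' (w, G w)) l (ball x r) := by
    rw [Metric.tendstoUniformlyOn_iff] at hunif ⊢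
    intro ε hε
    -- `k + 1` replaces `k`, which may be zero.
    filter_upwards [hunif (ε / (k + 1)) (by positivity), hgood] with i hi hi' w hw
    have h1 := hi w hw
    rw [dist_eq_norm] at h1 ⊢
    rw [lt_div_iff₀ (by positivity)] at h1
    calc _ ≤ k * ‖(w, G w) - (w, J i w)‖ := hlip _ (hGT w hw) _ (hi' w hw).1
      _ = k * ‖G w - J i w‖ := by rw [hnorm]
      _ ≤ ‖G w - J i w‖ * (k + 1) := by nlinarith [norm_nonneg (G w - J i w)]
      _ < ε := h1
  have hGd : ∀ w ∈ ball x r, HasFDerivAt G (jetField h h' (w, G w)) w := by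
    intro w hw
    have hn : ball x r ∈ 𝓝 w := isOpen_ball.mem_nhds hw
    refine hasFDerivAt_of_tendstoUniformlyOnFilter (l := l) (f := J)
      (f' := fun i w => jetField h h' (w, J i w)) (g' := fun w => jetField h h' (w, G w)) ?_ ?_ ?_
    · exact (tendstoUniformlyOn_iff_tendstoUniformlyOnFilter.1 hunif').mono_right
        (le_principal_iff.2 hn)
    · filter_upwards [hgood.prod_mk hn] with q hq using (hq.1 q.2 hq.2).2
    · filter_upwards [hn] with a ha using hG a ha
  -- Bootstrap: the derivative of `G` is the smooth field `jetField` evaluated along `G`, so each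
  -- order of smoothness of `G` yields the next.
  have hGs : ContDiffOn ℝ ∞ G (ball x r) := by
    rw [contDiffOn_infty]
    intro m
    induction m with
    | zero =>
      exact contDiffOn_zero.2 fun w hw => (hGd w hw).continuousAt.continuousWithinAt
    | succ m ih =>
      push_cast
      rw [contDiffOn_succ_iff_fderiv_of_isOpen isOpen_ball]
      refine ⟨fun w hw => (hGd w hw).differentiableAt.differentiableWithinAt, by simp, ?_⟩
      refine ContDiffOn.congr ?_ fun w hw => (hGd w hw).fderiv
      exact (hΨ.of_le (mod_cast le_top)).comp (contDiffOn_id.prodMk ih) fun w hw => hTU (hGT w hw)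
  refine ⟨fun w => (G w).1, hGs.fst, fun w hw => ⟨(hGT w hw).2.1, (hG w hw).fst_nhds, ?_⟩⟩
  -- The first component of `jetField` is the linear part of the jet, so the limit is again a 1-jet.
  have : fderiv ℝ (fun w => (G w).1) w = (G w).2 := by
    rw [(hGd w hw).fst.fderiv]
    rfl
  rw [this]
  exact (hG w hw).snd_nhds

end JetConvergence

/-! ### Metrics, maps and tangent vectors read in charts -/

section Charts

set_option maxSynthPendingDepth 3

open Filter

local notation "𝔼" n => EuclideanSpace ℝ (Fin n)

variable {n : ℕ} {M : Type*} [TopologicalSpace M] [ChartedSpace (EuclideanSpace ℝ (Fin n)) M]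

/-- The metric tensor at `z` as a bilinear form on the model space. -/
noncomputable def form [IsManifold (𝓡 n) ∞ M] (g : Metric n M) (z : M) :
    (𝔼 n) →L[ℝ] (𝔼 n) →L[ℝ] ℝ := g.inner z

/-- The differential at `z` of a self-map of `M`, as a linear map of the model space. -/
noncomputable def der (n : ℕ) {M : Type*} [TopologicalSpace M]
    [ChartedSpace (EuclideanSpace ℝ (Fin n)) M] (f : M → M) (z : M) : (𝔼 n) →L[ℝ] (𝔼 n) :=
  mfderiv (𝓡 n) (𝓡 n) f z

/-- The differential at `z` of the chart at `x`. -/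
noncomputable def chartDer (n : ℕ) {M : Type*} [TopologicalSpace M]
    [ChartedSpace (EuclideanSpace ℝ (Fin n)) M] (x z : M) : (𝔼 n) →L[ℝ] (𝔼 n) :=
  mfderiv (𝓡 n) (𝓡 n) (extChartAt (𝓡 n) x) z

/-- The differential at `y` of the inverse of the chart at `x`. -/
noncomputable def symmDer (x : M) (y : 𝔼 n) : (𝔼 n) →L[ℝ] (𝔼 n) :=
  mfderiv (𝓡 n) (𝓡 n) (extChartAt (𝓡 n) x).symm y

/-- A self-map of `M` read in the charts at `x` and `y`. -/
noncomputable def rep (n : ℕ) {M : Type*} [TopologicalSpace M]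
    [ChartedSpace (EuclideanSpace ℝ (Fin n)) M] (x y : M) (f : M → M) : (𝔼 n) → (𝔼 n) :=
  fun w => extChartAt (𝓡 n) y (f ((extChartAt (𝓡 n) x).symm w))

/-- The metric in the chart at `x`, as a field of bilinear forms. -/
noncomputable def chartForm [IsManifold (𝓡 n) ∞ M] (g : Metric n M) (x : M) (y : 𝔼 n) :
    (𝔼 n) →L[ℝ] (𝔼 n) →L[ℝ] ℝ :=
  (form g ((extChartAt (𝓡 n) x).symm y)).bilinearComp (symmDer x y) (symmDer x y)

theorem chartForm_apply [IsManifold (𝓡 n) ∞ M] (g : Metric n M) (x : M) (y v w : 𝔼 n) :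
    chartForm g x y v w =
      form g ((extChartAt (𝓡 n) x).symm y) (symmDer x y v) (symmDer x y w) := rfl

theorem chartMetric_eq [IsManifold (𝓡 n) ∞ M] (g : Metric n M) (x : M) (y v w : 𝔼 n) :
    chartMetric g x y v w = chartForm g x y v w := rfl

variable [IsManifold (𝓡 n) ∞ M]

theorem form_symm (g : Metric n M) (z : M) (v w : 𝔼 n) : form g z v w = form g z w v :=
  g.symm z v w

theorem form_pos (g : Metric n M) (z : M) {v : 𝔼 n} (hv : v ≠ 0) : 0 < form g z v v :=
  g.pos z v hv

theorem contMDiffOn_chart (x : M) : ContMDiffOn (𝓡 n) (𝓡 n) ∞ (extChartAt (𝓡 n) x)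
    (extChartAt (𝓡 n) x).source := by
  rw [extChartAt_source]
  exact contMDiffOn_extChartAt

theorem contMDiffAt_chart {x z : M} (hz : z ∈ (extChartAt (𝓡 n) x).source) :
    ContMDiffAt (𝓡 n) (𝓡 n) ∞ (extChartAt (𝓡 n) x) z :=
  (contMDiffOn_chart x).contMDiffAt ((isOpen_extChartAt_source x).mem_nhds hz)

theorem contMDiffAt_symm {x : M} {y : 𝔼 n} (hy : y ∈ (extChartAt (𝓡 n) x).target) :
    ContMDiffAt (𝓡 n) (𝓡 n) ∞ (extChartAt (𝓡 n) x).symm y :=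
  (contMDiffOn_extChartAt_symm x).contMDiffAt ((isOpen_extChartAt_target x).mem_nhds hy)

theorem mdiffAt_chart {x z : M} (hz : z ∈ (extChartAt (𝓡 n) x).source) :
    MDifferentiableAt (𝓡 n) (𝓡 n) (extChartAt (𝓡 n) x) z :=
  (contMDiffAt_chart hz).mdifferentiableAt (by simp)

theorem mdiffAt_symm {x : M} {y : 𝔼 n} (hy : y ∈ (extChartAt (𝓡 n) x).target) :
    MDifferentiableAt (𝓡 n) (𝓡 n) (extChartAt (𝓡 n) x).symm y :=
  (contMDiffAt_symm hy).mdifferentiableAt (by simp)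

theorem chartDer_symmDer {x : M} {y : 𝔼 n} (hy : y ∈ (extChartAt (𝓡 n) x).target) (v : 𝔼 n) :
    chartDer n x ((extChartAt (𝓡 n) x).symm y) (symmDer x y v) = v := by
  have h := mfderiv_extChartAt_comp_mfderivWithin_extChartAt_symm (I := 𝓡 n) hy
  have hr : Set.range (𝓡 n) = Set.univ := (𝓡 n).range_eq_univ
  rw [hr, mfderivWithin_univ] at h
  exact DFunLike.congr_fun h v

theorem symmDer_chartDer {x z : M} (hz : z ∈ (extChartAt (𝓡 n) x).source) (v : 𝔼 n) :
    symmDer x (extChartAt (𝓡 n) x z) (chartDer n x z v) = v := by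
  have h := mfderivWithin_extChartAt_symm_comp_mfderiv_extChartAt' (I := 𝓡 n) hz
  have hr : Set.range (𝓡 n) = Set.univ := (𝓡 n).range_eq_univ
  rw [hr, mfderivWithin_univ] at h
  exact DFunLike.congr_fun h v

theorem chartForm_chartDer (g : Metric n M) {x z : M} (hz : z ∈ (extChartAt (𝓡 n) x).source)
    (v w : 𝔼 n) : chartForm g x (extChartAt (𝓡 n) x z) (chartDer n x z v) (chartDer n x z w) =
      form g z v w := by
  rw [chartForm_apply, symmDer_chartDer hz, symmDer_chartDer hz, PartialEquiv.left_inv _ hz]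

/-- In finite dimension it suffices to evaluate on constant vectors. Each gives a smooth section of
the tangent bundle along the inverse chart, and the smooth bundle metric is then applied to two such
sections. -/
theorem contDiffOn_chartForm (g : Metric n M) (x : M) :
    ContDiffOn ℝ ∞ (chartForm g x) (extChartAt (𝓡 n) x).target := by
  rw [contDiffOn_clm_apply]
  intro v
  rw [contDiffOn_clm_apply]
  intro w
  have hT := isOpen_extChartAt_target (I := 𝓡 n) x
  have hsec : ∀ v : 𝔼 n, ContMDiffOn (𝓡 n) ((𝓡 n).prod (𝓡 n)) ∞
      (fun y : 𝔼 n => (⟨(extChartAt (𝓡 n) x).symm y, symmDer x y v⟩ : TangentBundle (𝓡 n) M))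
      (extChartAt (𝓡 n) x).target := by
    intro v
    have h1 := (contMDiffOn_extChartAt_symm (I := 𝓡 n) (n := ∞) x).contMDiffOn_tangentMapWithin
      (m := ∞) (by simp) hT.uniqueMDiffOn
    have h2 : ContMDiff (𝓡 n) ((𝓡 n).prod (𝓡 n)) ∞
        (fun y : 𝔼 n => (⟨y, v⟩ : TangentBundle (𝓡 n) (𝔼 n))) := by
      rw [contMDiff_vectorSpace_iff_contDiff (V := fun _ => v)]
      exact contDiff_const
    refine (h1.comp h2.contMDiffOn fun y hy => hy).congr fun y hy => ?_
    simp only [tangentMapWithin, Function.comp_apply, symmDer]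
    rw [mfderivWithin_of_isOpen hT hy]
    rfl
  intro y hy
  have hb : ContMDiffWithinAt (𝓡 n) (𝓡 n) ∞ (extChartAt (𝓡 n) x).symm
    (extChartAt (𝓡 n) x).target y := contMDiffOn_extChartAt_symm x y hy
  have : ContMDiffWithinAt (𝓡 n) ((𝓡 n).prod 𝓘(ℝ)) ∞
      (fun m => TotalSpace.mk' ℝ (E := Bundle.Trivial M ℝ) ((extChartAt (𝓡 n) x).symm m)
        (g.inner ((extChartAt (𝓡 n) x).symm m) (symmDer x m v) (symmDer x m w)))
      (extChartAt (𝓡 n) x).target y := by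
    apply ContMDiffWithinAt.clm_bundle_apply₂ (F₁ := 𝔼 n) (F₂ := 𝔼 n)
    · exact ContMDiffAt.comp_contMDiffWithinAt y g.contMDiff.contMDiffAt hb
    · exact hsec v y hy
    · exact hsec w y hy
  simp only [contMDiffWithinAt_totalSpace] at this
  exact this.2.contDiffWithinAt

theorem isCoordMetric_chartForm (g : Metric n M) (x : M) :
    IsCoordMetric (extChartAt (𝓡 n) x).target (chartForm g x) where
  isOpen := isOpen_extChartAt_target x
  smooth := contDiffOn_chartForm g x
  symm y _ v w := form_symm g _ _ _
  pos y hy v hv := by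
    refine form_pos g _ fun h => hv ?_
    have h' : symmDer x y v = 0 := h
    rw [← chartDer_symmDer hy v, h', map_zero]

theorem dChartMetric_eq (g : Metric n M) (x : M) {y : 𝔼 n}
    (hy : y ∈ (extChartAt (𝓡 n) x).target) (u v w : 𝔼 n) :
    dChartMetric g x y u v w = fderiv ℝ (chartForm g x) y u v w := by
  have h := (((isCoordMetric_chartForm g x).hasFDerivAt hy).clm_apply
    (hasFDerivAt_const v y)).clm_apply (hasFDerivAt_const w y)
  have : fderiv ℝ (fun z => chartMetric g x z v w) y = _ := h.fderiv
  rw [dChartMetric, this]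
  simp

/-- Links the scalar definitions in the statement with the operator-valued forms used in the proof.
-/
theorem christoffel_eq (g : Metric n M) (x : M) {y : 𝔼 n}
    (hy : y ∈ (extChartAt (𝓡 n) x).target) (u v w : 𝔼 n) :
    christoffel g x y u v w = christoffelForm (chartForm g x) y u v w := by
  rw [christoffel, dChartMetric_eq g x hy, dChartMetric_eq g x hy, dChartMetric_eq g x hy,
    christoffelForm_apply]

theorem contDiffAt_rep {x y : M} {f : M → M} {w : 𝔼 n} (hw : w ∈ (extChartAt (𝓡 n) x).target)
    (hf : ContMDiffAt (𝓡 n) (𝓡 n) ∞ f ((extChartAt (𝓡 n) x).symm w))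
    (hy : f ((extChartAt (𝓡 n) x).symm w) ∈ (extChartAt (𝓡 n) y).source) :
    ContDiffAt ℝ ∞ (rep n x y f) w :=
  ((contMDiffAt_chart hy).comp w (hf.comp w (contMDiffAt_symm hw))).contDiffAt

theorem fderiv_rep {x y : M} {f : M → M} {w : 𝔼 n} (hw : w ∈ (extChartAt (𝓡 n) x).target)
    (hf : MDifferentiableAt (𝓡 n) (𝓡 n) f ((extChartAt (𝓡 n) x).symm w))
    (hy : f ((extChartAt (𝓡 n) x).symm w) ∈ (extChartAt (𝓡 n) y).source) (v : 𝔼 n) :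
    fderiv ℝ (rep n x y f) w v = chartDer n y (f ((extChartAt (𝓡 n) x).symm w))
      (der n f ((extChartAt (𝓡 n) x).symm w) (symmDer x w v)) := by
  have h := (mdiffAt_chart hy).hasMFDerivAt.comp w
    (hf.hasMFDerivAt.comp w (mdiffAt_symm hw).hasMFDerivAt)
  have h2 : HasFDerivAt (rep n x y f) ((chartDer n y (f ((extChartAt (𝓡 n) x).symm w))).comp
      ((der n f ((extChartAt (𝓡 n) x).symm w)).comp (symmDer x w))) w := h.hasFDerivAt
  rw [h2.fderiv]
  rfl

theorem PreservesMetric.form_der {g : Metric n M} {f : M → M} (hf : PreservesMetric g f) (z : M)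
    (v w : 𝔼 n) : form g (f z) (der n f z v) (der n f z w) = form g z v w := hf.2 z v w

/-- Preservation of the metric is not assumed, so the identity also serves for a limit map whose
isometry property is still to be shown. -/
theorem chartForm_rep {g : Metric n M} {x y : M} {f : M → M} {w : 𝔼 n}
    (hw : w ∈ (extChartAt (𝓡 n) x).target)
    (hf : MDifferentiableAt (𝓡 n) (𝓡 n) f ((extChartAt (𝓡 n) x).symm w))
    (hy : f ((extChartAt (𝓡 n) x).symm w) ∈ (extChartAt (𝓡 n) y).source) (u v : 𝔼 n) :
    chartForm g y (rep n x y f w) (fderiv ℝ (rep n x y f) w u) (fderiv ℝ (rep n x y f) w v) =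
      form g (f ((extChartAt (𝓡 n) x).symm w))
        (der n f ((extChartAt (𝓡 n) x).symm w) (symmDer x w u))
        (der n f ((extChartAt (𝓡 n) x).symm w) (symmDer x w v)) := by
  rw [fderiv_rep hw hf hy, fderiv_rep hw hf hy, rep, chartForm_chartDer g hy]

/-- The trivialization of the tangent bundle at `y` is the differential of the chart, so convergence
of tangent vectors is convergence of base points and of coordinates in a single chart around the
limit. -/
theorem tendsto_tangentBundle_iff {α : Type*} {l : Filter α} {q : α → TangentBundle (𝓡 n) M}
    {p : TangentBundle (𝓡 n) M} {y : M} (hy : p.1 ∈ (extChartAt (𝓡 n) y).source) :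
    Tendsto q l (𝓝 p) ↔ Tendsto (fun a => (q a).1) l (𝓝 p.1) ∧
      Tendsto (fun a => chartDer n y (q a).1 (q a).2) l (𝓝 (chartDer n y p.1 p.2)) := by
  set e := trivializationAt (𝔼 n) (TangentSpace (𝓡 n) : M → Type _) y
  have he : ∀ q : TangentBundle (𝓡 n) M, q.1 ∈ (extChartAt (𝓡 n) y).source →
      (e q).2 = chartDer n y q.1 q.2 := by
    intro q hq
    have hq' : q.1 ∈ (chartAt (𝔼 n) y).source := by rwa [extChartAt_source] at hq
    have h := TangentBundle.continuousLinearMapAt_trivializationAt (I := 𝓡 n) hq'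
    have h2 := DFunLike.congr_fun h q.2
    have hb : q.1 ∈ e.baseSet := hq'
    exact (e.continuousLinearMapAt_apply_of_mem (R := ℝ) hb q.2).symm.trans h2
  have hz : p ∈ e.source := by
    rw [e.mem_source]
    rwa [extChartAt_source] at hy
  rw [e.tendsto_nhds_iff hz, he p hy]
  refine and_congr_right fun h1 => tendsto_congr' ?_
  filter_upwards [h1.eventually ((isOpen_extChartAt_source y).mem_nhds hy)] with a ha
  exact he _ ha

end Charts

/-! ### Uniform Lipschitz bounds and even continuity of metric-preserving maps -/

section LocalConvergence

set_option maxSynthPendingDepth 3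

open Filter Metric

/-- By homogeneity only unit vectors matter, and a positive continuous function on the compact set
of points of `K` and unit vectors has a positive lower bound. -/
theorem IsCoordMetric.exists_lower_bound {E : Type*} [NormedAddCommGroup E] [NormedSpace ℝ E]
    [FiniteDimensional ℝ E] {U K : Set E} {h : E → E →L[ℝ] E →L[ℝ] ℝ} (hh : IsCoordMetric U h)
    (hK : IsCompact K) (hKU : K ⊆ U) : ∃ c > 0, ∀ y ∈ K, ∀ v, c * ‖v‖ ^ 2 ≤ h y v v := by
  have hcont : ContinuousOn (fun q : E × E => h q.1 q.2 q.2) (K ×ˢ sphere (0 : E) 1) := by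
    have h1 : ContinuousOn (fun q : E × E => h q.1) (K ×ˢ sphere (0 : E) 1) :=
      (hh.smooth.continuousOn.mono hKU).comp continuousOn_fst fun q hq => hq.1
    exact (h1.clm_apply continuousOn_snd).clm_apply continuousOn_snd
  obtain ⟨c, hc, hle⟩ := (hK.prod (isCompact_sphere (0 : E) 1)).exists_forall_le' hcont
    (a := 0) fun q hq => hh.pos _ (hKU hq.1) _ (by
      rintro h0
      have := hq.2
      rw [h0] at this
      simp at this)
  refine ⟨c, hc, fun y hy v => ?_⟩
  by_cases hv : v = 0
  · simp [hv]
  have hn : ‖v‖ ≠ 0 := norm_ne_zero_iff.2 hv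
  have := hle (y, ‖v‖⁻¹ • v) ⟨hy, by simp [norm_smul, hn]⟩
  simp only [map_smul, smul_apply, smul_eq_mul] at this
  have h2 := mul_le_mul_of_nonneg_left this (sq_nonneg ‖v‖)
  calc c * ‖v‖ ^ 2 = ‖v‖ ^ 2 * c := mul_comm _ _
    _ ≤ _ := h2
    _ = _ := by field_simp

/-- In finite dimension an operator is a fixed continuous expression in its values on a basis, so
pointwise convergence implies norm convergence. -/
theorem exists_tendsto_of_tendsto_apply {E F ι : Type*} [NormedAddCommGroup E] [NormedSpace ℝ E]
    [FiniteDimensional ℝ E] [NormedAddCommGroup F] [NormedSpace ℝ F] {l : Filter ι}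
    {L : ι → E →L[ℝ] F} (hL : ∀ v, ∃ q, Tendsto (fun i => L i v) l (𝓝 q)) :
    ∃ L' : E →L[ℝ] F, Tendsto L l (𝓝 L') := by
  choose q hq using hL
  set b := Module.finBasis ℝ E
  have hsum : ∀ T : E →L[ℝ] F, T = ∑ j, ContinuousLinearMap.smulRightL ℝ E F
      (LinearMap.toContinuousLinearMap (b.coord j)) (T (b j)) := by
    intro T
    ext v
    conv_lhs => rw [← b.sum_repr v, map_sum]
    simp
  refine ⟨∑ j, ContinuousLinearMap.smulRightL ℝ E F
      (LinearMap.toContinuousLinearMap (b.coord j)) (q (b j)), ?_⟩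
  rw [funext fun i => hsum (L i)]
  exact tendsto_finsetSum _ fun j _ =>
    ((ContinuousLinearMap.smulRightL ℝ E F _).continuous.tendsto _).comp (hq (b j))

local notation "𝔼" n => EuclideanSpace ℝ (Fin n)

variable {n : ℕ} {M : Type*} [TopologicalSpace M] [ChartedSpace (EuclideanSpace ℝ (Fin n)) M]
  [IsManifold (𝓡 n) ∞ M]

/-- The open coordinate ball at `y`. -/
def chartBall (n : ℕ) {M : Type*} [TopologicalSpace M]
    [ChartedSpace (EuclideanSpace ℝ (Fin n)) M] (y : M) (R : ℝ) : Set M :=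
  (extChartAt (𝓡 n) y).source ∩ extChartAt (𝓡 n) y ⁻¹' ball (extChartAt (𝓡 n) y y) R

omit [IsManifold (𝓡 n) ∞ M] in
theorem isOpen_chartBall (y : M) (R : ℝ) : IsOpen (chartBall n y R) :=
  (continuousOn_extChartAt y).isOpen_inter_preimage (isOpen_extChartAt_source y) isOpen_ball

omit [IsManifold (𝓡 n) ∞ M] in
theorem chartBall_mem_nhds (y : M) {R : ℝ} (hR : 0 < R) : chartBall n y R ∈ 𝓝 y :=
  (isOpen_chartBall y R).mem_nhds ⟨mem_extChartAt_source y, mem_ball_self hR⟩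

omit [IsManifold (𝓡 n) ∞ M] in
theorem exists_closedBall_subset_target (y : M) {V : Set M} (hV : V ∈ 𝓝 y) :
    ∃ R > 0, closedBall (extChartAt (𝓡 n) y y) R ⊆
      (extChartAt (𝓡 n) y).target ∩ (extChartAt (𝓡 n) y).symm ⁻¹' V := by
  have h1 : (extChartAt (𝓡 n) y).symm ⁻¹' V ∈ 𝓝 (extChartAt (𝓡 n) y y) := by
    refine (continuousAt_extChartAt_symm y).preimage_mem_nhds ?_
    rwa [extChartAt_to_inv]
  exact nhds_basis_closedBall.mem_iff.1 (inter_mem (extChartAt_target_mem_nhds y) h1)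

/-- Self-maps of `M` that preserve the metric are uniformly Lipschitz in charts. -/
theorem exists_uniform_chart_bound [T2Space M] (g : Metric n M) (x y : M) {R : ℝ} (hR : 0 < R)
    (hRy : closedBall (extChartAt (𝓡 n) y y) R ⊆ (extChartAt (𝓡 n) y).target) :
    ∃ r > 0, ∃ C : ℝ, closedBall (extChartAt (𝓡 n) x x) r ⊆ (extChartAt (𝓡 n) x).target ∧
      ∀ f : M → M, PreservesMetric g f → ∀ z ∈ chartBall n x r, f z ∈ chartBall n y (R / 2) →
        ∀ w ∈ ball (extChartAt (𝓡 n) x x) r,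
          f ((extChartAt (𝓡 n) x).symm w) ∈ (extChartAt (𝓡 n) y).source ∧
          rep n x y f w ∈ closedBall (extChartAt (𝓡 n) y y) R ∧
          ‖fderiv ℝ (rep n x y f) w‖ ≤ C := by
  obtain ⟨r₀, hr₀, hr₀x⟩ := exists_closedBall_subset_target (n := n) x univ_mem
  rw [Set.preimage_univ, Set.inter_univ] at hr₀x
  obtain ⟨Λ, hΛ⟩ := (isCompact_closedBall (extChartAt (𝓡 n) x x) r₀).exists_bound_of_continuousOn
    ((contDiffOn_chartForm g x).continuousOn.mono hr₀x)
  obtain ⟨c, hc, hcle⟩ := (isCoordMetric_chartForm g y).exists_lower_bound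
    (isCompact_closedBall (extChartAt (𝓡 n) y y) R) hRy
  have hΛ0 : 0 ≤ Λ := (norm_nonneg _).trans (hΛ _ (mem_closedBall_self hr₀.le))
  -- An isometry satisfies c‖Df v‖² ≤ h'(Df v, Df v) = h(v, v) ≤ Λ‖v‖², with `Λ` and `c` independent
  -- of the map.
  set C : ℝ := Real.sqrt (Λ / c) with hC
  have hC0 : 0 ≤ C := Real.sqrt_nonneg _
  have hbound : ∀ f : M → M, PreservesMetric g f → ∀ w ∈ closedBall (extChartAt (𝓡 n) x x) r₀,
      f ((extChartAt (𝓡 n) x).symm w) ∈ (extChartAt (𝓡 n) y).source →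
      rep n x y f w ∈ closedBall (extChartAt (𝓡 n) y y) R →
      ‖fderiv ℝ (rep n x y f) w‖ ≤ C := by
    intro f hf w hw hs hwR
    refine ContinuousLinearMap.opNorm_le_bound _ hC0 fun v => ?_
    have h1 := hcle _ hwR (fderiv ℝ (rep n x y f) w v)
    rw [chartForm_rep (hr₀x hw) (hf.1.mdifferentiable (by simp) _) hs, hf.form_der,
      ← chartForm_apply] at h1
    have h2 : chartForm g x w v v ≤ Λ * ‖v‖ ^ 2 := by
      calc _ ≤ ‖chartForm g x w v v‖ := Real.le_norm_self _
        _ ≤ ‖chartForm g x w‖ * ‖v‖ * ‖v‖ := ContinuousLinearMap.le_opNorm₂ _ _ _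
        _ ≤ Λ * ‖v‖ * ‖v‖ := by gcongr; exact hΛ w hw
        _ = _ := by ring
    refine abs_le_of_sq_le_sq' ?_ (by positivity) |>.2
    rw [mul_pow, hC, Real.sq_sqrt (by positivity), div_mul_eq_mul_div, le_div_iff₀ hc]
    linarith
  -- Chosen so that a path of coordinate length at most `2 * r` has an image shorter than `R / 2`:
  -- an image starting in the half ball cannot leave the ball of radius `R`.
  set r : ℝ := min r₀ (R / (8 * (C + 1))) with hr
  have hrpos : 0 < r := by positivity
  have hrle : C * (2 * r) < R / 2 := by
    have : r ≤ R / (8 * (C + 1)) := min_le_right _ _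
    rw [le_div_iff₀ (by positivity)] at this
    nlinarith
  have hsub : closedBall (extChartAt (𝓡 n) x x) r ⊆ closedBall (extChartAt (𝓡 n) x x) r₀ :=
    closedBall_subset_closedBall (min_le_left _ _)
  refine ⟨r, hrpos, C, hsub.trans hr₀x, ?_⟩
  intro f hf z hz hfz
  set z₀ := extChartAt (𝓡 n) x z with hz₀
  have hz₀' : (extChartAt (𝓡 n) x).symm z₀ = z := PartialEquiv.left_inv _ hz.1
  suffices H : ∀ w ∈ ball (extChartAt (𝓡 n) x x) r,
      f ((extChartAt (𝓡 n) x).symm w) ∈ (extChartAt (𝓡 n) y).source ∧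
          rep n x y f w ∈ closedBall (extChartAt (𝓡 n) y y) R from
    fun w hw => ⟨(H w hw).1, (H w hw).2,
      hbound f hf w (hsub (ball_subset_closedBall hw)) (H w hw).1 (H w hw).2⟩
  intro w hw
  -- Compact, hence closed in the Hausdorff space `M`. The image path therefore cannot leave the
  -- chart domain through a limit point outside it.
  set A : Set M := (extChartAt (𝓡 n) y).symm '' closedBall (extChartAt (𝓡 n) y y) R with hA
  have hAc : IsCompact A := (isCompact_closedBall _ _).image_of_continuousOn
    ((continuousOn_extChartAt_symm y).mono hRy)
  have hAs : A ⊆ (extChartAt (𝓡 n) y).source := by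
    rintro _ ⟨a, ha, rfl⟩
    exact PartialEquiv.map_target _ (hRy ha)
  have hAR : ∀ m ∈ A, extChartAt (𝓡 n) y m ∈ closedBall (extChartAt (𝓡 n) y y) R := by
    rintro _ ⟨a, ha, rfl⟩
    rwa [PartialEquiv.right_inv _ (hRy ha)]
  have hBA : chartBall n y R ⊆ A := fun m hm =>
    ⟨extChartAt (𝓡 n) y m, ball_subset_closedBall hm.2, PartialEquiv.left_inv _ hm.1⟩
  set q : ℝ → 𝔼 n := fun t => z₀ + t • (w - z₀) with hq
  have hqmem : ∀ t ∈ Set.Icc (0 : ℝ) 1, q t ∈ ball (extChartAt (𝓡 n) x x) r := fun t ht =>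
    (convex_ball _ _).add_smul_sub_mem hz.2 hw ht
  have hqt : ∀ t ∈ Set.Icc (0 : ℝ) 1, q t ∈ (extChartAt (𝓡 n) x).target := fun t ht =>
    hr₀x (hsub (ball_subset_closedBall (hqmem t ht)))
  have hqd : ∀ t, HasDerivAt q (w - z₀) t := fun t => by
    simpa [hq] using ((hasDerivAt_id t).smul_const (w - z₀)).const_add z₀
  set p : ℝ → M := fun t => f ((extChartAt (𝓡 n) x).symm (q t)) with hp
  have hpc : ∀ t ∈ Set.Icc (0 : ℝ) 1, ContinuousAt p t := fun t ht =>
    hf.1.continuous.continuousAt.comp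
      (((continuousOn_extChartAt_symm x).continuousAt
        ((isOpen_extChartAt_target x).mem_nhds (hqt t ht))).comp (hqd t).continuousAt)
  have hwz : ‖w - z₀‖ ≤ 2 * r := by
    rw [← dist_eq_norm]
    have h1 := mem_ball.1 hw
    have h2 := mem_ball.1 hz.2
    linarith [dist_triangle_right w z₀ (extChartAt (𝓡 n) x x)]
  have hp0 : p 0 = f z := by
    change f ((extChartAt (𝓡 n) x).symm (z₀ + (0 : ℝ) • (w - z₀))) = f z
    rw [zero_smul, add_zero, hz₀']
  -- Continuity method along the segment from `z₀` to `w`: `S` is closed, and at a time of `S` the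
  -- length bound puts the path in the open ball of radius `R`, where the mean value inequality
  -- extends the bound a little further.
  set S : Set ℝ := {t | p t ∈ A ∧
    ‖extChartAt (𝓡 n) y (p t) - extChartAt (𝓡 n) y (f z)‖ ≤ C * ‖w - z₀‖ * t} with hS
  have hSball : ∀ t ∈ S, t ≤ 1 → p t ∈ chartBall n y R := by
    rintro t ⟨h1, h2⟩ ht
    refine ⟨hAs h1, ?_⟩
    have h3 := mem_ball.1 hfz.2
    have h4 : C * ‖w - z₀‖ * t ≤ C * (2 * r) := by
      calc _ ≤ C * ‖w - z₀‖ * 1 := by gcongr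
        _ ≤ _ := by rw [mul_one]; gcongr
    rw [← dist_eq_norm] at h2
    refine mem_ball.2 ?_
    linarith [dist_triangle (extChartAt (𝓡 n) y (p t)) (extChartAt (𝓡 n) y (f z))
      (extChartAt (𝓡 n) y y)]
  have hpcOn : ContinuousOn p (Set.Icc 0 1) := fun t ht => (hpc t ht).continuousWithinAt
  have hclosed : IsClosed (S ∩ Set.Icc 0 1) := by
    have h1 : IsClosed (Set.Icc (0 : ℝ) 1 ∩ p ⁻¹' A) :=
      hpcOn.preimage_isClosed_of_isClosed isClosed_Icc hAc.isClosed
    have h2 : ContinuousOn (fun t => extChartAt (𝓡 n) y (p t)) (Set.Icc (0 : ℝ) 1 ∩ p ⁻¹' A) :=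
      (continuousOn_extChartAt y).comp (hpcOn.mono Set.inter_subset_left) fun t ht => hAs ht.2
    have h3 := h1.isClosed_le (f := fun t => ‖extChartAt (𝓡 n) y (p t) -
      extChartAt (𝓡 n) y (f z)‖) (g := fun t => C * ‖w - z₀‖ * t)
      (h2.sub continuousOn_const).norm (by fun_prop)
    convert h3 using 1
    ext t
    simp only [hS, Set.mem_inter_iff, Set.mem_ofPred_eq, Set.mem_preimage]
    tauto
  have hIcc : Set.Icc (0 : ℝ) 1 ⊆ S := by
    refine hclosed.Icc_subset_of_forall_mem_nhdsWithin ?_ ?_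
    · refine ⟨?_, by simp [hp0]⟩
      rw [hp0]
      exact hBA ⟨hfz.1, ball_subset_ball (by linarith) hfz.2⟩
    · rintro t ⟨htS, ht0, ht1⟩
      have htb := hSball t htS ht1.le
      obtain ⟨ε, hε, hεb⟩ := Metric.eventually_nhds_iff.1
        ((hpc t ⟨ht0, ht1.le⟩).eventually ((isOpen_chartBall y R).mem_nhds htb))
      filter_upwards [Ioo_mem_nhdsGT (show t < min (t + ε) 1 from lt_min (by linarith) ht1)]
        with s hs
      have hs1 : s < t + ε := hs.2.trans_le (min_le_left _ _)
      have hs2 : s < 1 := hs.2.trans_le (min_le_right _ _)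
      have hseg : ∀ τ ∈ Set.Icc t s, p τ ∈ chartBall n y R := fun τ hτ =>
        hεb (by rw [Real.dist_eq, abs_lt]; constructor <;> linarith [hτ.1, hτ.2])
      refine ⟨hBA (hseg s ⟨hs.1.le, le_rfl⟩), ?_⟩
      have hder : ∀ τ ∈ Set.Icc t s, HasDerivWithinAt (fun τ => rep n x y f (q τ))
          (fderiv ℝ (rep n x y f) (q τ) (w - z₀)) (Set.Icc t s) τ := by
        intro τ hτ
        have hτ' : τ ∈ Set.Icc (0 : ℝ) 1 := ⟨ht0.trans hτ.1, hτ.2.trans hs2.le⟩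
        have := ((contDiffAt_rep (hqt τ hτ') hf.1.contMDiffAt
          (hseg τ hτ).1).differentiableAt (by simp)).hasFDerivAt
        exact (this.comp_hasDerivAt τ (hqd τ)).hasDerivWithinAt
      have hmvt := norm_image_sub_le_of_norm_deriv_le_segment' hder (C := C * ‖w - z₀‖)
        (fun τ hτ => by
          have hτ' : τ ∈ Set.Icc t s := ⟨hτ.1, hτ.2.le⟩
          have hτ'' : τ ∈ Set.Icc (0 : ℝ) 1 := ⟨ht0.trans hτ.1, hτ.2.le.trans hs2.le⟩
          refine (ContinuousLinearMap.le_opNorm _ _).trans ?_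
          gcongr
          exact hbound f hf _ (hsub (ball_subset_closedBall (hqmem τ hτ''))) (hseg τ hτ').1
            (ball_subset_closedBall (hseg τ hτ').2)) s ⟨hs.1.le, le_rfl⟩
      have h5 := htS.2
      calc _ ≤ ‖extChartAt (𝓡 n) y (p s) - extChartAt (𝓡 n) y (p t)‖ +
            ‖extChartAt (𝓡 n) y (p t) - extChartAt (𝓡 n) y (f z)‖ := norm_sub_le_norm_sub_add_norm_sub _ _ _
        _ ≤ C * ‖w - z₀‖ * (s - t) + C * ‖w - z₀‖ * t := add_le_add hmvt h5
        _ = _ := by ring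
  have h1 := (hIcc (Set.right_mem_Icc.2 zero_le_one)).1
  have hq1 : q 1 = w := by simp [hq]
  rw [hp] at h1
  simp only [hq1] at h1
  exact ⟨hAs h1, hAR _ h1⟩

/-- Self-maps of `M` that preserve the metric form an evenly continuous family. -/
theorem evenly_continuous [T2Space M] (g : Metric n M) (x y : M) {V : Set M} (hV : V ∈ 𝓝 y) :
    ∃ W ∈ 𝓝 x, ∃ V' ∈ 𝓝 y, ∀ f : M → M, PreservesMetric g f → ∀ p ∈ W, f p ∈ V' →
      ∀ q ∈ W, f q ∈ V := by
  obtain ⟨R, hR, hRy⟩ := exists_closedBall_subset_target (n := n) y hV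
  obtain ⟨r, hr, C, hrx, H⟩ := exists_uniform_chart_bound g x y hR
    (hRy.trans Set.inter_subset_left)
  refine ⟨chartBall n x r, chartBall_mem_nhds x hr, chartBall n y (R / 2),
    chartBall_mem_nhds y (by positivity), fun f hf p hp hfp q hq => ?_⟩
  have h1 := H f hf p hp hfp _ hq.2
  have h2 := (hRy h1.2.1).2
  rw [rep, PartialEquiv.left_inv _ hq.1] at h2
  rw [PartialEquiv.left_inv _ hq.1] at h1
  rwa [Set.mem_preimage, PartialEquiv.left_inv _ h1.1] at h2

/-- The image of a tangent vector at `z` under a self-map of `M`. -/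
noncomputable def push (n : ℕ) {M : Type*} [TopologicalSpace M]
    [ChartedSpace (EuclideanSpace ℝ (Fin n)) M] (f : M → M) (z : M) (v : 𝔼 n) :
    TangentBundle (𝓡 n) M := ⟨f z, der n f z v⟩

end LocalConvergence

/-! ### From convergence of differentials at one point to convergence everywhere -/

section GlobalConvergence

set_option maxSynthPendingDepth 3

open Filter Metric

theorem tendsto_clm_apply {E F ι : Type*} [NormedAddCommGroup E] [NormedSpace ℝ E]
    [NormedAddCommGroup F] [NormedSpace ℝ F] {l : Filter ι} {L : ι → E →L[ℝ] F} {v : ι → E}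
    {L' : E →L[ℝ] F} {v' : E} (hL : Tendsto L l (𝓝 L')) (hv : Tendsto v l (𝓝 v')) :
    Tendsto (fun i => L i (v i)) l (𝓝 (L' v')) :=
  ((isBoundedBilinearMap_apply (𝕜 := ℝ) (E := E) (F := F)).continuous.tendsto (L', v')).comp
    (hL.prodMk_nhds hv)

local notation "𝔼" n => EuclideanSpace ℝ (Fin n)

variable {n : ℕ} {M : Type*} [TopologicalSpace M] [ChartedSpace (EuclideanSpace ℝ (Fin n)) M]
  [IsManifold (𝓡 n) ∞ M]

/-- If the differentials at a point of a filter of isometries converge, then they converge on a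
uniform neighbourhood of this point to the differential of a local isometry. -/
theorem local_convergence [T2Space M] (g : Metric n M) (x y : M) :
    ∃ W ∈ 𝓝 x, ∃ V ∈ 𝓝 y, ∀ (l : Filter (Isom g)) [NeBot l], ∀ z ∈ W,
      (∀ v, ∃ q, Tendsto (fun a : Isom g => push n a.1 z v) l (𝓝 q)) →
      (∀ᶠ a in l, a.1 z ∈ V) → ∃ f : M → M, ∀ w ∈ W, ContMDiffAt (𝓡 n) (𝓡 n) ∞ f w ∧
        (∀ u v, form g (f w) (der n f w u) (der n f w v) = form g w u v) ∧
        ∀ v, Tendsto (fun a : Isom g => push n a.1 w v) l (𝓝 (push n f w v)) := by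
  obtain ⟨R, hR, hRy⟩ := exists_closedBall_subset_target (n := n) y univ_mem
  rw [Set.preimage_univ, Set.inter_univ] at hRy
  obtain ⟨r, hr, C, hrx, H⟩ := exists_uniform_chart_bound g x y hR hRy
  refine ⟨chartBall n x r, chartBall_mem_nhds x hr, chartBall n y (R / 2),
    chartBall_mem_nhds y (by positivity), ?_⟩
  intro l _ z hz hpush hV
  have hgood : ∀ᶠ a : Isom g in l, ∀ w ∈ ball (extChartAt (𝓡 n) x x) r,
      a.1 ((extChartAt (𝓡 n) x).symm w) ∈ (extChartAt (𝓡 n) y).source ∧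
      rep n x y a.1 w ∈ closedBall (extChartAt (𝓡 n) y y) R ∧
      ‖fderiv ℝ (rep n x y a.1) w‖ ≤ C := by
    filter_upwards [hV] with a ha using H a.1 a.2.1 z hz ha
  have hzs : (extChartAt (𝓡 n) x).symm (extChartAt (𝓡 n) x z) = z := PartialEquiv.left_inv _ hz.1
  have hbt : ∀ w ∈ ball (extChartAt (𝓡 n) x x) r, w ∈ (extChartAt (𝓡 n) x).target :=
    fun w hw => hrx (ball_subset_closedBall hw)
  have hmd : ∀ (a : Isom g) (w : M), MDifferentiableAt (𝓡 n) (𝓡 n) a.1 w := fun a w =>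
    a.2.1.1.mdifferentiable (by simp) w
  set A : Set M := (extChartAt (𝓡 n) y).symm '' closedBall (extChartAt (𝓡 n) y y) R with hA
  have hAc : IsCompact A := (isCompact_closedBall _ _).image_of_continuousOn
    ((continuousOn_extChartAt_symm y).mono hRy)
  have hAs : A ⊆ (extChartAt (𝓡 n) y).source := by
    rintro _ ⟨a, ha, rfl⟩
    exact PartialEquiv.map_target _ (hRy ha)
  -- The images of `z` stay in the compact set `A`, so their limit is still in the chart domain.
  have hqs : ∀ {v : 𝔼 n} {q : TangentBundle (𝓡 n) M},
      Tendsto (fun a : Isom g => push n a.1 z v) l (𝓝 q) → q.1 ∈ (extChartAt (𝓡 n) y).source := by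
    intro v q hq
    have h1 : Tendsto (fun a : Isom g => a.1 z) l (𝓝 q.1) :=
      ((FiberBundle.continuous_proj (𝔼 n) (TangentSpace (𝓡 n) : M → Type _)).tendsto q).comp hq
    refine hAs (hAc.isClosed.mem_of_tendsto h1 (hgood.mono fun a ha => ?_))
    have h2 := ha _ hz.2
    rw [hzs] at h2
    have h3 := h2.2.1
    rw [rep, hzs] at h3
    exact ⟨_, h3, PartialEquiv.left_inv _ h2.1⟩
  obtain ⟨q₀, hq₀⟩ := hpush 0
  have hp : Tendsto (fun a : Isom g => rep n x y a.1 (extChartAt (𝓡 n) x z)) l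
      (𝓝 (extChartAt (𝓡 n) y q₀.1)) := by
    have h1 := ((tendsto_tangentBundle_iff (hqs hq₀)).1 hq₀).1
    simp only [rep, hzs]
    exact (continuousAt_extChartAt' (by simpa using hqs hq₀)).tendsto.comp h1
  obtain ⟨L, hL⟩ : ∃ L, Tendsto (fun a : Isom g =>
      fderiv ℝ (rep n x y a.1) (extChartAt (𝓡 n) x z)) l (𝓝 L) := by
    refine exists_tendsto_of_tendsto_apply fun v => ?_
    obtain ⟨q, hq⟩ := hpush (symmDer x (extChartAt (𝓡 n) x z) v)
    refine ⟨_, ((tendsto_tangentBundle_iff (hqs hq)).1 hq).2.congr' ?_⟩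
    filter_upwards [hgood] with a ha
    have h2 := ha _ hz.2
    rw [fderiv_rep (hbt _ hz.2) (hmd _ _) h2.1, hzs]
    rfl
  obtain ⟨F, hFs, hF⟩ := jet_convergence (isCoordMetric_chartForm g x)
    (isCoordMetric_chartForm g y) (l := l) (f := fun a : Isom g => rep n x y a.1) hrx hRy
    (C := C) (by
      filter_upwards [hgood] with a ha
      refine ⟨fun w hw => (contDiffAt_rep (hbt w hw) a.2.1.1.contMDiffAt
        (ha w hw).1).contDiffWithinAt, fun w hw => ⟨(ha w hw).2.1, (ha w hw).2.2, fun u v => ?_⟩⟩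
      rw [chartForm_rep (hbt w hw) (hmd _ _) (ha w hw).1, a.2.1.form_der, chartForm_apply])
    hz.2 hp hL
  have hFt : ∀ w ∈ ball (extChartAt (𝓡 n) x x) r, F w ∈ (extChartAt (𝓡 n) y).target :=
    fun w hw => hRy (hF w hw).1
  set f : M → M := fun m => (extChartAt (𝓡 n) y).symm (F (extChartAt (𝓡 n) x m)) with hf
  have hfsmooth : ∀ w ∈ chartBall n x r, ContMDiffAt (𝓡 n) (𝓡 n) ∞ f w := fun w hw =>
    (contMDiffAt_symm (hFt _ hw.2)).comp w
      (((hFs.contDiffAt (isOpen_ball.mem_nhds hw.2)).contMDiffAt).comp w (contMDiffAt_chart hw.1))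
  have hrepf : ∀ w ∈ ball (extChartAt (𝓡 n) x x) r, rep n x y f w = F w := by
    intro w hw
    simp only [rep, hf]
    rw [PartialEquiv.right_inv _ (hbt w hw), PartialEquiv.right_inv _ (hFt w hw)]
  have hdrep : ∀ w ∈ ball (extChartAt (𝓡 n) x x) r,
      fderiv ℝ (rep n x y f) w = fderiv ℝ F w := fun w hw =>
    Filter.EventuallyEq.fderiv_eq (by
      filter_upwards [isOpen_ball.mem_nhds hw] with a ha using hrepf a ha)
  refine ⟨f, fun w hw => ⟨hfsmooth w hw, ?_, ?_⟩⟩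
  all_goals
    have hws : (extChartAt (𝓡 n) x).symm (extChartAt (𝓡 n) x w) = w := PartialEquiv.left_inv _ hw.1
    have hfw : f w ∈ (extChartAt (𝓡 n) y).source := PartialEquiv.map_target _ (hFt _ hw.2)
    have hfmd : MDifferentiableAt (𝓡 n) (𝓡 n) f w := (hfsmooth w hw).mdifferentiableAt (by simp)
  · intro u v
    have key : ∀ (u v : 𝔼 n), chartForm g y (F (extChartAt (𝓡 n) x w))
        (fderiv ℝ F (extChartAt (𝓡 n) x w) u) (fderiv ℝ F (extChartAt (𝓡 n) x w) v) =
        chartForm g x (extChartAt (𝓡 n) x w) u v := by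
      intro u v
      -- The isometry equation involves only the 1-jet, so it passes to the limit.
      have hc : ContinuousAt (chartForm g y) (F (extChartAt (𝓡 n) x w)) :=
        ((contDiffOn_chartForm g y).contDiffAt
          ((isOpen_extChartAt_target y).mem_nhds (hFt _ hw.2))).continuousAt
      obtain ⟨-, h1, h2⟩ := hF _ hw.2
      have h3 := tendsto_clm_apply (tendsto_clm_apply (hc.tendsto.comp h1)
        (tendsto_clm_apply h2 (tendsto_const_nhds (x := u))))
        (tendsto_clm_apply h2 (tendsto_const_nhds (x := v)))
      refine tendsto_nhds_unique h3 (tendsto_const_nhds.congr' ?_)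
      filter_upwards [hgood] with a ha
      rw [Function.comp_apply, chartForm_rep (hbt _ hw.2) (hmd _ _) (ha _ hw.2).1, a.2.1.form_der,
        chartForm_apply]
    have h1 := chartForm_rep (g := g) (x := x) (y := y) (f := f) (hbt _ hw.2)
      (by rwa [hws]) (by rwa [hws]) (chartDer n x w u) (chartDer n x w v)
    rw [hdrep _ hw.2, hrepf _ hw.2, key, symmDer_chartDer hw.1, symmDer_chartDer hw.1, hws,
      chartForm_chartDer g hw.1] at h1
    exact h1.symm
  · intro v
    have hdf : fderiv ℝ F (extChartAt (𝓡 n) x w) (chartDer n x w v) =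
        chartDer n y (f w) (der n f w v) := by
      have h1 := fderiv_rep (x := x) (y := y) (f := f) (hbt _ hw.2)
        (by rwa [hws]) (by rwa [hws]) (chartDer n x w v)
      rwa [hdrep _ hw.2, symmDer_chartDer hw.1, hws] at h1
    refine (tendsto_tangentBundle_iff (y := y) hfw).2 ⟨?_, ?_⟩
    · have h1 : Tendsto (fun a : Isom g => (extChartAt (𝓡 n) y).symm
          (rep n x y a.1 (extChartAt (𝓡 n) x w))) l (𝓝 (f w)) :=
        ((continuousOn_extChartAt_symm y).continuousAt
          ((isOpen_extChartAt_target y).mem_nhds (hFt _ hw.2))).tendsto.comp (hF _ hw.2).2.1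
      refine h1.congr' ?_
      filter_upwards [hgood] with a ha
      have h2 := (ha _ hw.2).1
      rw [hws] at h2
      rw [rep, hws, PartialEquiv.left_inv _ h2]
      rfl
    · change Tendsto _ l (𝓝 (chartDer n y (f w) (der n f w v)))
      rw [← hdf]
      refine (tendsto_clm_apply (hF _ hw.2).2.2
        (tendsto_const_nhds (x := chartDer n x w v))).congr' ?_
      filter_upwards [hgood] with a ha
      rw [fderiv_rep (hbt _ hw.2) (hmd _ _) (ha _ hw.2).1, symmDer_chartDer hw.1, hws]
      rfl

theorem tendsto_apply_of_push {ι : Type*} {l : Filter ι} {a : ι → M → M} {z : M} {v : 𝔼 n}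
    {q : TangentBundle (𝓡 n) M} (h : Tendsto (fun i => push n (a i) z v) l (𝓝 q)) :
    Tendsto (fun i => a i z) l (𝓝 q.1) :=
  ((FiberBundle.continuous_proj (𝔼 n) (TangentSpace (𝓡 n) : M → Type _)).tendsto q).comp h

/-- If the differentials at one point of a filter of isometries of a connected manifold converge,
then they converge everywhere, to the differential of a map that preserves the metric. -/
theorem exists_limit [T2Space M] [ConnectedSpace M] (g : Metric n M) (l : Filter (Isom g)) [NeBot l]
    (z : M) (hz : ∀ v, ∃ q, Tendsto (fun a : Isom g => push n a.1 z v) l (𝓝 q)) :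
    ∃ f : M → M, PreservesMetric g f ∧ ∀ w v,
      Tendsto (fun a : Isom g => push n a.1 w v) l (𝓝 (push n f w v)) := by
  set S : Set M := {w | ∀ v, ∃ q, Tendsto (fun a : Isom g => push n a.1 w v) l (𝓝 q)} with hS
  have hopen : IsOpen S := by
    rw [isOpen_iff_mem_nhds]
    intro x hx
    obtain ⟨q, hq⟩ := hx 0
    obtain ⟨W, hW, V, hV, H⟩ := local_convergence g x q.1
    obtain ⟨f, hf⟩ := H l x (mem_of_mem_nhds hW) hx ((tendsto_apply_of_push hq).eventually hV)
    filter_upwards [hW] with w hw v using ⟨_, (hf w hw).2.2 v⟩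
  have hclosed : IsClosed S := by
    rw [← closure_subset_iff_isClosed]
    intro x hx
    -- For `x` in the closure it is unknown where the images of `x` go. The target is therefore
    -- taken at `x` itself: for `u` in `S` near `x` and a late isometry `b`, the maps `b⁻¹ * a`
    -- bring `u` back near `x`. Their convergence at `x` follows from the local result, and
    -- composing with `b` returns to `a`.
    obtain ⟨W, hW, V, hV, H⟩ := local_convergence g x x
    obtain ⟨u, ⟨huW, huV⟩, huS⟩ := mem_closure_iff_nhds.1 hx _
      (inter_mem hW (interior_mem_nhds.2 hV))
    obtain ⟨q, hq⟩ := huS 0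
    have hbase := tendsto_apply_of_push hq
    -- Even continuity controls `b⁻¹` near the limit of the images of `u` although `b` is chosen
    -- only afterwards.
    obtain ⟨W₂, hW₂, V₂, hV₂, H₂⟩ := evenly_continuous g q.1 u
      (isOpen_interior.mem_nhds huV)
    have hev := hbase.eventually hW₂
    obtain ⟨b, hb⟩ := hev.exists
    have hcomp : ∀ (c a : Isom g) (m : M) (v : 𝔼 n),
        push n (c * a : Isom g).1 m v = tangentMap (𝓡 n) (𝓡 n) c.1 (push n a.1 m v) := by
      intro c a m v
      have h := mfderiv_comp m (c.2.1.1.mdifferentiable (by simp) (a.1 m))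
        (a.2.1.1.mdifferentiable (by simp) m)
      have h2 : der n ((c * a : Isom g).1 : M → M) m v = der n c.1 (a.1 m) (der n a.1 m v) :=
        DFunLike.congr_fun h v
      change (⟨_, der n ((c * a : Isom g).1 : M → M) m v⟩ : TangentBundle (𝓡 n) M) = _
      rw [h2]
      rfl
    have hcont : ∀ c : Isom g, Continuous (tangentMap (𝓡 n) (𝓡 n) c.1) := fun c =>
      c.2.1.1.continuous_tangentMap (by simp)
    obtain ⟨f, hf⟩ := H (l.map fun a => b⁻¹ * a) u huW (by
        intro v
        obtain ⟨q', hq'⟩ := huS v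
        refine ⟨tangentMap (𝓡 n) (𝓡 n) (b⁻¹ : Isom g).1 q', ?_⟩
        rw [tendsto_map'_iff]
        refine (((hcont b⁻¹).tendsto q').comp hq').congr fun a => ?_
        exact (hcomp b⁻¹ a u v).symm) (by
        rw [eventually_map]
        filter_upwards [hev] with a ha
        refine interior_subset (H₂ (b⁻¹ : Isom g).1 (b⁻¹ : Isom g).2.1 (b.1 u) hb ?_ (a.1 u) ha)
        have : (b⁻¹ : Isom g).1 (b.1 u) = u := b.1.symm_apply_apply u
        rw [this]
        exact mem_of_mem_nhds hV₂)
    intro v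
    have h1 := (hf x (mem_of_mem_nhds hW)).2.2 v
    rw [tendsto_map'_iff] at h1
    refine ⟨_, (((hcont b).tendsto _).comp h1).congr fun a => ?_⟩
    have := hcomp b (b⁻¹ * a) x v
    rw [mul_inv_cancel_left] at this
    exact this.symm
  have huniv : S = Set.univ := IsClopen.eq_univ ⟨hclosed, hopen⟩ ⟨z, hz⟩
  have hall : ∀ x v, ∃ q, Tendsto (fun a : Isom g => push n a.1 x v) l (𝓝 q) := fun x => by
    have : x ∈ S := huniv ▸ Set.mem_univ x
    exact this
  have hex : ∀ x, ∃ y, Tendsto (fun a : Isom g => a.1 x) l (𝓝 y) := fun x =>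
    ⟨_, tendsto_apply_of_push (hall x 0).choose_spec⟩
  choose f hf using hex
  have hloc : ∀ x, ContMDiffAt (𝓡 n) (𝓡 n) ∞ f x ∧
        (∀ u v, form g (f x) (der n f x u) (der n f x v) = form g x u v) ∧
        ∀ v, Tendsto (fun a : Isom g => push n a.1 x v) l (𝓝 (push n f x v)) := by
    intro x
    obtain ⟨W, hW, V, hV, H⟩ := local_convergence g x (f x)
    obtain ⟨F, hF⟩ := H l x (mem_of_mem_nhds hW) (hall x) ((hf x).eventually hV)
    -- The local limits are pointwise limits, so uniqueness of limits glues them to one global map.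
    have heq : f =ᶠ[𝓝 x] F := by
      filter_upwards [hW] with w hw
      exact tendsto_nhds_unique (hf w) (tendsto_apply_of_push ((hF w hw).2.2 0))
    obtain ⟨h1, h2, h3⟩ := hF x (mem_of_mem_nhds hW)
    have hder : der n f x = der n F x := heq.mfderiv_eq
    have hpush : ∀ v, push n f x v = push n F x v := fun v => by
      rw [push, push, hder, heq.self_of_nhds]
    refine ⟨h1.congr_of_eventuallyEq heq, ?_, fun v => ?_⟩
    · rwa [hder, heq.self_of_nhds]
    · rw [hpush]
      exact h3 v
  exact ⟨f, ⟨fun x => (hloc x).1, fun x => (hloc x).2.1⟩, fun x => (hloc x).2.2⟩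

end GlobalConvergence

/-! ### Parallel fields in charts and their behaviour under isometries -/

section ParallelTransport

set_option maxSynthPendingDepth 3

open Filter Metric

section Coordinates

variable {E : Type*} [NormedAddCommGroup E] [NormedSpace ℝ E]

theorem hasDerivAt_fderiv_apply {f : E → E} {c v : ℝ → E} {c' v' : E} {t : ℝ}
    (hf : ContDiffAt ℝ 2 f (c t)) (hc : HasDerivAt c c' t) (hv : HasDerivAt v v' t) :
    HasDerivAt (fun τ => fderiv ℝ f (c τ) (v τ))
      (fderiv ℝ (fderiv ℝ f) (c t) c' (v t) + fderiv ℝ f (c t) v') t := by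
  have hd : HasFDerivAt (fderiv ℝ f) (fderiv ℝ (fderiv ℝ f) (c t)) (c t) :=
    ((hf.fderiv_right (m := 1) (by norm_num)).differentiableAt (by simp)).hasFDerivAt
  exact (hd.comp_hasDerivAt t hc).clm_apply hv

/-- The Levi-Civita connection is compatible with the metric, in coordinates. -/
theorem IsCoordMetric.hasDerivAt_of_parallel [FiniteDimensional ℝ E] {U : Set E}
    {h : E → E →L[ℝ] E →L[ℝ] ℝ} (hh : IsCoordMetric U h) {c v w : ℝ → E} {c' : E} {t : ℝ}
    (hU : c t ∈ U) (hc : HasDerivAt c c' t)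
    (hv : HasDerivAt v (-christoffelMap h (c t) c' (v t)) t)
    (hw : HasDerivAt w (-christoffelMap h (c t) c' (w t)) t) :
    HasDerivAt (fun τ => h (c τ) (v τ) (w τ)) 0 t := by
  refine ((((hh.hasFDerivAt hU).comp_hasDerivAt t hc).clm_apply hv).clm_apply hw).congr_deriv ?_
  have hsy : ∀ a b d, fderiv ℝ h (c t) a b d = fderiv ℝ h (c t) a d b := by
    intro a b d
    have e1 : ∀ b d : E, HasFDerivAt (fun z => h z b d)
        (((fderiv ℝ h (c t)).flip b).flip d) (c t) := by
      intro b d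
      have := ((hh.hasFDerivAt hU).clm_apply (hasFDerivAt_const b _)).clm_apply
        (hasFDerivAt_const d _)
      refine this.congr_fderiv ?_
      ext; simp
    have e2 : (fun z => h z d b) =ᶠ[𝓝 (c t)] fun z => h z b d := by
      filter_upwards [hh.isOpen.mem_nhds hU] with z hz using hh.symm z hz d b
    exact DFunLike.congr_fun ((e1 b d).unique ((e1 d b).congr_of_eventuallyEq e2.symm)) a
  simp only [Function.comp_apply, map_neg, add_apply, neg_apply]
  rw [hh.symm _ hU (v t), hh.apply_christoffelMap hU, hh.apply_christoffelMap hU,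
    christoffelForm_apply, christoffelForm_apply, hsy c' (w t), hsy (w t), hsy (v t)]
  ring

end Coordinates

local notation "𝔼" n => EuclideanSpace ℝ (Fin n)

/-- The velocity of a curve, as a vector of the model space. -/
noncomputable def vel (n : ℕ) {M : Type*} [TopologicalSpace M]
    [ChartedSpace (EuclideanSpace ℝ (Fin n)) M] (γ : ℝ → M) (t : ℝ) : 𝔼 n := velocity n γ t

variable {n : ℕ} {M : Type*} [TopologicalSpace M] [ChartedSpace (EuclideanSpace ℝ (Fin n)) M]
  [IsManifold (𝓡 n) ∞ M]

/-- The equation of parallel fields at the time `t`, in the chart at `x`. -/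
def IsParallelAt (g : Metric n M) (γ : ℝ → M) (V : ℝ → 𝔼 n) (x : M) (t : ℝ) : Prop :=
  HasDerivAt (fun s => chartDer n x (γ s) (V s))
    (-christoffelMap (chartForm g x) (extChartAt (𝓡 n) x (γ t)) (chartDer n x (γ t) (vel n γ t))
      (chartDer n x (γ t) (V t))) t

/-- The field `V` along `γ` is parallel on the time interval `I`. -/
def IsParallelOn (g : Metric n M) (γ : ℝ → M) (I : Set ℝ) (V : ℝ → 𝔼 n) : Prop :=
  ∀ t ∈ I, ∀ x, γ t ∈ (extChartAt (𝓡 n) x).source → IsParallelAt g γ V x t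

/-- Nondegeneracy of the metric solves the equation tested against all `w` for the derivative,
giving an explicit linear differential equation. -/
theorem isParallel_iff (g : Metric n M) (γ : ℝ → M) (V : ℝ → 𝔼 n) :
    IsParallel g γ V ↔ IsParallelOn g γ Set.univ V := by
  have key : ∀ (x : M) (t : ℝ), γ t ∈ (extChartAt (𝓡 n) x).source → ∀ v' : 𝔼 n,
      (∀ w : 𝔼 n, chartMetric g x (extChartAt (𝓡 n) x (γ t)) v' w +
          christoffel g x (extChartAt (𝓡 n) x (γ t))
            (chartDer n x (γ t) (vel n γ t)) (chartDer n x (γ t) (V t)) w = 0) ↔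
      v' = -christoffelMap (chartForm g x) (extChartAt (𝓡 n) x (γ t))
        (chartDer n x (γ t) (vel n γ t)) (chartDer n x (γ t) (V t)) := by
    intro x t ht v'
    have hy := (extChartAt (𝓡 n) x).map_source ht
    have hg := isCoordMetric_chartForm g x
    simp only [chartMetric_eq, christoffel_eq g x hy, ← hg.apply_christoffelMap hy]
    rw [← add_eq_zero_iff_eq_neg]
    constructor
    · intro h
      refine hg.eq_zero_of_forall hy fun w => ?_
      rw [map_add]
      exact h w
    · intro h w
      have := congrArg (fun u => chartForm g x (extChartAt (𝓡 n) x (γ t)) u w) h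
      simpa using this
  constructor
  · intro h t _ x hx
    obtain ⟨v', h1, h2⟩ := h x t hx
    have := (key x t hx v').1 h2
    rw [this] at h1
    exact h1
  · intro h x t hx
    exact ⟨_, h t (Set.mem_univ t) x hx, (key x t hx _).2 rfl⟩

theorem IsParallelAt.congr {g : Metric n M} {γ : ℝ → M} {V V' : ℝ → 𝔼 n} {x : M} {t : ℝ}
    (h : IsParallelAt g γ V x t) (hV : V' =ᶠ[𝓝 t] V) : IsParallelAt g γ V' x t := by
  unfold IsParallelAt
  rw [hV.self_of_nhds]
  exact HasDerivAt.congr_of_eventuallyEq h (hV.mono fun s hs => by simp only [hs])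

variable {g : Metric n M} {γ : ℝ → M}

theorem hasDerivAt_chart (hγ : ContMDiff 𝓘(ℝ, ℝ) (𝓡 n) ∞ γ) {x : M} {t : ℝ}
    (ht : γ t ∈ (extChartAt (𝓡 n) x).source) :
    HasDerivAt (fun s => extChartAt (𝓡 n) x (γ s)) (chartDer n x (γ t) (vel n γ t)) t := by
  have h := ((mdiffAt_chart ht).hasMFDerivAt.comp t
    (hγ.mdifferentiable (by simp) t).hasMFDerivAt).hasFDerivAt
  have h2 : HasFDerivAt (fun s => extChartAt (𝓡 n) x (γ s))
    ((chartDer n x (γ t)).comp (mfderiv 𝓘(ℝ, ℝ) (𝓡 n) γ t : ℝ →L[ℝ] 𝔼 n)) t := h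
  exact h2.hasDerivAt

omit [IsManifold (𝓡 n) ∞ M] in
theorem eventually_mem_source (hγ : ContMDiff 𝓘(ℝ, ℝ) (𝓡 n) ∞ γ) {x : M} {t : ℝ}
    (ht : γ t ∈ (extChartAt (𝓡 n) x).source) : ∀ᶠ s in 𝓝 t, γ s ∈ (extChartAt (𝓡 n) x).source :=
  hγ.continuous.continuousAt.eventually ((isOpen_extChartAt_source x).mem_nhds ht)

/-- The differential of a map that preserves the metric, in charts, and its derivative. -/
theorem fderiv_rep_chartDer {f : M → M} (hf : PreservesMetric g f) {x y z : M}
    (hz : z ∈ (extChartAt (𝓡 n) x).source) (hfz : f z ∈ (extChartAt (𝓡 n) y).source) (v : 𝔼 n) :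
    fderiv ℝ (rep n x y f) (extChartAt (𝓡 n) x z) (chartDer n x z v) =
      chartDer n y (f z) (der n f z v) := by
  have hzs : (extChartAt (𝓡 n) x).symm (extChartAt (𝓡 n) x z) = z := PartialEquiv.left_inv _ hz
  rw [fderiv_rep (PartialEquiv.map_source _ hz) (hf.1.mdifferentiable (by simp) _) (by rwa [hzs]),
    symmDer_chartDer hz, hzs]

theorem chartDer_injective {x z : M} (hz : z ∈ (extChartAt (𝓡 n) x).source) :
    Function.Injective (chartDer n x z) := fun v w h => by
  rw [← symmDer_chartDer hz v, h, symmDer_chartDer hz]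

/-- The chain rule. It is read in charts because `f (γ t)` and `γ₂ (t + s)` are only propositionally
equal, and so are their tangent spaces. -/
theorem vel_of_comp {f : M → M} (hf : PreservesMetric g f) {γ₂ : ℝ → M}
    (hγ : ContMDiff 𝓘(ℝ, ℝ) (𝓡 n) ∞ γ) (hγ₂ : ContMDiff 𝓘(ℝ, ℝ) (𝓡 n) ∞ γ₂) {s : ℝ}
    (h : ∀ t, f (γ t) = γ₂ (t + s)) (t : ℝ) : vel n γ₂ (t + s) = der n f (γ t) (vel n γ t) := by
  have hx := mem_extChartAt_source (I := 𝓡 n) (γ t)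
  have hy := mem_extChartAt_source (I := 𝓡 n) (γ₂ (t + s))
  have hfy : f (γ t) ∈ (extChartAt (𝓡 n) (γ₂ (t + s))).source := by rwa [h]
  refine chartDer_injective hy ?_
  have h1 := (hasDerivAt_chart hγ₂ hy).comp_add_const t s
  have h2 := ((contDiffAt_rep (x := γ t) (y := γ₂ (t + s)) (f := f) (PartialEquiv.map_source _ hx)
    hf.1.contMDiffAt (by rwa [PartialEquiv.left_inv _ hx])).differentiableAt
      (by simp)).hasFDerivAt.comp_hasDerivAt t (hasDerivAt_chart hγ hx)
  have h3 : (fun τ => extChartAt (𝓡 n) (γ₂ (t + s)) (γ₂ (τ + s))) =ᶠ[𝓝 t]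
      (rep n (γ t) (γ₂ (t + s)) f) ∘ (fun τ => extChartAt (𝓡 n) (γ t) (γ τ)) := by
    filter_upwards [eventually_mem_source hγ hx] with τ hτ
    rw [Function.comp_apply, rep, PartialEquiv.left_inv _ hτ, h]
  have h4 := h1.unique (h2.congr_of_eventuallyEq h3)
  rw [h4, fderiv_rep_chartDer hf hx hfy, h]

/-- Maps that preserve the metric map parallel fields to parallel fields. -/
theorem IsParallelAt.transfer {f : M → M} (hf : PreservesMetric g f) {γ₂ : ℝ → M}
    (hγ : ContMDiff 𝓘(ℝ, ℝ) (𝓡 n) ∞ γ) (hγ₂ : ContMDiff 𝓘(ℝ, ℝ) (𝓡 n) ∞ γ₂) {s : ℝ}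
    (h : ∀ t, f (γ t) = γ₂ (t + s)) {V : ℝ → 𝔼 n} {x y : M} {t : ℝ}
    (hx : γ t ∈ (extChartAt (𝓡 n) x).source) (hy : γ₂ (t + s) ∈ (extChartAt (𝓡 n) y).source)
    (hV : IsParallelAt g γ V x t) :
    IsParallelAt g γ₂ (fun τ => der n f (γ (τ - s)) (V (τ - s))) y (t + s) := by
  have hfy : f (γ t) ∈ (extChartAt (𝓡 n) y).source := by rwa [h]
  have hw := PartialEquiv.map_source _ hx
  have hws : (extChartAt (𝓡 n) x).symm (extChartAt (𝓡 n) x (γ t)) = γ t :=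
    PartialEquiv.left_inv _ hx
  have hrep : rep n x y f (extChartAt (𝓡 n) x (γ t)) = extChartAt (𝓡 n) y (γ₂ (t + s)) := by
    rw [rep, hws, h]
  have hcd : ContDiffAt ℝ 2 (rep n x y f) (extChartAt (𝓡 n) x (γ t)) :=
    (contDiffAt_rep hw hf.1.contMDiffAt (by rwa [hws])).of_le (by norm_cast)
  have hiso : ∀ᶠ z in 𝓝 (extChartAt (𝓡 n) x (γ t)), ∀ v w, chartForm g y (rep n x y f z)
      (fderiv ℝ (rep n x y f) z v) (fderiv ℝ (rep n x y f) z w) = chartForm g x z v w := by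
    have h1 : ContinuousAt (fun z => f ((extChartAt (𝓡 n) x).symm z))
        (extChartAt (𝓡 n) x (γ t)) :=
      hf.1.continuous.continuousAt.comp ((continuousOn_extChartAt_symm x).continuousAt
        ((isOpen_extChartAt_target x).mem_nhds hw))
    have h2 : f ((extChartAt (𝓡 n) x).symm (extChartAt (𝓡 n) x (γ t))) ∈
        (extChartAt (𝓡 n) y).source := by rwa [hws]
    filter_upwards [(isOpen_extChartAt_target x).mem_nhds hw,
      h1.eventually ((isOpen_extChartAt_source y).mem_nhds h2)] with z hz hzy v w
    rw [chartForm_rep hz (hf.1.mdifferentiable (by simp) _) hzy, hf.form_der, chartForm_apply]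
  -- The derivative of Df(V) has a term with D²f. By the transformation law, its source Christoffel
  -- part cancels the one from the equation of `V`, leaving exactly the target equation.
  have hK := (isCoordMetric_chartForm g x).fderiv_fderiv_of_isometry (isCoordMetric_chartForm g y)
    hw (by rw [hrep]; exact PartialEquiv.map_source _ hy) hcd hiso
    (chartDer n x (γ t) (vel n γ t)) (chartDer n x (γ t) (V t))
  have h2 := hasDerivAt_fderiv_apply (c := fun τ => extChartAt (𝓡 n) x (γ τ)) hcd
    (hasDerivAt_chart hγ hx) hV
  have h3 : (fun τ => chartDer n y (γ₂ (τ + s)) (der n f (γ τ) (V τ))) =ᶠ[𝓝 t]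
      fun τ => fderiv ℝ (rep n x y f) (extChartAt (𝓡 n) x (γ τ)) (chartDer n x (γ τ) (V τ)) := by
    filter_upwards [eventually_mem_source hγ hx,
      ((continuous_add_const s).tendsto t).eventually (eventually_mem_source hγ₂ hy)] with τ hτ hτ'
    rw [fderiv_rep_chartDer hf hτ (by rwa [h]), h]
  have h4 := h2.congr_of_eventuallyEq h3
  have h5 : HasDerivAt (fun τ => chartDer n y (γ₂ τ) (der n f (γ (τ - s)) (V (τ - s)))) _ (t + s) :=
    HasDerivAt.congr_of_eventuallyEq (HasDerivAt.comp_sub_const (t + s) s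
      (by rw [add_sub_cancel_right]; exact h4))
      (Eventually.of_forall fun τ => by simp only [sub_add_cancel])
  refine h5.congr_deriv ?_
  rw [hK, hrep, fderiv_rep_chartDer hf hx hfy, fderiv_rep_chartDer hf hx hfy,
    vel_of_comp hf hγ hγ₂ h, h]
  simp only [add_sub_cancel_right, map_neg]
  abel

omit [IsManifold (𝓡 n) ∞ M] in
theorem der_id (z : M) (v : 𝔼 n) : der n (fun x : M => x) z v = v := by
  have : mfderiv (𝓡 n) (𝓡 n) (fun x : M => x) z = _ := mfderiv_id
  exact DFunLike.congr_fun this v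

/-- A change of charts is the identity map read in two charts, so this is the isometry case with
shift zero. -/
theorem IsParallelAt.change_chart (hγ : ContMDiff 𝓘(ℝ, ℝ) (𝓡 n) ∞ γ) {V : ℝ → 𝔼 n} {x y : M}
    {t : ℝ} (hx : γ t ∈ (extChartAt (𝓡 n) x).source) (hy : γ t ∈ (extChartAt (𝓡 n) y).source)
    (hV : IsParallelAt g γ V x t) : IsParallelAt g γ V y t := by
  have := hV.transfer (s := 0) (γ₂ := γ) (y := y) (PreservesMetric.id g) hγ hγ (by simp) hx
    (by simpa using hy)
  simpa [der_id] using this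

theorem IsParallelAt.hasDerivAt_form (hγ : ContMDiff 𝓘(ℝ, ℝ) (𝓡 n) ∞ γ) {V W : ℝ → 𝔼 n} {x : M}
    {t : ℝ} (hx : γ t ∈ (extChartAt (𝓡 n) x).source) (hV : IsParallelAt g γ V x t)
    (hW : IsParallelAt g γ W x t) : HasDerivAt (fun s => form g (γ s) (V s) (W s)) 0 t := by
  have h1 := (isCoordMetric_chartForm g x).hasDerivAt_of_parallel
    (c := fun s => extChartAt (𝓡 n) x (γ s)) (PartialEquiv.map_source _ hx)
    (hasDerivAt_chart hγ hx) hV hW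
  refine h1.congr_of_eventuallyEq ?_
  filter_upwards [eventually_mem_source hγ hx] with s hs
  rw [chartForm_chartDer g hs]

end ParallelTransport

/-! ### Existence and uniqueness of parallel fields on the whole line -/

section ParallelTransportExistence

set_option maxSynthPendingDepth 3

open Filter Metric

/-- Existence of solutions of linear differential equations, on a uniform time interval. -/
theorem exists_linear_ode_solution {E : Type*} [NormedAddCommGroup E] [NormedSpace ℝ E]
    [CompleteSpace E] {A : ℝ → E →L[ℝ] E} {t₀ ε K : ℝ} (hK0 : 0 ≤ K) (hKε : K * (4 * ε) ≤ 1)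
    (hA : ContinuousOn A (Set.Icc (t₀ - ε) (t₀ + ε)))
    (hK : ∀ t ∈ Set.Icc (t₀ - ε) (t₀ + ε), ‖A t‖ ≤ K)
    {t₁ : ℝ} (ht₁ : t₁ ∈ Set.Ioo (t₀ - ε) (t₀ + ε)) (v : E) :
    ∃ α : ℝ → E, α t₁ = v ∧ ∀ t ∈ Set.Ioo (t₀ - ε) (t₀ + ε), HasDerivAt α (A t (α t)) t := by
  -- On the ball of radius ‖v‖ + 1 about `v` the field is at most K(2‖v‖ + 1), and over a time of at
  -- most 2ε this moves by at most ‖v‖ + 1 since 4Kε ≤ 1. By linearity the interval thus depends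
  -- neither on `v` nor on `t₁`.
  have hPL : IsPicardLindelof (fun t y => A t y) (tmin := t₀ - ε) (tmax := t₀ + ε)
      ⟨t₁, ht₁.1.le, ht₁.2.le⟩ v (‖v‖₊ + 1) 0 (K.toNNReal * (2 * ‖v‖₊ + 1)) K.toNNReal := by
    refine ⟨fun t ht => ?_, fun y _ => hA.clm_apply continuousOn_const, fun t ht y hy => ?_, ?_⟩
    · refine LipschitzWith.lipschitzOnWith (LipschitzWith.weaken (A t).lipschitz ?_)
      rw [← NNReal.coe_le_coe, Real.coe_toNNReal _ hK0]
      exact hK t ht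
    · rw [mem_closedBall, dist_eq_norm] at hy
      have h1 : ‖y‖ ≤ 2 * ‖v‖ + 1 := by
        have := norm_le_norm_sub_add y v
        push_cast at hy
        linarith
      push_cast
      rw [Real.coe_toNNReal _ hK0]
      exact ((A t).le_opNorm y).trans (mul_le_mul (hK t ht) h1 (norm_nonneg _) hK0)
    · push_cast
      rw [Real.coe_toNNReal _ hK0]
      have h1 : max (t₀ + ε - t₁) (t₁ - (t₀ - ε)) ≤ 2 * ε :=
        max_le (by linarith [ht₁.1]) (by linarith [ht₁.2])
      have h2 := norm_nonneg v
      have h3 : K * (2 * ‖v‖ + 1) * max (t₀ + ε - t₁) (t₁ - (t₀ - ε)) ≤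
          K * (2 * ‖v‖ + 1) * (2 * ε) := by gcongr
      nlinarith
  obtain ⟨α, hα, hd⟩ := hPL.exists_eq_forall_mem_Icc_hasDerivWithinAt₀
  exact ⟨α, hα, fun t ht => (hd t ⟨ht.1.le, ht.2.le⟩).hasDerivAt (Icc_mem_nhds ht.1 ht.2)⟩

local notation "𝔼" n => EuclideanSpace ℝ (Fin n)

variable {n : ℕ} {M : Type*} [TopologicalSpace M] [ChartedSpace (EuclideanSpace ℝ (Fin n)) M]
  [IsManifold (𝓡 n) ∞ M] {g : Metric n M} {γ : ℝ → M}

theorem IsParallelOn.mono {I J : Set ℝ} {V : ℝ → 𝔼 n} (h : IsParallelOn g γ J V) (hIJ : I ⊆ J) :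
    IsParallelOn g γ I V := fun t ht => h t (hIJ ht)

theorem IsParallelOn.add {I : Set ℝ} {V W : ℝ → 𝔼 n} (hV : IsParallelOn g γ I V)
    (hW : IsParallelOn g γ I W) : IsParallelOn g γ I (fun t => V t + W t) := by
  intro t ht x hx
  have h := HasDerivAt.add (hV t ht x hx) (hW t ht x hx)
  unfold IsParallelAt
  simp only [map_add]
  refine h.congr_deriv ?_
  abel

theorem IsParallelOn.const_smul {I : Set ℝ} {V : ℝ → 𝔼 n} (hV : IsParallelOn g γ I V) (c : ℝ) :
    IsParallelOn g γ I (fun t => c • V t) := by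
  intro t ht x hx
  have h := HasDerivAt.const_smul c (hV t ht x hx)
  unfold IsParallelAt
  simp only [map_smul]
  refine h.congr_deriv ?_
  rw [smul_neg]

theorem IsParallelOn.form_eq (hγ : ContMDiff 𝓘(ℝ, ℝ) (𝓡 n) ∞ γ) {I : Set ℝ} (hI : IsOpen I)
    (hI' : IsPreconnected I) {V W : ℝ → 𝔼 n} (hV : IsParallelOn g γ I V)
    (hW : IsParallelOn g γ I W) {s t : ℝ} (hs : s ∈ I) (ht : t ∈ I) :
    form g (γ s) (V s) (W s) = form g (γ t) (V t) (W t) := by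
  have hd : ∀ t ∈ I, HasDerivAt (fun s => form g (γ s) (V s) (W s)) 0 t := fun t ht =>
    (hV t ht _ (mem_extChartAt_source (γ t))).hasDerivAt_form hγ (mem_extChartAt_source (γ t))
      (hW t ht _ (mem_extChartAt_source (γ t)))
  exact hI.is_const_of_deriv_eq_zero hI' (fun t ht => (hd t ht).differentiableAt.differentiableWithinAt)
    (fun t ht => (hd t ht).deriv) hs ht

/-- The difference is parallel, hence of constant length, and the metric is definite. -/
theorem IsParallelOn.eqOn (hγ : ContMDiff 𝓘(ℝ, ℝ) (𝓡 n) ∞ γ) {I : Set ℝ} (hI : IsOpen I)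
    (hI' : IsPreconnected I) {V W : ℝ → 𝔼 n} (hV : IsParallelOn g γ I V)
    (hW : IsParallelOn g γ I W) {s t : ℝ} (hs : s ∈ I) (ht : t ∈ I) (h : V s = W s) :
    V t = W t := by
  have hD := hV.add (hW.const_smul (-1))
  have h1 := hD.form_eq hγ hI hI' hD hs ht
  by_contra hne
  have h2 : V t + (-1 : ℝ) • W t ≠ 0 := by
    rw [neg_one_smul, ← sub_eq_add_neg]
    exact sub_ne_zero.2 hne
  have h3 := form_pos g (γ t) h2
  rw [← h1, h] at h3
  simp at h3

/-- Every vector at a time of `(a, b)` extends to a parallel field on `(a, b)`. -/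
def HasParallelTransport (g : Metric n M) (γ : ℝ → M) (a b : ℝ) : Prop :=
  ∀ t ∈ Set.Ioo a b, ∀ v : 𝔼 n, ∃ V, IsParallelOn g γ (Set.Ioo a b) V ∧ V t = v

theorem HasParallelTransport.mono {a b c d : ℝ} (h : HasParallelTransport g γ a b) (hac : a ≤ c)
    (hdb : d ≤ b) : HasParallelTransport g γ c d := by
  intro t ht v
  obtain ⟨V, hV, hVt⟩ := h t (Set.Ioo_subset_Ioo hac hdb ht) v
  exact ⟨V, hV.mono (Set.Ioo_subset_Ioo hac hdb), hVt⟩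

theorem exists_hasParallelTransport (hγ : ContMDiff 𝓘(ℝ, ℝ) (𝓡 n) ∞ γ) (t₀ : ℝ) :
    ∃ ε > 0, HasParallelTransport g γ (t₀ - ε) (t₀ + ε) := by
  set x := γ t₀
  set O : Set ℝ := γ ⁻¹' (extChartAt (𝓡 n) x).source with hO
  have hOo : IsOpen O := (isOpen_extChartAt_source x).preimage hγ.continuous
  have hc : ∀ t ∈ O, HasDerivAt (fun s => extChartAt (𝓡 n) x (γ s))
      (chartDer n x (γ t) (vel n γ t)) t := fun t ht => hasDerivAt_chart hγ ht
  have hcs : ContDiffOn ℝ ∞ (fun s => extChartAt (𝓡 n) x (γ s)) O := by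
    have h1 : ContMDiffOn 𝓘(ℝ, ℝ) (𝓡 n) ∞ (fun s => extChartAt (𝓡 n) x (γ s)) O :=
      (contMDiffOn_chart x).comp hγ.contMDiffOn fun t ht => ht
    exact h1.contDiffOn
  have hu : ContinuousOn (fun t => chartDer n x (γ t) (vel n γ t)) O :=
    (hcs.continuousOn_deriv_of_isOpen hOo (by simp)).congr fun t ht => (hc t ht).deriv.symm
  set A : ℝ → (𝔼 n) →L[ℝ] (𝔼 n) := fun t =>
    -christoffelMap (chartForm g x) (extChartAt (𝓡 n) x (γ t)) (chartDer n x (γ t) (vel n γ t))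
    with hA
  have hAc : ContinuousOn A O :=
    (((isCoordMetric_chartForm g x).contDiffOn_christoffelMap.continuousOn.comp hcs.continuousOn
      fun t ht => PartialEquiv.map_source _ ht).clm_apply hu).neg
  obtain ⟨δ, hδ, hδO⟩ := nhds_basis_closedBall.mem_iff.1
    (hOo.mem_nhds (show t₀ ∈ O from mem_extChartAt_source x))
  obtain ⟨K, hK⟩ := (isCompact_closedBall t₀ δ).exists_bound_of_continuousOn (hAc.mono hδO)
  have hK0 : 0 ≤ K := (norm_nonneg _).trans (hK t₀ (mem_closedBall_self hδ.le))
  set ε : ℝ := min δ (1 / (4 * (K + 1))) with hε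
  have hεpos : 0 < ε := by positivity
  have hKε : K * (4 * ε) ≤ 1 := by
    have : ε ≤ 1 / (4 * (K + 1)) := min_le_right _ _
    rw [le_div_iff₀ (by positivity)] at this
    nlinarith
  have hsub : Set.Icc (t₀ - ε) (t₀ + ε) ⊆ closedBall t₀ δ := by
    rw [Real.closedBall_eq_Icc]
    exact Set.Icc_subset_Icc (by linarith [min_le_left δ (1 / (4 * (K + 1)))])
      (by linarith [min_le_left δ (1 / (4 * (K + 1)))])
  refine ⟨ε, hεpos, fun t₁ ht₁ v => ?_⟩
  obtain ⟨α, hα, hd⟩ := exists_linear_ode_solution hK0 hKε (hAc.mono (hsub.trans hδO))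
    (fun t ht => hK t (hsub ht)) ht₁ (chartDer n x (γ t₁) v)
  have hcoord : ∀ t ∈ O, chartDer n x (γ t) (symmDer x (extChartAt (𝓡 n) x (γ t)) (α t)) = α t := by
    intro t ht
    have := chartDer_symmDer (PartialEquiv.map_source _ ht) (α t)
    rwa [PartialEquiv.left_inv _ ht] at this
  have hIsub : Set.Ioo (t₀ - ε) (t₀ + ε) ⊆ O := fun t ht => hδO (hsub ⟨ht.1.le, ht.2.le⟩)
  refine ⟨fun t => symmDer x (extChartAt (𝓡 n) x (γ t)) (α t), fun t ht y hy => ?_, ?_⟩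
  · refine IsParallelAt.change_chart (x := x) hγ (hIsub ht) hy ?_
    unfold IsParallelAt
    rw [hcoord t (hIsub ht)]
    refine (hd t ht).congr_of_eventuallyEq ?_
    filter_upwards [hOo.mem_nhds (hIsub ht)] with s hs using hcoord s hs
  · simp only [hα]
    exact symmDer_chartDer (hIsub ht₁) v

/-- Fields matched at one time `m` of the overlap agree on the whole overlap by uniqueness, so
switching from one to the other at `m` is parallel. -/
theorem HasParallelTransport.glue (hγ : ContMDiff 𝓘(ℝ, ℝ) (𝓡 n) ∞ γ) {a b c d : ℝ}
    (hac : a < c) (hcb : c < b) (hbd : b < d) (h₁ : HasParallelTransport g γ a b)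
    (h₂ : HasParallelTransport g γ c d) : HasParallelTransport g γ a d := by
  obtain ⟨m, hcm, hmb⟩ := exists_between hcb
  have key : ∀ V₁ V₂ : ℝ → 𝔼 n, IsParallelOn g γ (Set.Ioo a b) V₁ →
      IsParallelOn g γ (Set.Ioo c d) V₂ → V₁ m = V₂ m →
      ∃ V, IsParallelOn g γ (Set.Ioo a d) V ∧ Set.EqOn V V₁ (Set.Ioo a b) ∧
        Set.EqOn V V₂ (Set.Ioo c d) := by
    intro V₁ V₂ hV₁ hV₂ hm
    have hov : ∀ t ∈ Set.Ioo c b, V₁ t = V₂ t := fun t ht =>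
      (hV₁.mono (Set.Ioo_subset_Ioo_left hac.le)).eqOn hγ isOpen_Ioo isPreconnected_Ioo
        (hV₂.mono (Set.Ioo_subset_Ioo_right hbd.le)) ⟨hcm, hmb⟩ ht hm
    have e1 : Set.EqOn (fun t => if t < m then V₁ t else V₂ t) V₁ (Set.Ioo a b) := by
      intro t ht
      by_cases htm : t < m
      · simp [htm]
      · simp only [htm, if_false]
        exact (hov t ⟨hcm.trans_le (not_lt.1 htm), ht.2⟩).symm
    have e2 : Set.EqOn (fun t => if t < m then V₁ t else V₂ t) V₂ (Set.Ioo c d) := by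
      intro t ht
      by_cases htm : t < m
      · simp only [htm, if_true]
        exact hov t ⟨ht.1, htm.trans hmb⟩
      · simp [htm]
    refine ⟨_, fun t ht x hx => ?_, e1, e2⟩
    rcases lt_or_ge t b with htb | htb
    · exact (hV₁ t ⟨ht.1, htb⟩ x hx).congr
        (by filter_upwards [isOpen_Ioo.mem_nhds ⟨ht.1, htb⟩] with s hs using e1 hs)
    · have htc : t ∈ Set.Ioo c d := ⟨hcb.trans_le htb, ht.2⟩
      exact (hV₂ t htc x hx).congr
        (by filter_upwards [isOpen_Ioo.mem_nhds htc] with s hs using e2 hs)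
  intro t ht v
  rcases lt_or_ge t b with htb | htb
  · obtain ⟨V₁, hV₁, hv⟩ := h₁ t ⟨ht.1, htb⟩ v
    obtain ⟨V₂, hV₂, hm⟩ := h₂ m ⟨hcm, hmb.trans hbd⟩ (V₁ m)
    obtain ⟨V, hV, e1, -⟩ := key V₁ V₂ hV₁ hV₂ hm.symm
    exact ⟨V, hV, (e1 ⟨ht.1, htb⟩).trans hv⟩
  · have htc : t ∈ Set.Ioo c d := ⟨hcb.trans_le htb, ht.2⟩
    obtain ⟨V₂, hV₂, hv⟩ := h₂ t htc v
    obtain ⟨V₁, hV₁, hm⟩ := h₁ m ⟨hac.trans hcm, hmb⟩ (V₂ m)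
    obtain ⟨V, hV, -, e2⟩ := key V₁ V₂ hV₁ hV₂ hm
    exact ⟨V, hV, (e2 htc).trans hv⟩

theorem hasParallelTransport (hγ : ContMDiff 𝓘(ℝ, ℝ) (𝓡 n) ∞ γ) {N : ℝ} (hN : 0 ≤ N) :
    HasParallelTransport g γ (-N) N := by
  choose ε hε hloc using fun t => exists_hasParallelTransport (g := g) hγ t
  -- A Lebesgue number gives a step valid at all times of [-N, N], so finitely many gluings suffice.
  obtain ⟨δ, hδ, hleb⟩ := lebesgue_number_lemma_of_metric (isCompact_Icc (a := -N) (b := N))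
    (c := fun t => ball t (ε t)) (fun t => isOpen_ball)
    (fun t _ => Set.mem_iUnion.2 ⟨t, mem_ball_self (hε t)⟩)
  have hunif : ∀ t ∈ Set.Icc (-N) N, HasParallelTransport g γ (t - δ) (t + δ) := by
    intro t ht
    obtain ⟨i, hi⟩ := hleb t ht
    rw [Real.ball_eq_Ioo, Real.ball_eq_Ioo, Set.Ioo_subset_Ioo_iff (by linarith)] at hi
    exact (hloc i).mono hi.1 hi.2
  have hstep : ∀ k : ℕ, -N + k * δ ≤ N →
      HasParallelTransport g γ (-N - δ) (-N + (k + 1) * δ) := by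
    intro k
    induction k with
    | zero =>
      intro _
      simpa using hunif (-N) ⟨le_rfl, by linarith⟩
    | succ k ih =>
      intro hk
      push_cast at hk ⊢
      have hk0 : (0 : ℝ) ≤ k * δ := by positivity
      have h1 := ih (by linarith)
      have h2 := hunif (-N + (k + 1) * δ) ⟨by linarith, hk⟩
      have h3 := h1.glue hγ (by linarith) (by linarith) (by linarith) h2
      convert h3 using 1
      ring
  have hfl := Nat.floor_le (show 0 ≤ 2 * N / δ by positivity)
  have hlt := Nat.lt_floor_add_one (2 * N / δ)
  rw [le_div_iff₀ hδ] at hfl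
  rw [div_lt_iff₀ hδ] at hlt
  exact (hstep ⌊2 * N / δ⌋₊ (by linarith)).mono (by linarith) (by linarith)

/-- Exhaustion by intervals around zero that all contain `s`. The solutions agree on common
intervals by uniqueness, so at the time `t` the one of index `⌈|t|⌉₊` may be used. -/
theorem exists_parallel (hγ : ContMDiff 𝓘(ℝ, ℝ) (𝓡 n) ∞ γ) (s : ℝ) (v : 𝔼 n) :
    ∃ V, IsParallelOn g γ Set.univ V ∧ V s = v := by
  have hmem : ∀ k : ℕ, s ∈ Set.Ioo (-(|s| + k + 1)) (|s| + k + 1) := by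
    intro k
    have : (0 : ℝ) ≤ k := k.cast_nonneg
    rw [Set.mem_Ioo, ← abs_lt]
    linarith
  choose V hV hVs using fun k : ℕ => hasParallelTransport (g := g) hγ
    (N := |s| + k + 1) (by positivity) s (hmem k) v
  have hagree : ∀ j k : ℕ, j ≤ k → ∀ t ∈ Set.Ioo (-(|s| + j + 1)) (|s| + j + 1),
      V k t = V j t := by
    intro j k hjk t ht
    have hc : (j : ℝ) ≤ k := by exact_mod_cast hjk
    exact ((hV k).mono (Set.Ioo_subset_Ioo (by linarith) (by linarith))).eqOn hγ isOpen_Ioo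
      isPreconnected_Ioo (hV j) (hmem j) ht ((hVs k).trans (hVs j).symm)
  have hin : ∀ t : ℝ, t ∈ Set.Ioo (-(|s| + (⌈|t|⌉₊ : ℕ) + 1)) (|s| + (⌈|t|⌉₊ : ℕ) + 1) := by
    intro t
    have := Nat.le_ceil |t|
    rw [Set.mem_Ioo, ← abs_lt]
    linarith [abs_nonneg s]
  have heq : ∀ (k : ℕ), ∀ t ∈ Set.Ioo (-(|s| + k + 1)) (|s| + k + 1), V ⌈|t|⌉₊ t = V k t := by
    intro k t ht
    rcases le_total ⌈|t|⌉₊ k with h | h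
    · exact (hagree _ _ h t (hin t)).symm
    · exact hagree _ _ h t ht
  refine ⟨fun t => V ⌈|t|⌉₊ t, fun t _ x hx => ?_, hVs _⟩
  refine (hV ⌈|t|⌉₊ t (hin t) x hx).congr ?_
  filter_upwards [isOpen_Ioo.mem_nhds (hin t)] with τ hτ using heq _ τ hτ

end ParallelTransportExistence

/-! ### The parallel transport operator -/

section TransportOperator

set_option maxSynthPendingDepth 3

open Filter Metric

local notation "𝔼" n => EuclideanSpace ℝ (Fin n)

variable {n : ℕ} {M : Type*} [TopologicalSpace M] [ChartedSpace (EuclideanSpace ℝ (Fin n)) M]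
  [IsManifold (𝓡 n) ∞ M]

/-- The parallel transport along `γ`, as a linear map of the model space. -/
noncomputable def transport (g : Metric n M) (γ : ℝ → M) (s t : ℝ) : (𝔼 n) →L[ℝ] (𝔼 n) :=
  parallelTransport g γ s t

variable {g : Metric n M} {γ : ℝ → M}

/-- Linearity comes from uniqueness: sums and multiples of parallel fields are the parallel fields
with the corresponding initial vectors. -/
theorem exists_isParallelTransport (hγ : ContMDiff 𝓘(ℝ, ℝ) (𝓡 n) ∞ γ) (s t : ℝ) :
    ∃ L, IsParallelTransport g γ s t L := by
  choose V hV hVs using fun v : 𝔼 n => exists_parallel (g := g) hγ s v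
  have heq : ∀ {V W : ℝ → 𝔼 n}, IsParallelOn g γ Set.univ V → IsParallelOn g γ Set.univ W →
      V s = W s → V t = W t := fun hV hW h =>
    hV.eqOn hγ isOpen_univ isPreconnected_univ hW (Set.mem_univ s) (Set.mem_univ t) h
  let T : (𝔼 n) →ₗ[ℝ] (𝔼 n) :=
    { toFun := fun v => V v t
      map_add' := fun v w => heq (hV (v + w)) ((hV v).add (hV w)) (by simp only [hVs])
      map_smul' := fun c v => heq (hV (c • v)) ((hV v).const_smul c) (by simp only [hVs]) }
  refine ⟨(LinearMap.toContinuousLinearMap T : (𝔼 n) →L[ℝ] (𝔼 n)), fun v => ?_⟩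
  exact ⟨V v, (isParallel_iff g γ (V v)).2 (hV v), hVs v, rfl⟩

theorem transport_apply (hγ : ContMDiff 𝓘(ℝ, ℝ) (𝓡 n) ∞ γ) {V : ℝ → 𝔼 n}
    (hV : IsParallelOn g γ Set.univ V) (s t : ℝ) : transport g γ s t (V s) = V t := by
  have hex := exists_isParallelTransport (g := g) hγ s t
  have hspec : IsParallelTransport g γ s t (parallelTransport g γ s t) := by
    rw [parallelTransport, dif_pos hex]
    exact hex.choose_spec
  obtain ⟨W, hW, hWs, hWt⟩ := hspec (V s)
  have h1 := ((isParallel_iff g γ W).1 hW).eqOn hγ isOpen_univ isPreconnected_univ hV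
    (Set.mem_univ s) (Set.mem_univ t) hWs
  exact hWt.symm.trans h1

theorem transport_self (hγ : ContMDiff 𝓘(ℝ, ℝ) (𝓡 n) ∞ γ) (t : ℝ) (v : 𝔼 n) :
    transport g γ t t v = v := by
  obtain ⟨V, hV, rfl⟩ := exists_parallel (g := g) hγ t v
  exact transport_apply hγ hV t t

theorem transport_transport (hγ : ContMDiff 𝓘(ℝ, ℝ) (𝓡 n) ∞ γ) (r s t : ℝ) (v : 𝔼 n) :
    transport g γ s t (transport g γ r s v) = transport g γ r t v := by
  obtain ⟨V, hV, rfl⟩ := exists_parallel (g := g) hγ r v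
  rw [transport_apply hγ hV, transport_apply hγ hV, transport_apply hγ hV]

theorem form_transport (hγ : ContMDiff 𝓘(ℝ, ℝ) (𝓡 n) ∞ γ) (s t : ℝ) (v w : 𝔼 n) :
    form g (γ t) (transport g γ s t v) (transport g γ s t w) = form g (γ s) v w := by
  obtain ⟨V, hV, rfl⟩ := exists_parallel (g := g) hγ s v
  obtain ⟨W, hW, rfl⟩ := exists_parallel (g := g) hγ s w
  rw [transport_apply hγ hV, transport_apply hγ hW]
  exact hV.form_eq hγ isOpen_univ isPreconnected_univ hW (Set.mem_univ t) (Set.mem_univ s)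

/-- Parallel transport commutes with the maps that preserve the metric and translate `γ`. -/
theorem der_transport (hγ : ContMDiff 𝓘(ℝ, ℝ) (𝓡 n) ∞ γ) {f : M → M} (hf : PreservesMetric g f)
    {σ : ℝ} (h : ∀ t, f (γ t) = γ (t + σ)) (s t : ℝ) (v : 𝔼 n) :
    der n f (γ t) (transport g γ s t v) =
      transport g γ (s + σ) (t + σ) (der n f (γ s) v) := by
  obtain ⟨V, hV, rfl⟩ := exists_parallel (g := g) hγ s v
  -- Both sides are values of the pushed-forward parallel field, reparameterized by the shift.
  have hW : IsParallelOn g γ Set.univ (fun τ => der n f (γ (τ - σ)) (V (τ - σ))) := by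
    intro τ _ y hy
    have := (hV (τ - σ) (Set.mem_univ _) _ (mem_extChartAt_source _)).transfer (y := y) hf hγ hγ h
      (mem_extChartAt_source _) (by rwa [sub_add_cancel])
    rwa [sub_add_cancel] at this
  have h1 := transport_apply hγ hW (s + σ) (t + σ)
  simp only [add_sub_cancel_right] at h1
  rw [h1, transport_apply hγ hV]

theorem transport_vel (hγ : IsUnitSpeedGeodesic g γ) (s t : ℝ) :
    transport g γ s t (vel n γ s) = vel n γ t :=
  transport_apply hγ.smooth ((isParallel_iff g γ (vel n γ)).1 hγ.parallel) s t

theorem continuousAt_chartDer_transport (hγ : ContMDiff 𝓘(ℝ, ℝ) (𝓡 n) ∞ γ) (r : ℝ) {x : M} {t : ℝ}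
    (hx : γ t ∈ (extChartAt (𝓡 n) x).source) :
    Tendsto (fun s => (chartDer n x (γ s)).comp (transport g γ r s)) (𝓝 t)
      (𝓝 ((chartDer n x (γ t)).comp (transport g γ r t))) := by
  have hv : ∀ v, Tendsto (fun s => (chartDer n x (γ s)).comp (transport g γ r s) v) (𝓝 t)
      (𝓝 ((chartDer n x (γ t)).comp (transport g γ r t) v)) := by
    intro v
    obtain ⟨V, hV, rfl⟩ := exists_parallel (g := g) hγ r v
    have h1 : HasDerivAt (fun s => chartDer n x (γ s) (V s)) _ t := hV t (Set.mem_univ t) x hx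
    simp only [ContinuousLinearMap.comp_apply, transport_apply hγ hV]
    exact h1.continuousAt.tendsto
  obtain ⟨L, hL⟩ := exists_tendsto_of_tendsto_apply fun v => ⟨_, hv v⟩
  have : L = (chartDer n x (γ t)).comp (transport g γ r t) := by
    ext1 v
    exact tendsto_nhds_unique (tendsto_clm_apply hL tendsto_const_nhds) (hv v)
  rwa [← this]

theorem tendsto_transport (hγ : ContMDiff 𝓘(ℝ, ℝ) (𝓡 n) ∞ γ) {ι : Type*} {l : Filter ι} (r : ℝ)
    {s : ι → ℝ} {v : ι → 𝔼 n} {s₀ : ℝ} {v₀ : 𝔼 n} (hs : Tendsto s l (𝓝 s₀))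
    (hv : Tendsto v l (𝓝 v₀)) :
    Tendsto (fun i => (⟨γ (s i), transport g γ r (s i) (v i)⟩ : TangentBundle (𝓡 n) M)) l
      (𝓝 ⟨γ s₀, transport g γ r s₀ v₀⟩) := by
  have hx := mem_extChartAt_source (I := 𝓡 n) (γ s₀)
  refine (tendsto_tangentBundle_iff (y := γ s₀) hx).2
    ⟨(hγ.continuous.tendsto s₀).comp hs, ?_⟩
  have := tendsto_clm_apply ((continuousAt_chartDer_transport (g := g) hγ r hx).comp hs) hv
  exact this

end TransportOperator

/-! ### Convergence of isometries in the compact-open topology -/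

section Isometries

set_option maxSynthPendingDepth 3

open Filter Metric

local notation "𝔼" n => EuclideanSpace ℝ (Fin n)

variable {n : ℕ} {M : Type*} [TopologicalSpace M] [ChartedSpace (EuclideanSpace ℝ (Fin n)) M]
  [IsManifold (𝓡 n) ∞ M] [T2Space M] {g : Metric n M}

omit [T2Space M] in
theorem Isom.ext_apply {a b : Isom g} (h : ∀ x, a.1 x = b.1 x) : a = b :=
  Subtype.ext (Homeomorph.ext h)

/-- Pointwise convergence of isometries implies convergence in the compact-open topology. -/
theorem Isom.tendsto_of_tendsto_apply {ι : Type*} {l : Filter ι} {a : ι → Isom g} {b : Isom g}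
    (h : ∀ x, Tendsto (fun i => (a i).1 x) l (𝓝 (b.1 x))) : Tendsto a l (𝓝 b) := by
  rw [nhds_induced, tendsto_comap_iff, ContinuousMap.tendsto_nhds_compactOpen]
  intro K hK U hU hb
  -- Even continuity extends convergence at a point to a neighbourhood of the point, and compactness
  -- needs finitely many of these.
  refine hK.induction_on (p := fun s => ∀ᶠ i in l, Set.MapsTo (a i).1 s U) ?_ ?_ ?_ ?_
  · exact Eventually.of_forall fun i => Set.mapsTo_empty _ _
  · exact fun s t hst ht => ht.mono fun i hi => hi.mono_left hst
  · intro s t hs ht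
    filter_upwards [hs, ht] with i h1 h2 using h1.union h2
  · intro x hx
    obtain ⟨W, hW, V, hV, H⟩ := evenly_continuous g x (b.1 x) (hU.mem_nhds (hb hx))
    refine ⟨W, mem_nhdsWithin_of_mem_nhds hW, ?_⟩
    filter_upwards [(h x).eventually hV] with i hi q hq
    exact H (a i).1 (a i).2.1 x (mem_of_mem_nhds hW) hi q hq

theorem Isom.tendsto_apply_of_tendsto {ι : Type*} {l : Filter ι} {a : ι → Isom g} {f : M → M}
    {x : ι → M} {x₀ : M} (hf : ∀ x, Tendsto (fun i => (a i).1 x) l (𝓝 (f x)))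
    (hx : Tendsto x l (𝓝 x₀)) : Tendsto (fun i => (a i).1 (x i)) l (𝓝 (f x₀)) := by
  intro V hV
  obtain ⟨W, hW, V', hV', H⟩ := evenly_continuous g x₀ (f x₀) hV
  rw [mem_map]
  filter_upwards [(hf x₀).eventually hV', hx.eventually hW] with i h1 h2
  exact H (a i).1 (a i).2.1 x₀ (mem_of_mem_nhds hW) h1 _ h2

variable [ConnectedSpace M]

/-- Isometries whose differentials at one point converge to the differential of an isometry
converge. -/
theorem Isom.tendsto_of_push {l : Filter (Isom g)} {b : Isom g} {z : M}
    (h : ∀ v, Tendsto (fun a : Isom g => push n a.1 z v) l (𝓝 (push n b.1 z v))) : l ≤ 𝓝 b := by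
  -- Adjoining `b` to the filter forces the limit map to be `b` itself, by evaluation along `pure
  -- b`.
  have hpure : ∀ v, Tendsto (fun a : Isom g => push n a.1 z v) (l ⊔ pure b)
      (𝓝 (push n b.1 z v)) := fun v =>
    (h v).sup (tendsto_pure_nhds (fun a : Isom g => push n a.1 z v) b)
  obtain ⟨f, -, hf⟩ := exists_limit g (l ⊔ pure b) z fun v => ⟨_, hpure v⟩
  have hfb : ∀ x, f x = b.1 x := fun x =>
    tendsto_nhds_unique ((tendsto_apply_of_push (hf x 0)).mono_left le_sup_right)
      (tendsto_pure_nhds (fun a : Isom g => a.1 x) b)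
  refine Isom.tendsto_of_tendsto_apply (a := id) fun x => ?_
  have := (tendsto_apply_of_push (hf x 0)).mono_left (le_sup_left (a := l) (b := pure b))
  exact (hfb x) ▸ this

/-- An isometry is determined by its differential at one point. -/
theorem Isom.eq_of_push {a b : Isom g} {z : M} (h : ∀ v, push n a.1 z v = push n b.1 z v) :
    a = b := by
  -- Rigidity as a case of convergence: a limit along the filter carried by `a` and `b` has to equal
  -- both maps.
  have hl : ∀ v, Tendsto (fun a : Isom g => push n a.1 z v) (pure a ⊔ pure b)
      (𝓝 (push n b.1 z v)) := fun v => by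
    refine Tendsto.sup ?_ (tendsto_pure_nhds (fun a : Isom g => push n a.1 z v) b)
    rw [← h v]
    exact tendsto_pure_nhds (fun a : Isom g => push n a.1 z v) a
  obtain ⟨f, -, hf⟩ := exists_limit g (pure a ⊔ pure b) z fun v => ⟨_, hl v⟩
  refine Isom.ext_apply fun x => ?_
  have h1 := tendsto_nhds_unique ((tendsto_apply_of_push (hf x 0)).mono_left le_sup_left)
      (tendsto_pure_nhds (fun a : Isom g => a.1 x) a)
  have h2 := tendsto_nhds_unique ((tendsto_apply_of_push (hf x 0)).mono_left le_sup_right)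
      (tendsto_pure_nhds (fun a : Isom g => a.1 x) b)
  exact h1.symm.trans h2

/-- If the differentials of isometries, and of their inverses, converge at some points, then the
isometries converge. -/
theorem Isom.exists_tendsto {ι : Type*} {l : Filter ι} [NeBot l] {a : ι → Isom g} {z z' : M}
    (hz : ∀ v, ∃ q, Tendsto (fun i => push n (a i).1 z v) l (𝓝 q))
    (hz' : ∀ v, ∃ q, Tendsto (fun i => push n (a i)⁻¹.1 z' v) l (𝓝 q)) :
    ∃ b : Isom g, ∀ x v, Tendsto (fun i => push n (a i).1 x v) l (𝓝 (push n b.1 x v)) := by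
  obtain ⟨f, hf, hfl⟩ := exists_limit g (l.map a) z fun v => by
    obtain ⟨q, hq⟩ := hz v
    exact ⟨q, tendsto_map'_iff.2 hq⟩
  obtain ⟨f', hf', hfl'⟩ := exists_limit g (l.map fun i => (a i)⁻¹) z' fun v => by
    obtain ⟨q, hq⟩ := hz' v
    exact ⟨q, tendsto_map'_iff.2 hq⟩
  have hfl₂ : ∀ x v, Tendsto (fun i => push n (a i).1 x v) l (𝓝 (push n f x v)) := fun x v =>
    tendsto_map'_iff.1 (hfl x v)
  have hfl₂' : ∀ x v, Tendsto (fun i => push n (a i)⁻¹.1 x v) l (𝓝 (push n f' x v)) := fun x v =>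
    tendsto_map'_iff.1 (hfl' x v)
  have hb : ∀ x, Tendsto (fun i => (a i).1 x) l (𝓝 (f x)) := fun x =>
    tendsto_apply_of_push (hfl₂ x 0)
  have hb' : ∀ x, Tendsto (fun i => (a i)⁻¹.1 x) l (𝓝 (f' x)) := fun x =>
    tendsto_apply_of_push (hfl₂' x 0)
  -- Even continuity allows the argument to move with the map, so the limits of `a i` and of its
  -- inverse are mutually inverse.
  have h1 : ∀ x, f (f' x) = x := fun x => by
    refine tendsto_nhds_unique (Isom.tendsto_apply_of_tendsto hb (hb' x)) ?_
    exact tendsto_const_nhds.congr fun i => ((a i).1.apply_symm_apply x).symm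
  have h2 : ∀ x, f' (f x) = x := fun x => by
    refine tendsto_nhds_unique (Isom.tendsto_apply_of_tendsto hb' (hb x)) ?_
    exact tendsto_const_nhds.congr fun i => ((a i).1.symm_apply_apply x).symm
  exact ⟨⟨⟨⟨f, f', h2, h1⟩, hf.1.continuous, hf'.1.continuous⟩, hf, hf'⟩, hfl₂⟩

end Isometries

/-! ### Von Neumann's theorem on closed groups of units -/

section ClosedLinearGroups

open Filter NormedSpace

variable {A : Type*} [NormedRing A] [NormedAlgebra ℝ A] [CompleteSpace A]

theorem contDiff_exp : ContDiff ℝ ω (exp : A → A) :=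
  contDiff_iff_contDiffAt.2 fun x => (exp_analytic (𝕂 := ℝ) x).contDiffAt

theorem exp_add {x y : A} (h : Commute x y) : exp (x + y) = exp x * exp y :=
  letI := NormedAlgebra.restrictScalars ℚ ℝ A
  exp_add_of_commute h

-- The inverse function theorem at zero, where the derivative of the exponential is the identity.
variable (A) in
theorem exists_log : ∃ L : A → A, ContDiffAt ℝ ω L 1 ∧ L 1 = 0 ∧
    HasFDerivAt L (ContinuousLinearMap.id ℝ A) 1 ∧ (∀ᶠ x in 𝓝 (1 : A), exp (L x) = x) ∧
    ∀ᶠ X in 𝓝 (0 : A), L (exp X) = X := by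
  have h0 : HasFDerivAt (exp : A → A) ((ContinuousLinearEquiv.refl ℝ A : A ≃L[ℝ] A) : A →L[ℝ] A)
      0 := (hasStrictFDerivAt_exp_zero (𝕂 := ℝ) (𝔸 := A)).hasFDerivAt
  have hc : ContDiffAt ℝ ω (exp : A → A) 0 := contDiff_exp.contDiffAt
  have hs := hc.hasStrictFDerivAt' h0 (by simp)
  have h1 : exp (0 : A) = 1 := exp_zero
  have hL := hc.to_localInverse h0 (by simp)
  have hd := hs.to_localInverse.hasFDerivAt
  have h2 := hs.eventually_right_inverse
  have h3 := hs.localInverse_apply_image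
  rw [h1] at hL hd h2 h3
  exact ⟨_, hL, h3, hd, h2, hs.eventually_left_inverse⟩

/-- The exponential map of a Banach algebra, with values in the group of units. -/
noncomputable def expUnit (X : A) : Aˣ where
  val := exp X
  inv := exp (-X)
  val_inv := by
    rw [← exp_add (Commute.refl X).neg_right, add_neg_cancel, exp_zero]
  inv_val := by
    rw [← exp_add (Commute.refl X).neg_left, neg_add_cancel, exp_zero]

@[simp]
theorem val_expUnit (X : A) : (expUnit X : A) = exp X := rfl

@[simp]
theorem val_inv_expUnit (X : A) : ((expUnit X)⁻¹ : Aˣ) = expUnit (-X) :=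
  Units.ext rfl

theorem expUnit_zero : expUnit (0 : A) = 1 := Units.ext exp_zero

theorem expUnit_zsmul (m : ℤ) (X : A) : expUnit (m • X) = expUnit X ^ m := by
  have hn : ∀ m : ℕ, expUnit (m • X) = expUnit X ^ m := fun m => by
    induction m with
    | zero => simp [expUnit_zero]
    | succ m ih =>
      rw [pow_succ, ← ih, succ_nsmul]
      exact Units.ext (exp_add ((Commute.refl X).smul_left m))
  cases m with
  | ofNat m => simpa using hn m
  | negSucc m =>
    rw [zpow_negSucc, ← hn, val_inv_expUnit, negSucc_zsmul]

theorem continuous_expUnit : Continuous (expUnit : A → Aˣ) := by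
  refine Units.continuous_iff.2 ⟨contDiff_exp.continuous, ?_⟩
  change Continuous fun X : A => ((expUnit X)⁻¹ : Aˣ).val
  simp only [val_inv_expUnit, val_expUnit]
  exact contDiff_exp.continuous.comp continuous_neg

variable {Γ : Subgroup Aˣ}

/-- A limit of rescaled logarithms of elements of a closed group generates a one-parameter
subgroup. -/
theorem expUnit_smul_mem_of_tendsto (hΓ : IsClosed (Γ : Set Aˣ)) {ι : Type*} {l : Filter ι} [NeBot l]
    {X : ι → A} {c : ι → ℝ} {Z : A} (hX : ∀ᶠ i in l, expUnit (X i) ∈ Γ)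
    (hc : ∀ᶠ i in l, c i ≠ 0) (hc0 : Tendsto c l (𝓝 0))
    (hZ : Tendsto (fun i => (c i)⁻¹ • X i) l (𝓝 Z)) (t : ℝ) : expUnit (t • Z) ∈ Γ := by
  -- Integer powers of elements of `Γ` stay in `Γ`; the multiples ⌊t/c⌋ of `X` approximate t·Z
  -- because the rounding error is at most |c|.
  have hm : Tendsto (fun i => (⌊t / c i⌋ : ℝ) * c i) l (𝓝 t) := by
    rw [tendsto_iff_norm_sub_tendsto_zero]
    refine squeeze_zero' (Eventually.of_forall fun i => norm_nonneg _) ?_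
      (tendsto_norm_zero.comp hc0)
    filter_upwards [hc] with i hi
    have h1 : (⌊t / c i⌋ : ℝ) * c i - t = -(Int.fract (t / c i) * c i) := by
      rw [Int.fract, sub_mul, div_mul_cancel₀ _ hi]
      ring
    rw [h1, norm_neg, norm_mul, Function.comp_apply]
    refine mul_le_of_le_one_left (norm_nonneg _) ?_
    rw [Real.norm_of_nonneg (Int.fract_nonneg _)]
    exact (Int.fract_lt_one _).le
  have h2 : Tendsto (fun i => expUnit ((⌊t / c i⌋ : ℤ) • X i)) l (𝓝 (expUnit (t • Z))) := by
    refine (continuous_expUnit.tendsto _).comp ((hm.smul hZ).congr' ?_)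
    filter_upwards [hc] with i hi
    rw [smul_smul, mul_assoc, mul_inv_cancel₀ hi, mul_one, Int.cast_smul_eq_zsmul]
  refine hΓ.mem_of_tendsto h2 ?_
  filter_upwards [hX] with i hi
  rw [expUnit_zsmul]
  exact Γ.zpow_mem hi _

/-- The Lie algebra of a closed group of units. -/
noncomputable def lieAlg (hΓ : IsClosed (Γ : Set Aˣ)) : Submodule ℝ A where
  carrier := {X | ∀ t : ℝ, expUnit (t • X) ∈ Γ}
  zero_mem' := fun t => by
    rw [smul_zero, expUnit_zero]
    exact Γ.one_mem
  smul_mem' := fun c X hX t => by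
    rw [smul_smul]
    exact hX _
  add_mem' := fun {X Y} hX hY => by
    obtain ⟨L, -, hL1, hLd, hLe, -⟩ := exists_log A
    have hp : HasDerivAt (fun t : ℝ => exp (t • X) * exp (t • Y)) (X + Y) 0 := by
      have h : ∀ Z : A, HasDerivAt (fun t : ℝ => exp (t • Z)) Z 0 := fun Z => by
        have h1 : HasDerivAt (fun t : ℝ => t • Z) Z 0 := by
          simpa using (hasDerivAt_id (0 : ℝ)).smul_const Z
        have h2 : HasFDerivAt (exp : A → A) (1 : A →L[ℝ] A) ((0 : ℝ) • Z) := by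
          rw [zero_smul]
          exact (hasStrictFDerivAt_exp_zero (𝕂 := ℝ)).hasFDerivAt
        exact h2.comp_hasDerivAt (0 : ℝ) h1
      have h3 := (h X).mul (h Y)
      simp only [zero_smul, exp_zero, mul_one, one_mul] at h3
      exact h3
    have h0 : exp ((0 : ℝ) • X) * exp ((0 : ℝ) • Y) = 1 := by simp
    -- The logarithms of exp(tX)exp(tY), divided by t, tend to X + Y, which is then a limit of
    -- rescaled logarithms of elements of `Γ`.
    have hq : HasDerivAt (fun t : ℝ => L (exp (t • X) * exp (t • Y))) (X + Y) 0 := by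
      rw [← h0] at hLd
      exact hLd.comp_hasDerivAt (0 : ℝ) hp
    have hs := hq.tendsto_slope_zero
    have hcont : Tendsto (fun t : ℝ => exp (t • X) * exp (t • Y)) (𝓝[≠] 0) (𝓝 1) := by
      have := hp.continuousAt.tendsto
      simp only [zero_smul, exp_zero, mul_one] at this
      exact this.mono_left nhdsWithin_le_nhds
    refine expUnit_smul_mem_of_tendsto hΓ (l := 𝓝[≠] (0 : ℝ)) (c := fun t => t)
      (X := fun t => L (exp (t • X) * exp (t • Y))) ?_ self_mem_nhdsWithin
      (tendsto_id.mono_left nhdsWithin_le_nhds) (by simpa [hL1] using hs)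
    filter_upwards [hcont.eventually hLe] with t ht
    have h3 : expUnit (L (exp (t • X) * exp (t • Y))) = expUnit (t • X) * expUnit (t • Y) :=
      Units.ext ht
    rw [h3]
    exact Γ.mul_mem (hX t) (hY t)

/-- Near the identity, a closed group of units is the image under the exponential map of its Lie
algebra. -/
theorem eventually_log_mem_lieAlg [FiniteDimensional ℝ A] (hΓ : IsClosed (Γ : Set Aˣ)) {L : A → A}
    (hLe : ∀ᶠ X in 𝓝 (0 : A), L (exp X) = X) :
    ∀ᶠ x in 𝓝 (1 : A), ∀ u ∈ Γ, (u : A) = x → L x ∈ lieAlg hΓ := by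
  obtain ⟨p, hp⟩ := LinearMap.exists_leftInverse_of_injective (lieAlg hΓ).subtype
    (Submodule.ker_subtype _)
  have hp' : ∀ X (hX : X ∈ lieAlg hΓ), (p X : A) = X := fun X hX =>
    congrArg Subtype.val (LinearMap.congr_fun hp ⟨X, hX⟩)
  let P : A →L[ℝ] A := LinearMap.toContinuousLinearMap ((lieAlg hΓ).subtype ∘ₗ p)
  have hPm : ∀ X, P X ∈ lieAlg hΓ := fun X => (p X).2
  have hPP : ∀ X, P (X - P X) = 0 := fun X => by
    rw [map_sub, sub_eq_zero]
    exact (hp' _ (hPm X)).symm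
  have hPZ : ∀ Z ∈ lieAlg hΓ, P Z = Z := hp'
  -- `P` projects onto the Lie algebra. Splitting the exponential into a part along it and a
  -- transverse part is a local diffeomorphism with derivative the identity.
  have hΦ : HasStrictFDerivAt (fun X => exp (P X) * exp (X - P X))
      ((ContinuousLinearEquiv.refl ℝ A : A ≃L[ℝ] A) : A →L[ℝ] A) 0 := by
    have hexp : ∀ {Q : A →L[ℝ] A}, HasStrictFDerivAt (fun X => exp (Q X)) Q 0 := fun {Q} => by
      have h1 : HasStrictFDerivAt (exp : A → A) (1 : A →L[ℝ] A) (Q 0) := by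
        rw [map_zero]
        exact hasStrictFDerivAt_exp_zero (𝕂 := ℝ)
      exact h1.comp 0 Q.hasStrictFDerivAt
    have h2 := (hexp (Q := P)).mul' (hexp (Q := ContinuousLinearMap.id ℝ A - P))
    convert! h2 using 1
    ext X
    simp
  set Ψ := hΦ.localInverse _ _ _ with hΨ
  have hone : exp (P 0) * exp ((0 : A) - P 0) = 1 := by simp
  have hΨ1 : Tendsto Ψ (𝓝 1) (𝓝 0) := by
    have := hΦ.localInverse_tendsto
    rwa [hone] at this
  have hΨr : ∀ᶠ x in 𝓝 (1 : A), exp (P (Ψ x)) * exp (Ψ x - P (Ψ x)) = x := by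
    have := hΦ.eventually_right_inverse
    rwa [hone] at this
  have hPΨ : Tendsto (fun x => P (Ψ x)) (𝓝 1) (𝓝 0) := by
    have h1 := (P.continuous.tendsto 0).comp hΨ1
    rwa [map_zero] at h1
  have hY0 : Tendsto (fun x => Ψ x - P (Ψ x)) (𝓝 1) (𝓝 0) := by
    simpa using hΨ1.sub hPΨ
  -- Elements of `Γ` tending to 1 with logarithm outside the Lie algebra would have nonzero
  -- transverse parts, whose exponentials still lie in `Γ`. A limit of the normalized transverse
  -- parts is a unit vector of the Lie algebra killed by `P`, which is absurd.
  by_contra hcon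
  let bad : Set A := {x | (∃ u ∈ Γ, (u : A) = x) ∧ L x ∉ lieAlg hΓ}
  have hbad : ∃ᶠ x in 𝓝 (1 : A), x ∈ bad := by
    refine (not_eventually.1 hcon).mono fun x hx => ?_
    push Not at hx
    obtain ⟨u, hu, hux, hL⟩ := hx
    exact ⟨⟨u, hu, hux⟩, hL⟩
  have hne : NeBot (𝓝 (1 : A) ⊓ 𝓟 bad) := frequently_mem_iff_neBot.1 hbad
  obtain ⟨l, hl⟩ := Ultrafilter.exists_le (𝓝 (1 : A) ⊓ 𝓟 bad)
  have hl1 : (l : Filter A) ≤ 𝓝 1 := hl.trans inf_le_left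
  have hlb : ∀ᶠ x in (l : Filter A), x ∈ bad := hl.trans inf_le_right (mem_principal_self _)
  have hYΓ : ∀ᶠ x in (l : Filter A), expUnit (Ψ x - P (Ψ x)) ∈ Γ := by
    filter_upwards [hl1 hΨr, hlb] with x hx hb
    obtain ⟨⟨u, hu, hux⟩, -⟩ := hb
    have h1 : expUnit (P (Ψ x)) * expUnit (Ψ x - P (Ψ x)) = u := Units.ext (hx.trans hux.symm)
    have h2 : expUnit (P (Ψ x)) ∈ Γ := by simpa using hPm (Ψ x) 1
    rw [← Γ.mul_mem_cancel_left h2, h1]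
    exact hu
  have hYne : ∀ᶠ x in (l : Filter A), Ψ x - P (Ψ x) ≠ 0 := by
    filter_upwards [hl1 hΨr, hl1 (hPΨ.eventually hLe), hlb] with x hx hx2 hb h0
    rw [h0, exp_zero, mul_one] at hx
    rw [hx] at hx2
    exact hb.2 (hx2 ▸ hPm _)
  have hsph : ∀ᶠ x in (l : Filter A), ‖Ψ x - P (Ψ x)‖⁻¹ • (Ψ x - P (Ψ x)) ∈ Metric.sphere (0 : A) 1 := by
    filter_upwards [hYne] with x hx
    rw [mem_sphere_zero_iff_norm, norm_smul, norm_inv, norm_norm, inv_mul_cancel₀ (norm_ne_zero_iff.2 hx)]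
  have : ProperSpace A := FiniteDimensional.proper_real A
  obtain ⟨Z, hZs, hZ⟩ := (isCompact_sphere (0 : A) 1).ultrafilter_le_nhds
    (l.map fun x => ‖Ψ x - P (Ψ x)‖⁻¹ • (Ψ x - P (Ψ x))) (by
      rw [le_principal_iff]
      exact hsph)
  have hZ' : Tendsto (fun x => ‖Ψ x - P (Ψ x)‖⁻¹ • (Ψ x - P (Ψ x))) (l : Filter A) (𝓝 Z) := hZ
  have hZΓ : Z ∈ lieAlg hΓ := fun t => expUnit_smul_mem_of_tendsto hΓ hYΓ
    (hYne.mono fun x hx => norm_ne_zero_iff.2 hx)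
    (tendsto_norm_zero.comp (hY0.mono_left hl1)) hZ' t
  have hPZ0 : P Z = 0 := by
    refine tendsto_nhds_unique ((P.continuous.tendsto Z).comp hZ') ?_
    refine tendsto_const_nhds.congr fun x => ?_
    simp only [Function.comp_apply, map_smul, hPP, smul_zero]
  rw [hPZ Z hZΓ] at hPZ0
  rw [hPZ0] at hZs
  simp at hZs

end ClosedLinearGroups

/-! ### Lie group structure on discrete quotients of closed groups of units -/

section QuotientOfClosedLinearGroup

open Filter NormedSpace

variable {A : Type*} [NormedRing A] [NormedAlgebra ℝ A] {Γ : Subgroup Aˣ}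

/-- Coordinates at the identity of a quotient `pr : Γ → H` of a closed group of units by a discrete
subgroup: a local inverse `ψ` of the map `X ↦ pr (exp (j X))`. -/
structure IdentityChart {H : Type*} [Group H] [TopologicalSpace H] (pr : Γ →* H) (k : ℕ) where
  /-- the exponential map in linear coordinates of the Lie algebra -/
  lift : EuclideanSpace ℝ (Fin k) → Γ
  /-- the chart -/
  chart : OpenPartialHomeomorph H (EuclideanSpace ℝ (Fin k))
  one_mem : 1 ∈ chart.source
  symm_apply : ∀ X, chart.symm X = pr (lift X)
  contDiff_lift : ContDiff ℝ ∞ fun X => ((lift X : Aˣ) : A)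
  contDiff_lift_inv : ContDiff ℝ ∞ fun X => (((lift X)⁻¹ : Γ) : Aˣ).val
  contDiffAt_comp : ∀ {V : Type} [NormedAddCommGroup V] [NormedSpace ℝ V] {F : V → Γ} {v : V},
    ContDiffAt ℝ ∞ (fun v => ((F v : Aˣ) : A)) v → pr (F v) ∈ chart.source →
      ContDiffAt ℝ ∞ (fun v => chart (pr (F v))) v

/-- The exponential parameterizes a neighbourhood of 1 in `Γ` by its Lie algebra, and `pr` is open,
continuous and, its kernel being discrete, injective near 1. -/
theorem exists_identityChart [CompleteSpace A] [FiniteDimensional ℝ A] (hΓ : IsClosed (Γ : Set Aˣ)) {H : Type*}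
    [Group H] [TopologicalSpace H] (pr : Γ →* H) (hcont : Continuous pr) (hopen : IsOpenMap pr)
    (hker : ∀ᶠ u in 𝓝 (1 : Γ), pr u = 1 → u = 1) : ∃ k, Nonempty (IdentityChart pr k) := by
  obtain ⟨L, hLc, hL1, -, hLe, heL⟩ := exists_log A
  have hlog := eventually_log_mem_lieAlg hΓ heL
  let k := Module.finrank ℝ (lieAlg hΓ)
  let ℓ : EuclideanSpace ℝ (Fin k) ≃L[ℝ] lieAlg hΓ :=
    ContinuousLinearEquiv.ofFinrankEq (by simp [k])
  let j : EuclideanSpace ℝ (Fin k) →L[ℝ] A := (lieAlg hΓ).subtypeL.comp (ℓ : _ →L[ℝ] lieAlg hΓ)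
  have hjm : ∀ X, j X ∈ lieAlg hΓ := fun X => (ℓ X).2
  obtain ⟨p, hp⟩ := LinearMap.exists_leftInverse_of_injective (lieAlg hΓ).subtype
    (Submodule.ker_subtype _)
  let q : A →L[ℝ] EuclideanSpace ℝ (Fin k) :=
    (ℓ.symm : lieAlg hΓ →L[ℝ] _).comp (LinearMap.toContinuousLinearMap p)
  have hqj : ∀ X, q (j X) = X := fun X => by
    change ℓ.symm (p ((lieAlg hΓ).subtype (ℓ X))) = X
    rw [← LinearMap.comp_apply, hp]
    exact ℓ.symm_apply_apply X
  have hjq : ∀ X ∈ lieAlg hΓ, j (q X) = X := fun X hX => by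
    change ((ℓ (ℓ.symm (p ((lieAlg hΓ).subtype ⟨X, hX⟩))) : lieAlg hΓ) : A) = X
    rw [← LinearMap.comp_apply, hp, ℓ.apply_symm_apply]
    rfl
  let lift : EuclideanSpace ℝ (Fin k) → Γ := fun X => ⟨expUnit (j X), by simpa using hjm X 1⟩
  have hlift : Continuous lift :=
    (continuous_expUnit.comp j.continuous).subtype_mk _
  have hval : Continuous fun u : Γ => ((u : Aˣ) : A) := Units.continuous_val.comp continuous_subtype_val
  -- a neighbourhood of the identity of `Γ` on which `pr` is injective
  obtain ⟨O, hO1, hO⟩ : ∃ O ∈ 𝓝 (1 : Γ), ∀ u ∈ O, ∀ v ∈ O, pr u = pr v → u = v := by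
    have h1 : Tendsto (fun w : Γ × Γ => w.1⁻¹ * w.2) (𝓝 (1, 1)) (𝓝 1) := by
      have : Continuous fun w : Γ × Γ => w.1⁻¹ * w.2 := by fun_prop
      simpa using this.tendsto (1, 1)
    have h2 : ∀ᶠ w : Γ × Γ in 𝓝 1 ×ˢ 𝓝 1, pr (w.1⁻¹ * w.2) = 1 → w.1⁻¹ * w.2 = 1 := by
      rw [← nhds_prod_eq]
      exact h1.eventually hker
    obtain ⟨O, hO, h⟩ := eventually_prod_self_iff'.1 h2
    refine ⟨O, hO, fun u hu v hv huv => ?_⟩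
    have h3 := h u hu v hv (by rw [map_mul, map_inv, huv, inv_mul_cancel])
    exact inv_mul_eq_one.1 h3
  have hval1 : Tendsto (fun u : Γ => ((u : Aˣ) : A)) (𝓝 1) (𝓝 1) := by
    simpa using hval.tendsto 1
  have hLcont : Tendsto L (𝓝 1) (𝓝 0) := hL1 ▸ hLc.continuousAt.tendsto
  -- a good neighbourhood `W` of the identity
  have hW : ∀ᶠ u in 𝓝 (1 : Γ), u ∈ O ∧ exp (L (u : Aˣ)) = ((u : Aˣ) : A) ∧
      ContDiffAt ℝ ω L (u : Aˣ) ∧ L (u : Aˣ) ∈ lieAlg hΓ ∧ L (exp (L (u : Aˣ))) = L (u : Aˣ) := by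
    filter_upwards [hO1, hval1.eventually hLe, hval1.eventually (hLc.eventually (by simp)),
      hval1.eventually hlog, hval1.eventually (hLcont.eventually heL)] with u h1 h2 h3 h4 h5
    exact ⟨h1, h2, h3, h4 u u.2 rfl, h5⟩
  obtain ⟨W, hWsub, hWo, hW1⟩ := eventually_nhds_iff.1 hW
  obtain ⟨S, hSsub, hSo, hS0⟩ := eventually_nhds_iff.1 heL
  let T : Set (EuclideanSpace ℝ (Fin k)) := {X | lift X ∈ W ∧ j X ∈ S}
  have hTo : IsOpen T := (hWo.preimage hlift).inter (hSo.preimage j.continuous)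
  have hlift0 : lift 0 = 1 := Subtype.ext (by simp [lift, expUnit_zero])
  have hT0 : (0 : EuclideanSpace ℝ (Fin k)) ∈ T :=
    ⟨by rw [hlift0]; exact hW1, by simpa using hS0⟩
  have hqL : ∀ X ∈ T, q (L ((lift X : Aˣ) : A)) = X := fun X hX => by
    change q (L (exp (j X))) = X
    rw [hSsub _ hX.2, hqj]
  have hliftq : ∀ u ∈ W, lift (q (L (u : Aˣ))) = u := fun u hu => by
    obtain ⟨-, h1, -, h2, -⟩ := hWsub u hu
    refine Subtype.ext (Units.ext ?_)
    change exp (j (q (L (u : Aˣ)))) = _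
    rw [hjq _ h2, h1]
  have hinj : Set.InjOn (fun X => pr (lift X)) T := fun X hX Y hY h => by
    have h1 := hO _ (hWsub _ hX.1).1 _ (hWsub _ hY.1).1 h
    rw [← hqL X hX, h1, hqL Y hY]
  have hopenT : ∀ V ⊆ T, IsOpen V → IsOpen ((fun X => pr (lift X)) '' V) := fun V hVT hV => by
    have h1 : (fun X => pr (lift X)) '' V = pr '' (lift '' V) := by rw [Set.image_image]
    rw [h1]
    refine hopen _ ?_
    -- On `W` the logarithm inverts `lift`, which makes the image of `lift` a preimage under a
    -- continuous map.
    have h2 : lift '' V = W ∩ {u : Γ | q (L (u : Aˣ)) ∈ V} := by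
      ext u
      constructor
      · rintro ⟨X, hX, rfl⟩
        refine ⟨(hVT hX).1, ?_⟩
        change q (L ((lift X : Aˣ) : A)) ∈ V
        rwa [hqL X (hVT hX)]
      · rintro ⟨hu, huV⟩
        exact ⟨_, huV, hliftq u hu⟩
    rw [h2]
    refine ContinuousOn.isOpen_inter_preimage (f := fun u : Γ => q (L (u : Aˣ))) (fun u hu => ?_) hWo hV
    have h3 := (hWsub u hu).2.2.1.continuousAt
    exact (q.continuous.continuousAt.comp (h3.comp (f := fun u : Γ => ((u : Aˣ) : A))
      hval.continuousAt)).continuousWithinAt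
  let e : PartialEquiv (EuclideanSpace ℝ (Fin k)) H := hinj.toPartialEquiv _ T
  let φ : OpenPartialHomeomorph (EuclideanSpace ℝ (Fin k)) H :=
    OpenPartialHomeomorph.ofContinuousOpenRestrict e (hcont.comp hlift).continuousOn (by
      intro V hV
      have h1 : e.source.domRestrict e '' V = (fun X => pr (lift X)) '' (Subtype.val '' V) := by
        rw [Set.image_image]
        rfl
      rw [h1]
      exact hopenT _ (by rintro _ ⟨X, -, rfl⟩; exact X.2) (hTo.isOpenMap_subtype_val _ hV)) hTo
  have hφ : ∀ X, φ X = pr (lift X) := fun X => rfl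
  have hWchart : ∀ u ∈ W, j (q (L (u : Aˣ))) ∈ S → φ.symm (pr u) = q (L (u : Aˣ)) := fun u hu hS => by
    have h1 : q (L (u : Aˣ)) ∈ φ.source := ⟨by rw [hliftq u hu]; exact hu, hS⟩
    have h2 := φ.left_inv h1
    rwa [hφ, hliftq u hu] at h2
  refine ⟨k, ⟨⟨lift, φ.symm, ?_, fun X => rfl, ?_, ?_, ?_⟩⟩⟩
  · have h1 := φ.map_source (x := 0) hT0
    rwa [hφ, hlift0, map_one] at h1
  · exact (contDiff_exp.comp j.contDiff).of_le (by simp)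
  · have h1 : ∀ X, (((lift X)⁻¹ : Γ) : Aˣ).val = exp (-(j X)) := fun X => rfl
    simp only [h1]
    exact (contDiff_exp.comp j.contDiff.neg).of_le (by simp)
  · intro V _ _ F v hF hv
    have hX : φ.symm (pr (F v)) ∈ T := φ.map_target hv
    have hX' : pr (lift (φ.symm (pr (F v)))) = pr (F v) := φ.right_inv hv
    set X := φ.symm (pr (F v)) with hXdef
    -- `F v` may be far from the preimage `lift X` selected by the chart. The kernel element `κ`
    -- moves `F` there without changing `pr ∘ F`, and near `lift X` the chart is the logarithm.
    set κ := lift X * (F v)⁻¹ with hκ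
    have hκ1 : pr κ = 1 := by rw [hκ, map_mul, map_inv, hX', mul_inv_cancel]
    have hκv : κ * F v = lift X := by rw [hκ, inv_mul_cancel_right]
    have hFc : ContinuousAt F v := by
      have h1 : Topology.IsInducing fun u : Γ => ((u : Aˣ) : A) :=
        Units.isOpenEmbedding_val.isInducing.comp Topology.IsInducing.subtypeVal
      exact h1.continuousAt_iff.2 hF.continuousAt
    have hκF : Tendsto (fun w => κ * F w) (𝓝 v) (𝓝 (lift X)) := by
      rw [← hκv]
      exact (continuous_const_mul κ).continuousAt.comp hFc
    have hκFA : ContDiffAt ℝ ∞ (fun w => ((κ : Aˣ) : A) * ((F w : Aˣ) : A)) v :=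
      contDiffAt_const.mul hF
    have hκvA : ((κ : Aˣ) : A) * ((F v : Aˣ) : A) = ((lift X : Aˣ) : A) := by
      rw [← hκv]
      rfl
    have hLX := (hWsub _ hX.1).2.2.1
    have hev : ∀ᶠ w in 𝓝 v, φ.symm (pr (F w)) = q (L (((κ : Aˣ) : A) * ((F w : Aˣ) : A))) := by
      have h1 : ∀ᶠ u : Γ in 𝓝 (lift X), j (q (L (u : Aˣ))) ∈ S := by
        have h2 : ContinuousAt (fun u : Γ => j (q (L (u : Aˣ)))) (lift X) :=
          j.continuous.continuousAt.comp (q.continuous.continuousAt.comp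
            (hLX.continuousAt.comp (f := fun u : Γ => ((u : Aˣ) : A)) hval.continuousAt))
        refine h2.eventually (hSo.mem_nhds ?_)
        change j (q (L ((lift X : Aˣ) : A))) ∈ S
        rw [hqL X hX]
        exact hX.2
      filter_upwards [hκF.eventually (hWo.mem_nhds hX.1), hκF.eventually h1] with w hw hw2
      have h3 := hWchart _ hw hw2
      rw [map_mul, hκ1, one_mul] at h3
      exact h3
    refine ContDiffAt.congr_of_eventuallyEq ?_ hev
    rw [← hκvA] at hLX
    exact q.contDiff.contDiffAt.comp v ((hLX.of_le (by simp)).comp v hκFA)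

/-- The chart at `h` obtained from a chart at the identity by translation. -/
noncomputable def IdentityChart.chartAt {H : Type*} [Group H] [TopologicalSpace H] [ContinuousMul H]
    {pr : Γ →* H} {k : ℕ} (c : IdentityChart pr k) (h : H) :
    OpenPartialHomeomorph H (EuclideanSpace ℝ (Fin k)) :=
  (Homeomorph.mulLeft h⁻¹).transOpenPartialHomeomorph c.chart

/-- Chart changes, product and inverse all lift to `Γ`, where they are built from `lift`, its
inverse and products with constants in the algebra; `contDiffAt_comp` brings their smoothness down
to `H`. -/
theorem IdentityChart.exists_lieGroup {H : Type*} [Group H] [TopologicalSpace H]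
    [IsTopologicalGroup H] {pr : Γ →* H} (hsurj : Function.Surjective pr) {k : ℕ}
    (c : IdentityChart pr k) :
    ∃ _ : ChartedSpace (EuclideanSpace ℝ (Fin k)) H, LieGroup (𝓡 k) ∞ H := by
  -- No continuity of `σ` is needed: each chart uses only one value of it.
  obtain ⟨σ, hσ⟩ := hsurj.hasRightInverse
  have hsymm : ∀ h X, (c.chartAt h).symm X = pr (σ h * c.lift X) := fun h X => by
    rw [map_mul, hσ, ← c.symm_apply]
    change (h⁻¹)⁻¹ * c.chart.symm X = _
    rw [inv_inv]
  have happly : ∀ h u, c.chartAt h (pr u) = c.chart (pr ((σ h)⁻¹ * u)) := fun h u => by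
    rw [map_mul, map_inv, hσ]
    rfl
  have hsource : ∀ h u, pr u ∈ (c.chartAt h).source ↔ pr ((σ h)⁻¹ * u) ∈ c.chart.source :=
    fun h u => by
    rw [map_mul, map_inv, hσ]
    rfl
  have hmem : ∀ h, h ∈ (c.chartAt h).source := fun h => by
    change h⁻¹ * h ∈ c.chart.source
    rw [inv_mul_cancel]
    exact c.one_mem
  have hkey : ∀ {V : Type} [NormedAddCommGroup V] [NormedSpace ℝ V] {F : V → Γ} {v : V} (h : H),
      ContDiffAt ℝ ∞ (fun v => ((F v : Aˣ) : A)) v → pr (F v) ∈ (c.chartAt h).source →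
      ContDiffAt ℝ ∞ (fun v => c.chartAt h (pr (F v))) v := fun {V} _ _ {F v} h hF hv => by
    simp only [happly]
    exact c.contDiffAt_comp (F := fun v => (σ h)⁻¹ * F v) (contDiffAt_const.mul hF)
      ((hsource _ _).1 hv)
  have hlift : ∀ h, ContDiff ℝ ∞ fun X => (((σ h * c.lift X : Γ) : Aˣ) : A) := fun h =>
    contDiff_const.mul c.contDiff_lift
  let cs : ChartedSpace (EuclideanSpace ℝ (Fin k)) H :=
    { atlas := Set.range c.chartAt
      chartAt := c.chartAt
      mem_chart_source := hmem
      chart_mem_atlas := fun h => ⟨h, rfl⟩ }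
  have hext : ∀ h x : H, extChartAt (𝓡 k) h x = c.chartAt h x := fun h x => rfl
  have hexts : ∀ (h : H) X, (extChartAt (𝓡 k) h).symm X = pr (σ h * c.lift X) := fun h X => hsymm h X
  have hinv : ∀ h x : H, x ∈ (c.chartAt h).source →
      pr (σ h * c.lift (c.chartAt h x)) = x := fun h x hx => by
    rw [← hsymm]
    exact (c.chartAt h).left_inv hx
  refine ⟨cs, ?_⟩
  have hman : IsManifold (𝓡 k) ∞ H := by
    refine isManifold_of_contDiffOn _ _ _ ?_
    rintro _ _ ⟨h, rfl⟩ ⟨h', rfl⟩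
    intro X hX
    have hX1 : (c.chartAt h).symm X ∈ (c.chartAt h').source := hX.1.2
    rw [hsymm] at hX1
    have h1 := hkey h' ((hlift h).contDiffAt (x := X)) hX1
    simp only [← hsymm] at h1
    exact h1.contDiffWithinAt
  have hmul : ContMDiff ((𝓡 k).prod (𝓡 k)) (𝓡 k) ∞ fun x : H × H => x.1 * x.2 := by
    intro x
    refine contMDiffAt_iff.2 ⟨continuous_mul.continuousAt, ?_⟩
    have h1 : ContDiffAt ℝ ∞ (fun X : EuclideanSpace ℝ (Fin k) × EuclideanSpace ℝ (Fin k) =>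
        ((((σ x.1 * c.lift X.1) * (σ x.2 * c.lift X.2) : Γ) : Aˣ) : A))
        (c.chartAt x.1 x.1, c.chartAt x.2 x.2) :=
      (((hlift x.1).comp contDiff_fst).mul ((hlift x.2).comp contDiff_snd)).contDiffAt
    have h2 := hkey (x.1 * x.2) h1 (by
      rw [map_mul, hinv _ _ (hmem _), hinv _ _ (hmem _)]
      exact hmem _)
    simp only [map_mul pr (σ x.1 * _), ← hsymm] at h2
    exact h2.contDiffWithinAt
  have hinv' : ContMDiff (𝓡 k) (𝓡 k) ∞ fun x : H => x⁻¹ := by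
    intro x
    refine contMDiffAt_iff.2 ⟨continuous_inv.continuousAt, ?_⟩
    have h1 : ContDiffAt ℝ ∞ (fun X : EuclideanSpace ℝ (Fin k) =>
        ((((σ x * c.lift X)⁻¹ : Γ) : Aˣ) : A)) (c.chartAt x x) := by
      simp only [mul_inv_rev]
      exact (c.contDiff_lift_inv.mul contDiff_const).contDiffAt
    have h2 := hkey x⁻¹ h1 (by
      rw [map_inv, hinv _ _ (hmem _)]
      exact hmem _)
    simp only [map_inv pr, ← hsymm] at h2
    exact h2.contDiffWithinAt
  exact { hman with
    contMDiff_mul := hmul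
    contMDiff_inv := hinv' }

/-- A topological group that is the quotient of a closed group of units of a finite-dimensional
algebra by a discrete normal subgroup is a Lie group. -/
theorem exists_lieGroup_of_quotient [CompleteSpace A] [FiniteDimensional ℝ A] (hΓ : IsClosed (Γ : Set Aˣ)) {H : Type*}
    [Group H] [TopologicalSpace H] (pr : Γ →* H) (hcont : Continuous pr) (hopen : IsOpenMap pr)
    (hsurj : Function.Surjective pr) (hker : ∀ᶠ u in 𝓝 (1 : Γ), pr u = 1 → u = 1) :
    ∃ (k : ℕ) (_ : ChartedSpace (EuclideanSpace ℝ (Fin k)) H), LieGroup (𝓡 k) ∞ H := by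
  have hq : IsOpenQuotientMap pr := ⟨hsurj, hcont, hopen⟩
  have : IsTopologicalGroup H :=
    { continuous_mul := by
        refine (hq.prodMap hq).isQuotientMap.continuous_iff.2 ?_
        have h : Continuous fun x : Γ × Γ => pr (x.1 * x.2) := hcont.comp continuous_mul
        simp only [map_mul] at h
        exact h
      continuous_inv := by
        refine hq.isQuotientMap.continuous_iff.2 ?_
        have h : Continuous fun x : Γ => pr x⁻¹ := hcont.comp continuous_inv
        simp only [map_inv] at h
        exact h }
  obtain ⟨k, ⟨c⟩⟩ := exists_identityChart hΓ pr hcont hopen hker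
  exact ⟨k, c.exists_lieGroup hsurj⟩

end QuotientOfClosedLinearGroup

/-! ### Isometries translating the geodesic and their turns -/

section Translations

set_option maxSynthPendingDepth 3

open Filter Metric

local notation "𝔼" n => EuclideanSpace ℝ (Fin n)

variable {n : ℕ} {M : Type*} [TopologicalSpace M] [ChartedSpace (EuclideanSpace ℝ (Fin n)) M]
  [IsManifold (𝓡 n) ∞ M]

theorem tangentBundle_tendsto_nhds_unique [T2Space M] {ι : Type*} {l : Filter ι} [NeBot l]
    {f : ι → TangentBundle (𝓡 n) M} {x : M} {v w : 𝔼 n}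
    (hv : Tendsto f l (𝓝 ⟨x, v⟩)) (hw : Tendsto f l (𝓝 ⟨x, w⟩)) : v = w := by
  have hx := mem_extChartAt_source (I := 𝓡 n) x
  have h1 := ((tendsto_tangentBundle_iff (p := ⟨x, v⟩) hx).1 hv).2
  have h2 := ((tendsto_tangentBundle_iff (p := ⟨x, w⟩) hx).1 hw).2
  exact chartDer_injective hx (tendsto_nhds_unique h1 h2)

variable {g : Metric n M} {γ : ℝ → M}

/-- The isometry `a` translates `γ` by `s`. -/
def IsTranslation (γ : ℝ → M) (a : Isom g) (s : ℝ) : Prop := ∀ t, a.1 (γ t) = γ (t + s)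

theorem IsTranslation.one : IsTranslation γ (1 : Isom g) 0 := fun t => by
  rw [add_zero]
  rfl

theorem IsTranslation.mul {a b : Isom g} {s s' : ℝ} (ha : IsTranslation γ a s)
    (hb : IsTranslation γ b s') : IsTranslation γ (a * b) (s + s') := fun t => by
  change a.1 (b.1 (γ t)) = _
  rw [hb, ha]
  congr 1
  ring

theorem IsTranslation.inv {a : Isom g} {s : ℝ} (ha : IsTranslation γ a s) :
    IsTranslation γ a⁻¹ (-s) := fun t => by
  change a.1.symm (γ t) = _
  rw [Homeomorph.symm_apply_eq, ha, neg_add_cancel_right]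

/-- The differential at `γ 0` of an isometry that translates `γ` by `s`, composed with the parallel
transport back to `γ 0`. -/
noncomputable def turn (γ : ℝ → M) (a : Isom g) (s : ℝ) : (𝔼 n) →L[ℝ] (𝔼 n) :=
  (transport g γ s 0).comp (der n a.1 (γ 0))

/-- The amount and the turn together recover the differential at `γ 0`, and thereby the isometry. -/
theorem push_eq (hγ : ContMDiff 𝓘(ℝ, ℝ) (𝓡 n) ∞ γ) {a : Isom g} {s : ℝ}
    (ha : IsTranslation γ a s) (v : 𝔼 n) :
    push n a.1 (γ 0) v = ⟨γ s, transport g γ 0 s (turn γ a s v)⟩ := by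
  have h1 : transport g γ 0 s (turn γ a s v) = der n a.1 (γ 0) v := by
    rw [turn, ContinuousLinearMap.comp_apply, transport_transport hγ, transport_self hγ]
  have h2 : a.1 (γ 0) = γ s := by rw [ha, zero_add]
  rw [h1, push, h2]

theorem turn_one (hγ : ContMDiff 𝓘(ℝ, ℝ) (𝓡 n) ∞ γ) : turn γ (1 : Isom g) 0 = 1 := by
  ext1 v
  rw [turn, ContinuousLinearMap.comp_apply, transport_self hγ]
  exact der_id _ v

theorem der_mul (a b : Isom g) (z : M) (v : 𝔼 n) :
    der n (a * b).1 z v = der n a.1 (b.1 z) (der n b.1 z v) := by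
  have h : mfderiv (𝓡 n) (𝓡 n) ((a.1 : M → M) ∘ b.1) z = _ :=
    mfderiv_comp z (a.2.1.1.mdifferentiable (by simp) _) (b.2.1.1.mdifferentiable (by simp) _)
  exact DFunLike.congr_fun h v

/-- The differential of `a` commutes with transport along `γ` up to the shift, so it can be carried
past the transport that enters the turn of `b`. -/
theorem turn_mul (hγ : ContMDiff 𝓘(ℝ, ℝ) (𝓡 n) ∞ γ) {a b : Isom g} {s s' : ℝ}
    (ha : IsTranslation γ a s) (hb : IsTranslation γ b s') :
    turn γ (a * b) (s + s') = turn γ a s * turn γ b s' := by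
  ext1 v
  have h1 : der n b.1 (γ 0) v = transport g γ 0 s' (turn γ b s' v) := by
    rw [turn, ContinuousLinearMap.comp_apply, transport_transport hγ, transport_self hγ]
  have h2 := der_transport hγ a.2.1 ha 0 s' (turn γ b s' v)
  rw [← h1, zero_add] at h2
  rw [turn, ContinuousLinearMap.comp_apply, der_mul, hb, zero_add, h2, add_comm s' s,
    transport_transport hγ]
  rfl

theorem form_turn (hγ : ContMDiff 𝓘(ℝ, ℝ) (𝓡 n) ∞ γ) {a : Isom g} {s : ℝ}
    (ha : IsTranslation γ a s) (v w : 𝔼 n) :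
    form g (γ 0) (turn γ a s v) (turn γ a s w) = form g (γ 0) v w := by
  rw [turn, ContinuousLinearMap.comp_apply, ContinuousLinearMap.comp_apply, form_transport hγ]
  have h := a.2.1.form_der (γ 0) v w
  rwa [ha, zero_add] at h

theorem turn_vel (hγ : IsUnitSpeedGeodesic g γ) {a : Isom g} {s : ℝ} (ha : IsTranslation γ a s) :
    turn γ a s (vel n γ 0) = vel n γ 0 := by
  have h := vel_of_comp a.2.1 hγ.smooth hγ.smooth ha 0
  rw [turn, ContinuousLinearMap.comp_apply, ← h, zero_add, transport_vel hγ]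

theorem turn_inv_mul (hγ : ContMDiff 𝓘(ℝ, ℝ) (𝓡 n) ∞ γ) {a : Isom g} {s : ℝ}
    (ha : IsTranslation γ a s) : turn γ a⁻¹ (-s) * turn γ a s = 1 := by
  rw [← turn_mul hγ ha.inv ha, inv_mul_cancel, neg_add_cancel, turn_one hγ]

theorem turn_mul_inv (hγ : ContMDiff 𝓘(ℝ, ℝ) (𝓡 n) ∞ γ) {a : Isom g} {s : ℝ}
    (ha : IsTranslation γ a s) : turn γ a s * turn γ a⁻¹ (-s) = 1 := by
  rw [← turn_mul hγ ha ha.inv, mul_inv_cancel, add_neg_cancel, turn_one hγ]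

theorem isUnit_of_form_eq {z : M} {B : (𝔼 n) →L[ℝ] (𝔼 n)}
    (hB : ∀ v w, form g z (B v) (B w) = form g z v w) : IsUnit B := by
  have hinj : Function.Injective B := by
    refine (injective_iff_map_eq_zero B).2 fun v hv => ?_
    by_contra hne
    have h := form_pos g z hne
    rw [← hB, hv] at h
    simp at h
  exact ContinuousLinearMap.isUnit_iff_bijective.2
    ⟨hinj, (LinearMap.injective_iff_surjective (f := (B : (𝔼 n) →ₗ[ℝ] 𝔼 n))).1 hinj⟩

/-- Boundedness of the orthogonal group in operator norm; it supplies the compactness of the turns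
for periodic `γ`. -/
theorem isBounded_form_eq (g : Metric n M) (z : M) :
    ∃ C : ℝ, ∀ B : (𝔼 n) →L[ℝ] (𝔼 n), (∀ v w, form g z (B v) (B w) = form g z v w) → ‖B‖ ≤ C := by
  obtain ⟨c, hc0, hc⟩ : ∃ c : ℝ, 0 < c ∧ ∀ v : 𝔼 n, c * ‖v‖ ^ 2 ≤ form g z v v := by
    have hm : IsCoordMetric Set.univ fun _ : 𝔼 n => form g z :=
      ⟨isOpen_univ, contDiffOn_const, fun _ _ => form_symm g z, fun _ _ _ => form_pos g z⟩
    obtain ⟨c, hc, h⟩ := hm.exists_lower_bound (isCompact_singleton (x := 0)) (Set.subset_univ _)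
    exact ⟨c, hc, h 0 rfl⟩
  refine ⟨√(‖form g z‖ / c), fun B hB => ?_⟩
  refine B.opNorm_le_bound (Real.sqrt_nonneg _) fun v => ?_
  have h1 : c * ‖B v‖ ^ 2 ≤ ‖form g z‖ * ‖v‖ ^ 2 := by
    refine (hc (B v)).trans ?_
    rw [hB]
    refine (Real.le_norm_self _).trans (((form g z).le_opNorm₂ v v).trans_eq ?_)
    ring
  have h2 : ‖B v‖ ^ 2 ≤ ‖form g z‖ / c * ‖v‖ ^ 2 := by
    rw [div_mul_eq_mul_div, le_div_iff₀ hc0]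
    linarith
  refine (Real.le_sqrt (norm_nonneg _) (by positivity) |>.2 h2).trans_eq ?_
  rw [Real.sqrt_mul (by positivity), Real.sqrt_sq (norm_nonneg _)]

/-- The velocity is nonzero, so `γ` does not return to `γ 0` at small nonzero times. Hence the
periods are discrete. -/
theorem eventually_eq_zero_of_apply_eq (hγ : IsUnitSpeedGeodesic g γ) :
    ∀ᶠ s in 𝓝 (0 : ℝ), γ s = γ 0 → s = 0 := by
  have hx := mem_extChartAt_source (I := 𝓡 n) (γ 0)
  have h1 := hasDerivAt_chart hγ.smooth hx
  have hv : vel n γ 0 ≠ 0 := fun h => by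
    have h2 : form g (γ 0) (vel n γ 0) (vel n γ 0) = 1 := hγ.unit 0
    rw [h] at h2
    simp at h2
  have hne : chartDer n (γ 0) (γ 0) (vel n γ 0) ≠ 0 := fun h =>
    hv (chartDer_injective hx (h.trans (map_zero _).symm))
  have h3 := h1.eventually_ne (c := extChartAt (𝓡 n) (γ 0) (γ 0)) hne
  rw [eventually_nhdsWithin_iff] at h3
  filter_upwards [h3] with s hs h
  by_contra h0
  exact hs h0 (by rw [h])

variable [T2Space M] [ConnectedSpace M]

theorem IsTranslation.tendsto (hγ : ContMDiff 𝓘(ℝ, ℝ) (𝓡 n) ∞ γ) {ι : Type*} {l : Filter ι}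
    {a : ι → Isom g} {s : ι → ℝ} (ha : ∀ i, IsTranslation γ (a i) (s i)) {b : Isom g} {s₀ : ℝ}
    (hb : IsTranslation γ b s₀) (hs : Tendsto s l (𝓝 s₀))
    (ht : Tendsto (fun i => turn γ (a i) (s i)) l (𝓝 (turn γ b s₀))) : Tendsto a l (𝓝 b) := by
  refine Isom.tendsto_of_push (z := γ 0) fun v => tendsto_map'_iff.2 ?_
  rw [push_eq hγ hb]
  refine (tendsto_transport hγ 0 hs (tendsto_clm_apply ht tendsto_const_nhds)).congr fun i => ?_
  exact (push_eq hγ (ha i) v).symm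

/-- Translations of `γ` converge as soon as their amounts and their turns do. -/
theorem IsTranslation.exists_tendsto (hγ : ContMDiff 𝓘(ℝ, ℝ) (𝓡 n) ∞ γ) {ι : Type*} {l : Filter ι}
    [NeBot l] {a : ι → Isom g} {s : ι → ℝ} (ha : ∀ i, IsTranslation γ (a i) (s i)) {s₀ : ℝ}
    {B : (𝔼 n) →L[ℝ] (𝔼 n)} (hs : Tendsto s l (𝓝 s₀))
    (ht : Tendsto (fun i => turn γ (a i) (s i)) l (𝓝 B)) :
    ∃ b : Isom g, IsTranslation γ b s₀ ∧ turn γ b s₀ = B ∧ Tendsto a l (𝓝 b) := by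
  have happ : ∀ v, Tendsto (fun i => turn γ (a i) (s i) v) l (𝓝 (B v)) := fun v =>
    tendsto_clm_apply ht tendsto_const_nhds
  have hB : ∀ v w, form g (γ 0) (B v) (B w) = form g (γ 0) v w := fun v w => by
    refine tendsto_nhds_unique ?_ (tendsto_const_nhds (x := form g (γ 0) v w) (f := l))
    refine (tendsto_clm_apply (tendsto_clm_apply tendsto_const_nhds (happ v)) (happ w)).congr
      fun i => form_turn hγ (ha i) v w
  -- Being orthogonal, the limit turn is invertible, so the turns of the inverse isometries converge
  -- as well; this is needed for the limit to be a bijection.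
  obtain ⟨U, hU⟩ := isUnit_of_form_eq hB
  have hinv : Tendsto (fun i => turn γ (a i)⁻¹ (-s i)) l (𝓝 (Ring.inverse B)) := by
    have h1 := (NormedRing.inverse_continuousAt U).tendsto
    rw [hU] at h1
    refine (h1.comp ht).congr fun i => ?_
    let W : ((𝔼 n) →L[ℝ] (𝔼 n))ˣ :=
      ⟨turn γ (a i) (s i), turn γ (a i)⁻¹ (-s i), turn_mul_inv hγ (ha i), turn_inv_mul hγ (ha i)⟩
    exact Ring.inverse_unit W
  have hpush : ∀ v, Tendsto (fun i => push n (a i).1 (γ 0) v) l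
      (𝓝 ⟨γ s₀, transport g γ 0 s₀ (B v)⟩) := fun v =>
    (tendsto_transport hγ 0 hs (happ v)).congr fun i => (push_eq hγ (ha i) v).symm
  obtain ⟨b, hb⟩ := Isom.exists_tendsto (z := γ 0) (z' := γ 0) (fun v => ⟨_, hpush v⟩) fun v =>
    ⟨_, (tendsto_transport hγ 0 hs.neg
      (tendsto_clm_apply hinv (tendsto_const_nhds (x := v)))).congr fun i =>
      (push_eq hγ (ha i).inv v).symm⟩
  have hb' : ∀ x, Tendsto (fun i => (a i).1 x) l (𝓝 (b.1 x)) := fun x =>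
    tendsto_apply_of_push (hb x 0)
  have hbt : IsTranslation γ b s₀ := fun t => by
    refine tendsto_nhds_unique (hb' (γ t)) ?_
    refine ((hγ.continuous.tendsto (t + s₀)).comp (tendsto_const_nhds.add hs)).congr fun i => ?_
    exact (ha i t).symm
  have hturn : turn γ b s₀ = B := by
    ext1 v
    have h1 := hb (γ 0) v
    rw [push_eq hγ hbt] at h1
    have h2 := tangentBundle_tendsto_nhds_unique h1 (hpush v)
    have h3 := congrArg (transport g γ s₀ 0) h2
    rwa [transport_transport hγ, transport_transport hγ, transport_self hγ, transport_self hγ] at h3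
  exact ⟨b, hbt, hturn, Isom.tendsto_of_tendsto_apply hb'⟩

theorem IsTranslation.eq_of_turn_eq (hγ : ContMDiff 𝓘(ℝ, ℝ) (𝓡 n) ∞ γ) {a b : Isom g} {s : ℝ}
    (ha : IsTranslation γ a s) (hb : IsTranslation γ b s) (h : turn γ a s = turn γ b s) : a = b :=
  Isom.eq_of_push (z := γ 0) fun v => by rw [push_eq hγ ha, push_eq hγ hb, h]

end Translations

/-! ### The group of translations with amounts, as a closed group of units -/

section TranslationGroup

set_option maxSynthPendingDepth 3

open Filter Metric

local notation "𝔼" n => EuclideanSpace ℝ (Fin n)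

variable {n : ℕ} {M : Type*} [TopologicalSpace M] [ChartedSpace (EuclideanSpace ℝ (Fin n)) M]
  [IsManifold (𝓡 n) ∞ M] {g : Metric n M} {γ : ℝ → M}

/-- The isometries that translate `γ`, together with the amount of the translation. -/
def translationGroup (g : Metric n M) (γ : ℝ → M) : Subgroup (Multiplicative ℝ × Isom g) where
  carrier := {x | IsTranslation γ x.2 x.1.toAdd}
  mul_mem' := fun ha hb => IsTranslation.mul ha hb
  one_mem' := IsTranslation.one
  inv_mem' := fun ha => IsTranslation.inv ha

/-- The element of the translation group given by a translation. -/
def IsTranslation.toGroup {a : Isom g} {s : ℝ} (h : IsTranslation γ a s) : translationGroup g γ :=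
  ⟨(Multiplicative.ofAdd s, a), h⟩

/-- The amount of a translation. -/
def amount (x : translationGroup g γ) : ℝ := x.1.1.toAdd

theorem isTranslation (x : translationGroup g γ) : IsTranslation γ x.1.2 (amount x) := x.2

/-- The projection of the group of translations with their amounts onto `G_γ`. -/
def toG (g : Metric n M) (γ : ℝ → M) : translationGroup g γ →* G g γ where
  toFun x := ⟨x.1.2, amount x, isTranslation x⟩
  map_one' := rfl
  map_mul' _ _ := rfl

theorem toG_surjective : Function.Surjective (toG g γ) := fun a =>
  ⟨IsTranslation.toGroup (s := shift a) (shift_spec a), rfl⟩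

/-- The development of a translation, in multiplicative form. -/
noncomputable def unitHom (hγ : ContMDiff 𝓘(ℝ, ℝ) (𝓡 n) ∞ γ) :
    translationGroup g γ →* (ℝ × ((𝔼 n) →L[ℝ] (𝔼 n)))ˣ :=
  MonoidHom.toHomUnits
    -- The exponential turns the additive amount into a unit of ℝ.
    { toFun := fun x => (Real.exp (amount x), turn γ x.1.2 (amount x))
      map_one' := Prod.ext Real.exp_zero (turn_one hγ)
      map_mul' := fun x y => Prod.ext (Real.exp_add _ _)
        (turn_mul hγ (isTranslation x) (isTranslation y)) }

theorem val_unitHom (hγ : ContMDiff 𝓘(ℝ, ℝ) (𝓡 n) ∞ γ) (x : translationGroup g γ) :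
    (unitHom hγ x : ℝ × ((𝔼 n) →L[ℝ] (𝔼 n))) =
      (Real.exp (amount x), turn γ x.1.2 (amount x)) := rfl

theorem tendsto_unitHom_iff (hγ : ContMDiff 𝓘(ℝ, ℝ) (𝓡 n) ∞ γ) {ι : Type*} {l : Filter ι}
    {x : ι → translationGroup g γ} {u : (ℝ × ((𝔼 n) →L[ℝ] (𝔼 n)))ˣ} :
    Tendsto (fun i => unitHom hγ (x i)) l (𝓝 u) ↔
      Tendsto (fun i => Real.exp (amount (x i))) l (𝓝 u.val.1) ∧
      Tendsto (fun i => turn γ (x i).1.2 (amount (x i))) l (𝓝 u.val.2) := by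
  rw [Units.isOpenEmbedding_val.isInducing.tendsto_nhds_iff, nhds_prod_eq, tendsto_prod_iff']
  rfl

theorem tendsto_amount {ι : Type*} {l : Filter ι} {s : ι → ℝ} {c : ℝ} (hc : c ≠ 0)
    (h : Tendsto (fun i => Real.exp (s i)) l (𝓝 c)) : Tendsto s l (𝓝 (Real.log c)) := by
  have h1 := (Real.continuousAt_log hc).tendsto.comp h
  simpa [Function.comp_def] using h1

theorem tendsto_unitHom_unitHom_iff (hγ : ContMDiff 𝓘(ℝ, ℝ) (𝓡 n) ∞ γ) {ι : Type*} {l : Filter ι}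
    {x : ι → translationGroup g γ} {y : translationGroup g γ} :
    Tendsto (fun i => unitHom hγ (x i)) l (𝓝 (unitHom hγ y)) ↔
      Tendsto (fun i => amount (x i)) l (𝓝 (amount y)) ∧
      Tendsto (fun i => turn γ (x i).1.2 (amount (x i))) l (𝓝 (turn γ y.1.2 (amount y))) := by
  rw [tendsto_unitHom_iff]
  refine and_congr ⟨fun h => ?_, fun h => (Real.continuous_exp.tendsto _).comp h⟩ Iff.rfl
  have h1 : Tendsto (fun i => amount (x i)) l (𝓝 (Real.log (Real.exp (amount y)))) :=
    tendsto_amount (Real.exp_ne_zero _) h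
  rwa [Real.log_exp] at h1

omit [TopologicalSpace M] in
theorem eq_of_forall_apply_add_eq (hper : ¬ IsPeriodic γ) {s s' : ℝ}
    (h : ∀ t, γ (t + s) = γ (t + s')) : s = s' := by
  have key : ∀ {s s' : ℝ}, (∀ t, γ (t + s) = γ (t + s')) → ¬ s < s' := fun {s s'} h hlt => by
    refine hper ⟨s' - s, sub_pos.2 hlt, fun t => ?_⟩
    have h1 := h (t - s)
    rw [sub_add_cancel] at h1
    rw [h1]
    congr 1
    ring
  exact le_antisymm (not_lt.1 (key fun t => (h t).symm)) (not_lt.1 (key h))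

omit [IsManifold (𝓡 n) ∞ M] in
theorem tangentCast_eq {x y : M} (h : x = y) (v : 𝔼 n) :
    (tangentCast h : (𝔼 n) →L[ℝ] (𝔼 n)) v = v := by
  subst h
  rfl

theorem exists_isTranslation_mem_Icc {p : ℝ} (hp : 0 < p) (hper : Function.Periodic γ p)
    (a : G g γ) (c : ℝ) : ∃ s ∈ Set.Icc c (c + p), IsTranslation γ a.1 s := by
  obtain ⟨m, hm, -⟩ := existsUnique_add_zsmul_mem_Ico hp (shift a) c
  refine ⟨_, Set.Ico_subset_Icc_self hm, fun t => ?_⟩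
  rw [shift_spec a, ← add_assoc, hper.zsmul m]

variable [T2Space M] [ConnectedSpace M]

theorem unitHom_injective (hγ : ContMDiff 𝓘(ℝ, ℝ) (𝓡 n) ∞ γ) :
    Function.Injective (unitHom (g := g) hγ) := fun x y h => by
  have h1 := congrArg (fun u : (ℝ × ((𝔼 n) →L[ℝ] (𝔼 n)))ˣ => u.val) h
  simp only [val_unitHom, Prod.mk.injEq, Real.exp_eq_exp] at h1
  refine Subtype.ext (Prod.ext h1.1 ?_)
  refine (isTranslation x).eq_of_turn_eq hγ (h1.1 ▸ isTranslation y) ?_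
  rw [h1.2, h1.1]

/-- At a point of the closure the amounts and turns converge, so the translations converge to a
translation with these data. -/
theorem isClosed_range_unitHom (hγ : ContMDiff 𝓘(ℝ, ℝ) (𝓡 n) ∞ γ) :
    IsClosed ((unitHom (g := g) hγ).range : Set (ℝ × ((𝔼 n) →L[ℝ] (𝔼 n)))ˣ) := by
  refine isClosed_of_closure_subset fun u hu => ?_
  have hne : NeBot (comap (unitHom (g := g) hγ) (𝓝 u)) :=
    comap_neBot_iff_frequently.2 (mem_closure_iff_frequently.1 hu)
  obtain ⟨h1, h2⟩ := (tendsto_unitHom_iff (l := comap (unitHom (g := g) hγ) (𝓝 u)) hγ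
    (x := fun x => x)).1 tendsto_comap
  have hu0 : u.val.1 ≠ 0 := ((Prod.isUnit_iff.1 u.isUnit).1).ne_zero
  -- A limit of exponentials is nonnegative, and the first coordinate of a unit is nonzero, so its
  -- logarithm is an amount.
  have hpos : 0 < u.val.1 :=
    lt_of_le_of_ne (ge_of_tendsto' h1 fun x => (Real.exp_pos _).le) hu0.symm
  obtain ⟨b, hb, hbt, -⟩ := IsTranslation.exists_tendsto hγ (fun x => isTranslation x)
    (tendsto_amount hu0 h1) h2
  refine ⟨hb.toGroup, Units.ext (Prod.ext (Real.exp_log hpos) hbt)⟩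

/-- `G_γ` as a quotient of a closed group of units. -/
noncomputable def unitsToG (hγ : ContMDiff 𝓘(ℝ, ℝ) (𝓡 n) ∞ γ) :
    (unitHom (g := g) hγ).range →* G g γ :=
  (toG g γ).comp (MonoidHom.ofInjective (unitHom_injective hγ)).symm.toMonoidHom

theorem unitsToG_apply (hγ : ContMDiff 𝓘(ℝ, ℝ) (𝓡 n) ∞ γ) (x : translationGroup g γ) :
    unitsToG hγ ⟨unitHom hγ x, x, rfl⟩ = toG g γ x := by
  have h : (MonoidHom.ofInjective (unitHom_injective (g := g) hγ)).symm ⟨unitHom hγ x, x, rfl⟩ = x :=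
    (MulEquiv.symm_apply_eq _).2 rfl
  exact congrArg (toG g γ) h

/-- Common core of both cases. The kernel of the projection consists of the amounts by which the
identity translates `γ`; `hker` is its discreteness. -/
theorem isLieGroup_G (hγ : ContMDiff 𝓘(ℝ, ℝ) (𝓡 n) ∞ γ) (τ : TopologicalSpace (G g γ))
    (hT2 : T2Space (G g γ)) (hcont : Continuous (unitsToG (g := g) hγ))
    (hopen : IsOpenMap (unitsToG (g := g) hγ))
    (hker : ∀ᶠ s in 𝓝 (0 : ℝ), IsTranslation γ (1 : Isom g) s → s = 0) :
    @IsLieGroup (G g γ) _ τ := by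
  have hsurj : Function.Surjective (unitsToG (g := g) hγ) := fun a => by
    obtain ⟨x, rfl⟩ := toG_surjective a
    exact ⟨_, unitsToG_apply hγ x⟩
  have hq : IsOpenQuotientMap (unitsToG (g := g) hγ) := ⟨hsurj, hcont, hopen⟩
  have hsc : SecondCountableTopology (ℝ × ((𝔼 n) →L[ℝ] (𝔼 n)))ˣ :=
    Units.isOpenEmbedding_val.isInducing.secondCountableTopology
  have hsc' : SecondCountableTopology (unitHom (g := g) hγ).range :=
    TopologicalSpace.Subtype.secondCountableTopology _
  refine ⟨hT2, hq.isQuotientMap.secondCountableTopology hopen, ?_⟩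
  refine exists_lieGroup_of_quotient (isClosed_range_unitHom hγ) (unitsToG hγ) hcont hopen hsurj ?_
  have h1 : Tendsto (fun u : (unitHom (g := g) hγ).range => Real.log u.1.val.1) (𝓝 1) (𝓝 0) := by
    have h2 : Continuous fun u : (unitHom (g := g) hγ).range => u.1.val.1 :=
      continuous_fst.comp (Units.continuous_val.comp continuous_subtype_val)
    have h3 := (h2.continuousAt (x := 1)).log (by simp)
    simpa [ContinuousAt] using h3
  filter_upwards [h1.eventually hker]
  rintro ⟨_, x, rfl⟩ hu h
  rw [unitsToG_apply] at h
  have h4 : x.1.2 = 1 := congrArg Subtype.val h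
  have h5 : Real.log (unitHom hγ x).val.1 = amount x := Real.log_exp _
  rw [h5, ← h4] at hu
  have h6 : x = 1 := Subtype.ext (Prod.ext (hu (isTranslation x)) h4)
  exact Subtype.ext ((congrArg (unitHom hγ) h6).trans (map_one _))

theorem continuous_unitsToG (hγ : ContMDiff 𝓘(ℝ, ℝ) (𝓡 n) ∞ γ) (τ : TopologicalSpace (G g γ))
    (h : ∀ (y : translationGroup g γ) (l : Filter (translationGroup g γ)),
      Tendsto amount l (𝓝 (amount y)) →
      Tendsto (fun x => turn γ x.1.2 (amount x)) l (𝓝 (turn γ y.1.2 (amount y))) →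
      Tendsto (toG g γ) l (𝓝 (toG g γ y))) : Continuous (unitsToG (g := g) hγ) := by
  refine continuous_iff_continuousAt.2 ?_
  rintro ⟨_, y, rfl⟩
  let e := MonoidHom.ofInjective (unitHom_injective (g := g) hγ)
  have he : ∀ u, unitHom hγ (e.symm u) = u.1 := fun u =>
    congrArg Subtype.val (e.apply_symm_apply u)
  have h1 : Tendsto (fun u => unitHom hγ (e.symm u)) (𝓝 ⟨unitHom hγ y, y, rfl⟩)
      (𝓝 (unitHom hγ y)) := by
    simp only [he]
    exact continuous_subtype_val.tendsto _
  obtain ⟨h2, h3⟩ := (tendsto_unitHom_unitHom_iff hγ).1 h1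
  have h4 := h y (map e.symm (𝓝 ⟨unitHom hγ y, y, rfl⟩)) h2 h3
  rw [ContinuousAt, unitsToG_apply]
  exact h4

/-! ### Non-periodic geodesics -/

section NonPeriodic

omit [T2Space M] [ConnectedSpace M] in
theorem IsTranslation.eq_shift (hper : ¬ IsPeriodic γ) {a : G g γ} {s : ℝ}
    (h : IsTranslation γ a.1 s) : s = shift a :=
  eq_of_forall_apply_add_eq hper fun t => (h t).symm.trans (shift_spec a t)

omit [T2Space M] [ConnectedSpace M] in
theorem rotation_eq (a : G g γ) : (rotation a : (𝔼 n) →L[ℝ] (𝔼 n)) = turn γ a.1 (shift a) := by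
  ext1 v
  exact congrArg (transport g γ (shift a) 0) (tangentCast_eq _ _)

/-- The development of `G_γ`, with values in the linear maps of the model space. -/
noncomputable def modelDevelopment (g : Metric n M) (γ : ℝ → M) (a : G g γ) :
    ℝ × ((𝔼 n) →L[ℝ] (𝔼 n)) := (shift a, turn γ a.1 (shift a))

omit [T2Space M] [ConnectedSpace M] in
theorem development_eq : (development g γ : G g γ → ℝ × ((𝔼 n) →L[ℝ] (𝔼 n))) =
    modelDevelopment g γ :=
  funext fun a => Prod.ext rfl (rotation_eq a)

omit [T2Space M] [ConnectedSpace M] in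
theorem naturalTopology_eq :
    naturalTopology g γ = TopologicalSpace.induced (modelDevelopment g γ) inferInstance :=
  congrArg (fun f : G g γ → ℝ × ((𝔼 n) →L[ℝ] (𝔼 n)) => TopologicalSpace.induced f inferInstance)
    development_eq

theorem modelDevelopment_injective (hγ : ContMDiff 𝓘(ℝ, ℝ) (𝓡 n) ∞ γ) :
    Function.Injective (modelDevelopment g γ) := fun a b h => by
  have h1 : shift a = shift b := congrArg Prod.fst h
  have h2 : turn γ a.1 (shift a) = turn γ b.1 (shift b) := congrArg Prod.snd h
  refine Subtype.ext (IsTranslation.eq_of_turn_eq hγ (shift_spec a) (h1 ▸ shift_spec b) ?_)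
  rw [h2, h1]

theorem isClosed_range_modelDevelopment (hper : ¬ IsPeriodic γ)
    (hγ : ContMDiff 𝓘(ℝ, ℝ) (𝓡 n) ∞ γ) : IsClosed (Set.range (modelDevelopment g γ)) := by
  refine isClosed_of_closure_subset fun u hu => ?_
  have hne : NeBot (comap (modelDevelopment g γ) (𝓝 u)) :=
    comap_neBot_iff_frequently.2 (mem_closure_iff_frequently.1 hu)
  have h : Tendsto (modelDevelopment g γ) (comap (modelDevelopment g γ) (𝓝 u)) (𝓝 u) :=
    tendsto_comap
  obtain ⟨b, hb, hbt, -⟩ := IsTranslation.exists_tendsto hγ (fun a : G g γ => shift_spec a)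
    ((continuous_fst.tendsto u).comp h) ((continuous_snd.tendsto u).comp h)
  have h1 : u.1 = shift (⟨b, u.1, hb⟩ : G g γ) := IsTranslation.eq_shift hper hb
  exact ⟨⟨b, u.1, hb⟩, Prod.ext h1.symm ((congrArg (turn γ b) h1.symm).trans hbt)⟩

theorem isLieGroup_naturalTopology (hper : ¬ IsPeriodic γ) (hγ : ContMDiff 𝓘(ℝ, ℝ) (𝓡 n) ∞ γ) :
    @IsLieGroup (G g γ) _ (naturalTopology g γ) := by
  rw [naturalTopology_eq]
  have hshift : ∀ x : translationGroup g γ, shift (toG g γ x) = amount x := fun x =>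
    (IsTranslation.eq_shift (a := toG g γ x) hper (isTranslation x)).symm
  let τ : TopologicalSpace (G g γ) := TopologicalSpace.induced (modelDevelopment g γ) inferInstance
  refine isLieGroup_G hγ τ ?_ ?_ ?_ ?_
  · exact T2Space.of_injective_continuous (modelDevelopment_injective hγ) continuous_induced_dom
  · refine continuous_unitsToG hγ τ fun y l h1 h2 => ?_
    rw [nhds_induced, tendsto_comap_iff, nhds_prod_eq, tendsto_prod_iff']
    simp only [Function.comp_def, modelDevelopment, hshift]
    exact ⟨h1, h2⟩
  · have hcont : Continuous (modelDevelopment g γ) := continuous_induced_dom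
    -- Without periods the amount is determined by the isometry, so the projection has an inverse,
    -- continuous by the definition of the natural topology.
    have hinv : Continuous fun a : G g γ => (⟨unitHom hγ (IsTranslation.toGroup (shift_spec a)),
        _, rfl⟩ : (unitHom (g := g) hγ).range) := by
      refine Continuous.subtype_mk (continuous_iff_continuousAt.2 fun a => ?_) _
      exact (tendsto_unitHom_unitHom_iff hγ).2 ⟨(continuous_fst.comp hcont).tendsto a,
        (continuous_snd.comp hcont).tendsto a⟩
    refine IsOpenMap.of_inverse hinv (fun a => ?_) ?_
    · exact unitsToG_apply hγ _
    · rintro ⟨_, x, rfl⟩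
      rw [unitsToG_apply]
      refine Subtype.ext (congrArg (unitHom hγ) (Subtype.ext (Prod.ext (hshift x) rfl)))
  · refine Eventually.of_forall fun s hs => ?_
    exact eq_of_forall_apply_add_eq hper fun t => (hs t).symm.trans (IsTranslation.one (g := g) t)

theorem continuous_val_naturalTopology (hγ : ContMDiff 𝓘(ℝ, ℝ) (𝓡 n) ∞ γ) :
    Continuous[naturalTopology g γ, inferInstance] (Subtype.val : G g γ → Isom g) := by
  rw [naturalTopology_eq]
  let τ : TopologicalSpace (G g γ) := TopologicalSpace.induced (modelDevelopment g γ) inferInstance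
  refine (@continuous_iff_continuousAt _ _ τ _ _).2 fun a => ?_
  have h : Tendsto (modelDevelopment g γ) (@nhds _ τ a) (𝓝 (modelDevelopment g γ a)) := by
    rw [nhds_induced]
    exact tendsto_comap
  exact IsTranslation.tendsto hγ (fun a : G g γ => shift_spec a) (shift_spec a)
    ((continuous_fst.tendsto _).comp h) ((continuous_snd.tendsto _).comp h)

end NonPeriodic

/-! ### Periodic geodesics -/

section Periodic

/-- Bounded amounts and orthogonal turns both range in compact sets, so along an ultrafilter they
converge, and with them the isometries. -/
theorem IsTranslation.exists_tendsto_of_mem_Icc (hγ : ContMDiff 𝓘(ℝ, ℝ) (𝓡 n) ∞ γ) {ι : Type*}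
    (l : Ultrafilter ι) {a : ι → Isom g} {s : ι → ℝ} {c d : ℝ}
    (ha : ∀ i, IsTranslation γ (a i) (s i)) (hs : ∀ i, s i ∈ Set.Icc c d) :
    ∃ b s₀, IsTranslation γ b s₀ ∧ Tendsto s l (𝓝 s₀) ∧
      Tendsto (fun i => turn γ (a i) (s i)) l (𝓝 (turn γ b s₀)) ∧ Tendsto a l (𝓝 b) := by
  obtain ⟨C, hC⟩ := isBounded_form_eq g (γ 0)
  have hs' : ∀ᶠ i in (l : Filter ι), s i ∈ Set.Icc c d := Eventually.of_forall hs
  have ht' : ∀ᶠ i in (l : Filter ι),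
      turn γ (a i) (s i) ∈ closedBall (0 : (𝔼 n) →L[ℝ] (𝔼 n)) C := Eventually.of_forall fun i =>
    mem_closedBall_zero_iff.2 (hC _ (form_turn hγ (ha i)))
  obtain ⟨s₀, -, hs₀⟩ := isCompact_Icc.ultrafilter_le_nhds (l.map s) (le_principal_iff.2 hs')
  obtain ⟨B, -, hB⟩ := (isCompact_closedBall (0 : (𝔼 n) →L[ℝ] (𝔼 n)) C).ultrafilter_le_nhds
    (l.map fun i => turn γ (a i) (s i)) (le_principal_iff.2 ht')
  have hs₁ : Tendsto s l (𝓝 s₀) := hs₀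
  have hB₁ : Tendsto (fun i => turn γ (a i) (s i)) l (𝓝 B) := hB
  obtain ⟨b, hb, rfl, hab⟩ := IsTranslation.exists_tendsto (l := l) hγ ha hs₁ hB₁
  exact ⟨b, s₀, hb, hs₁, hB₁, hab⟩

theorem compactSpace_G (hγ : ContMDiff 𝓘(ℝ, ℝ) (𝓡 n) ∞ γ) {p : ℝ} (hp : 0 < p)
    (hper : Function.Periodic γ p) : CompactSpace (G g γ) := by
  choose s hs hsa using fun a : G g γ => exists_isTranslation_mem_Icc hp hper a 0
  refine ⟨isCompact_iff_ultrafilter_le_nhds.2 fun l _ => ?_⟩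
  obtain ⟨b, s₀, hb, -, -, h⟩ := IsTranslation.exists_tendsto_of_mem_Icc hγ l hsa hs
  refine ⟨⟨b, s₀, hb⟩, trivial, ?_⟩
  exact tendsto_subtype_rng (f := fun a : G g γ => a).2 h

instance : T2Space (Isom g) := by
  refine T2Space.of_injective_continuous (f := fun a : Isom g => (⟨a.1, a.1.continuous⟩ : C(M, M)))
    (fun a b h => Isom.ext_apply fun x => DFunLike.congr_fun h x) continuous_induced_dom

/-- Along an ultrafilter in `G g γ` tending to the image of `y`, lifts with amounts in [0, p]
converge, though perhaps to another lift of the same isometry; multiplication by a kernel element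
corrects this. -/
theorem isOpenMap_unitsToG (hγ : ContMDiff 𝓘(ℝ, ℝ) (𝓡 n) ∞ γ) {p : ℝ} (hp : 0 < p)
    (hper : Function.Periodic γ p) : IsOpenMap (unitsToG (g := g) hγ) := by
  refine isOpenMap_iff_nhds_le.2 ?_
  rintro ⟨_, y, rfl⟩
  rw [unitsToG_apply]
  choose s hs hsa using fun a : G g γ => exists_isTranslation_mem_Icc hp hper a 0
  refine le_iff_ultrafilter.2 fun l hl => ?_
  obtain ⟨b, s₀, hb, h1, h2, h3⟩ := IsTranslation.exists_tendsto_of_mem_Icc hγ l hsa hs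
  have hby : b = y.1.2 := tendsto_nhds_unique h3 (tendsto_subtype_rng.1 hl)
  subst hby
  -- It has the identity as its isometry and the difference of the two amounts as its amount.
  let κ : translationGroup g γ := y * hb.toGroup⁻¹
  have hκ : toG g γ κ = 1 := Subtype.ext (mul_inv_cancel y.1.2)
  have h4 : Tendsto (fun a => unitHom hγ (hsa a).toGroup) l (𝓝 (unitHom hγ hb.toGroup)) :=
    (tendsto_unitHom_unitHom_iff hγ).2 ⟨h1, h2⟩
  have h5 : Tendsto (fun a => unitHom hγ (κ * (hsa a).toGroup)) l (𝓝 (unitHom hγ y)) := by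
    have h6 := h4.const_mul (unitHom hγ κ)
    simp only [← map_mul] at h6
    rwa [inv_mul_cancel_right] at h6
  have h7 : Tendsto (fun a => (⟨unitHom hγ (κ * (hsa a).toGroup), _, rfl⟩ :
      (unitHom (g := g) hγ).range)) l (𝓝 ⟨unitHom hγ y, y, rfl⟩) := tendsto_subtype_rng.2 h5
  have h8 : ∀ a, unitsToG hγ ⟨unitHom hγ (κ * (hsa a).toGroup), _, rfl⟩ = a := fun a => by
    rw [unitsToG_apply, map_mul, hκ, one_mul]
    rfl
  have h9 := map_mono (m := unitsToG hγ) h7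
  rw [map_map] at h9
  refine le_trans (le_of_eq ?_) h9
  rw [show (unitsToG hγ ∘ fun a => (⟨unitHom hγ (κ * (hsa a).toGroup), _, rfl⟩ :
    (unitHom (g := g) hγ).range)) = id from funext h8, map_id]

theorem isLieGroup_of_periodic (hγ : IsUnitSpeedGeodesic g γ) {p : ℝ} (hp : 0 < p)
    (hper : Function.Periodic γ p) : IsLieGroup (G g γ) := by
  refine isLieGroup_G hγ.smooth inferInstance inferInstance ?_
    (isOpenMap_unitsToG hγ.smooth hp hper) ?_
  · refine continuous_unitsToG hγ.smooth inferInstance fun y l h1 h2 => ?_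
    exact tendsto_subtype_rng.2
      (IsTranslation.tendsto hγ.smooth isTranslation (isTranslation y) h1 h2)
  · filter_upwards [eventually_eq_zero_of_apply_eq hγ] with s hs h
    refine hs ?_
    rw [← zero_add s, ← h 0]
    rfl

end Periodic

end TranslationGroup

end RiemGeod

/-! ### The main theorem -/

theorem mainTheorem2 {n : ℕ} {M : Type*} [TopologicalSpace M]
    [ChartedSpace (EuclideanSpace ℝ (Fin n)) M] [IsManifold (𝓡 n) ∞ M]
    [T2Space M] [SecondCountableTopology M] [ConnectedSpace M]
    (g : RiemGeod.Metric n M) (γ : ℝ → M) (hγ : RiemGeod.IsUnitSpeedGeodesic g γ) :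
    (RiemGeod.IsPeriodic γ →
      IsClosed (RiemGeod.G g γ : Set (RiemGeod.Isom g)) ∧
      CompactSpace (RiemGeod.G g γ) ∧
      RiemGeod.IsLieGroup (RiemGeod.G g γ)) ∧
    (¬ RiemGeod.IsPeriodic γ →
      (∀ (a : RiemGeod.G g γ) (s : ℝ), (∀ t, a.1.1 (γ t) = γ (t + s)) → s = RiemGeod.shift a) ∧
      @RiemGeod.IsLieGroup (RiemGeod.G g γ) _ (RiemGeod.naturalTopology g γ) ∧
      Continuous[RiemGeod.naturalTopology g γ, inferInstance]
        (Subtype.val : RiemGeod.G g γ → RiemGeod.Isom g) ∧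
      (∀ (a : RiemGeod.G g γ) (v w : TangentSpace (𝓡 n) (γ 0)),
        g.inner (γ 0) (RiemGeod.rotation a v) (RiemGeod.rotation a w) = g.inner (γ 0) v w) ∧
      (∀ a : RiemGeod.G g γ,
        RiemGeod.rotation a (RiemGeod.velocity n γ 0) = RiemGeod.velocity n γ 0) ∧
      (∀ a b : RiemGeod.G g γ, RiemGeod.shift (a * b) = RiemGeod.shift a + RiemGeod.shift b ∧
        RiemGeod.rotation (a * b) = (RiemGeod.rotation a).comp (RiemGeod.rotation b)) ∧
      Function.Injective (RiemGeod.development g γ) ∧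
      IsClosed (Set.range (RiemGeod.development g γ))) := by
  refine ⟨fun hper => ?_, fun hper => ⟨?_, ?_, ?_, ?_, ?_, ?_, ?_, ?_⟩⟩
  · obtain ⟨p, hp, hper⟩ := hper
    have hc := RiemGeod.compactSpace_G (g := g) hγ.smooth hp hper
    exact ⟨(isCompact_iff_compactSpace.2 hc).isClosed, hc, RiemGeod.isLieGroup_of_periodic hγ hp hper⟩
  · exact fun a s h => RiemGeod.IsTranslation.eq_shift hper h
  · exact RiemGeod.isLieGroup_naturalTopology hper hγ.smooth
  · exact RiemGeod.continuous_val_naturalTopology hγ.smooth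
  · intro a v w
    rw [RiemGeod.rotation_eq]
    exact RiemGeod.form_turn hγ.smooth (RiemGeod.shift_spec a) v w
  · intro a
    rw [RiemGeod.rotation_eq]
    exact RiemGeod.turn_vel hγ (RiemGeod.shift_spec a)
  · intro a b
    have hs : RiemGeod.shift (a * b) = RiemGeod.shift a + RiemGeod.shift b :=
      (RiemGeod.IsTranslation.eq_shift hper
        (RiemGeod.IsTranslation.mul (RiemGeod.shift_spec a) (RiemGeod.shift_spec b))).symm
    refine ⟨hs, ?_⟩
    rw [RiemGeod.rotation_eq, RiemGeod.rotation_eq, RiemGeod.rotation_eq, hs]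
    exact RiemGeod.turn_mul hγ.smooth (RiemGeod.shift_spec a) (RiemGeod.shift_spec b)
  · rw [RiemGeod.development_eq]
    exact RiemGeod.modelDevelopment_injective hγ.smooth
  · rw [RiemGeod.development_eq]
    exact RiemGeod.isClosed_range_modelDevelopment hper hγ.smooth
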